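/- Let $n,d$ be natural numbers. There is a constant $C=C(n,d)$ such that the following holds. Let $X\subset\mathbb{A}^n_{\overline{\mathbb{Q}}}$ be an integral closed subvariety of dimension $m\le n-2$ and degree $d$ (the degree of $X$ being that of its closure in $\mathbb{P}^n$). Let $\overline{X}\subset\mathbb{P}^n_{\overline{\mathbb{Q}}}$ be its projective closure, and let $X_0=\overline{X}\cap H_0$, where $H_0$ denotes the hyperplane $x_0=0$ at infinity. Then there exist an $(m+1)\times n$ matrix $A$ and an $(m+1)$-vector $\mathbf{b}$, with integer entries of absolute value at most $C$, such that the morphism $\pi:X\to\mathbb{A}^{m+1}_{\overline{\mathbb{Q}}}$, $\mathbf{x}\mapsto A\mathbf{x}+\mathbf{b}$, is birational onto its image, its fibres consist of at most $d$ points, and $\pi(X)$ is an integral closed hypersurface of degree $d$. Moreover, $[x_0:\mathbf{x}]\mapsto[x_0:A\mathbf{x}+x_0\mathbf{b}]$ is defined at every point of $\overline{X}$ and gives a morphism $\bar\pi:\overline{X}\to\mathbb{P}^{m+1}_{\overline{\mathbb{Q}}}$ extending $\pi$, with the following property. Let $X_0=X_{0,1}\cup\dots\cup X_{0,k}$ be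 the decomposition of $X_0$, with its reduced structure, into irreducible components, and let $d_i=\deg X_{0,i}$. Then the restriction $\bar\pi:X_{0,i}\to\mathbb{P}^{m+1}_{\overline{\mathbb{Q}}}$ is birational onto its image for each $i$, and \[ \bar\pi(\overline{X})\cap H_0=\bar\pi(X_0)=\bar\pi(X_{0,1})\cup\dots\cup\bar\pi(X_{0,k}), \] where each $\bar\pi(X_{0,i})$ is an integral closed subvariety of dimension $m-1$ and degree $d_i$. -/

import Mathlib

open MvPolynomial Filter Topology
open scoped LinearAlgebra.Projectivization

namespace BirationalProjection

/-- The base field, an algebraic closure of the rational numbers. -/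
abbrev Qbar : Type := AlgebraicClosure ℚ

noncomputable section

/-- The closed points of affine `n`-space over `Qbar`. -/
def Aff (n : ℕ) : Type := Fin n → Qbar

/-- The closed points of projective `n`-space over `Qbar`, with coordinates `x₀, …, xₙ`. -/
abbrev Proj (n : ℕ) : Type := ℙ Qbar (Fin (n + 1) → Qbar)

/-- The common zeros in affine space of a set of polynomials. -/
def affZeros {n : ℕ} (S : Set (MvPolynomial (Fin n) Qbar)) : Set (Aff n) :=
  {x | ∀ f ∈ S, eval x f = 0}

/-- The common zeros in projective space of a set of polynomials; this is used for homogeneous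
polynomials only, where vanishing does not depend on the representative of the point. -/
def projZeros {n : ℕ} (S : Set (MvPolynomial (Fin (n + 1)) Qbar)) : Set (Proj n) :=
  {p | ∀ f ∈ S, eval p.rep f = 0}

/-- The Zariski topology on affine space. -/
instance affTopology (n : ℕ) : TopologicalSpace (Aff n) :=
  TopologicalSpace.ofClosed {Z | ∃ S, Z = affZeros S}
    ⟨{1}, by ext x; simp [affZeros]⟩
    (by
      intro 𝒜 h𝒜
      refine ⟨{f | ∀ x ∈ ⋂₀ 𝒜, eval x f = 0}, ?_⟩
      ext x
      refine ⟨fun hx f hf => hf x hx, fun hx => ?_⟩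
      rw [Set.mem_sInter]
      intro Z hZ
      obtain ⟨S, rfl⟩ := h𝒜 hZ
      exact fun f hf => hx f fun y hy => (Set.mem_sInter.1 hy) _ hZ f hf)
    (by
      rintro _ ⟨S, rfl⟩ _ ⟨T, rfl⟩
      refine ⟨{h | ∃ f ∈ S, ∃ g ∈ T, h = f * g}, ?_⟩
      ext x
      constructor
      · rintro (hx | hx) _ ⟨f, hf, g, hg, rfl⟩
        · simp [hx f hf]
        · simp [hx g hg]
      · intro hx
        by_contra hcon
        simp only [affZeros, Set.mem_union, Set.mem_ofPred_eq, not_or, not_forall] at hcon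
        obtain ⟨⟨f, hf, hf0⟩, ⟨g, hg, hg0⟩⟩ := hcon
        have := hx _ ⟨f, hf, g, hg, rfl⟩
        rw [map_mul] at this
        exact (mul_ne_zero hf0 hg0) this)

/-- The Zariski topology on projective space: the closed sets are the zero sets of sets of
homogeneous polynomials. -/
instance projTopology (n : ℕ) : TopologicalSpace (Proj n) :=
  TopologicalSpace.ofClosed
    {Z | ∃ S, (∀ f ∈ S, ∃ e : ℕ, f.IsHomogeneous e) ∧ Z = projZeros S}
    ⟨{1}, by simpa using ⟨0, isHomogeneous_one _ _⟩, by ext x; simp [projZeros]⟩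
    (by
      intro 𝒜 h𝒜
      refine ⟨{f | (∃ e : ℕ, f.IsHomogeneous e) ∧ ∀ p ∈ ⋂₀ 𝒜, eval p.rep f = 0},
        fun f hf => hf.1, ?_⟩
      ext x
      refine ⟨fun hx f hf => hf.2 x hx, fun hx => ?_⟩
      rw [Set.mem_sInter]
      intro Z hZ
      obtain ⟨S, hS, rfl⟩ := h𝒜 hZ
      exact fun f hf => hx f ⟨hS f hf, fun y hy => (Set.mem_sInter.1 hy) _ hZ f hf⟩)
    (by
      rintro _ ⟨S, hS, rfl⟩ _ ⟨T, hT, rfl⟩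
      refine ⟨{h | ∃ f ∈ S, ∃ g ∈ T, h = f * g}, ?_, ?_⟩
      · rintro _ ⟨f, hf, g, hg, rfl⟩
        obtain ⟨a, ha⟩ := hS f hf
        obtain ⟨b, hb⟩ := hT g hg
        exact ⟨a + b, ha.mul hb⟩
      ext x
      constructor
      · rintro (hx | hx) _ ⟨f, hf, g, hg, rfl⟩
        · simp [hx f hf]
        · simp [hx g hg]
      · intro hx
        by_contra hcon
        simp only [projZeros, Set.mem_union, Set.mem_ofPred_eq, not_or, not_forall] at hcon
        obtain ⟨⟨f, hf, hf0⟩, ⟨g, hg, hg0⟩⟩ := hcon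
        have := hx _ ⟨f, hf, g, hg, rfl⟩
        rw [map_mul] at this
        exact (mul_ne_zero hf0 hg0) this)

/-- The embedding of affine space in projective space, `x ↦ [1 : x₁ : ⋯ : xₙ]`. -/
def affToProj {n : ℕ} (x : Aff n) : Proj n :=
  Projectivization.mk Qbar (Fin.cons 1 x : Fin (n + 1) → Qbar)
    (fun h => one_ne_zero (congrFun h 0))

/-- The hyperplane at infinity `x₀ = 0`. -/
def H₀ (n : ℕ) : Set (Proj n) := {p | p.rep 0 = 0}

/-- The projective closure of a subset of affine space. -/
def projClosure {n : ℕ} (X : Set (Aff n)) : Set (Proj n) := closure (affToProj '' X)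

/-- The irreducible components of a subset of projective space: its maximal irreducible
subsets. -/
def components {n : ℕ} (Z : Set (Proj n)) : Set (Set (Proj n)) :=
  {W | Maximal (fun V : Set (Proj n) => IsIrreducible V ∧ V ⊆ Z) W}

/-- The homogeneous ideal of a subset of projective space: the polynomials that vanish on all
representatives of all its points. -/
def homIdeal {n : ℕ} (Z : Set (Proj n)) : Ideal (MvPolynomial (Fin (n + 1)) Qbar) :=
  vanishingIdeal Qbar {v | ∃ hv : v ≠ 0, Projectivization.mk Qbar v hv ∈ Z}

/-- The Hilbert function of a subset of projective space: the dimension of the degree `t` part of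
its homogeneous coordinate ring. -/
def hilbertFunction {n : ℕ} (Z : Set (Proj n)) (t : ℕ) : ℕ :=
  Module.finrank Qbar
    (homogeneousSubmodule (Fin (n + 1)) Qbar t ⧸
      ((homIdeal Z).restrictScalars Qbar).comap
        (homogeneousSubmodule (Fin (n + 1)) Qbar t).subtype)

/-- A closed subset `Z` of projective space has degree `d`: its dimension is a natural number `r`,
and the leading term of its Hilbert function is `(d / r!) t ^ r`. -/
def HasDegree {n : ℕ} (Z : Set (Proj n)) (d : ℕ) : Prop :=
  ∃ r : ℕ, topologicalKrullDim Z = r ∧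
    Tendsto (fun t : ℕ => (r.factorial : ℝ) * hilbertFunction Z t / (t : ℝ) ^ r) atTop (𝓝 (d : ℝ))

/-- `W` is an integral hypersurface of degree `d` in affine space. -/
def IsIntegralHypersurface {n : ℕ} (W : Set (Aff n)) (d : ℕ) : Prop :=
  ∃ f : MvPolynomial (Fin n) Qbar, Irreducible f ∧ f.totalDegree = d ∧ W = affZeros {f}

/-- `φ` is regular on the subset `U` of affine space: near each point of `U` it is given on `U` by
quotients of polynomials. -/
def AffRegularOn {n k : ℕ} (U : Set (Aff n)) (φ : Aff n → Aff k) : Prop :=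
  ∀ p ∈ U, ∃ O : Set (Aff n), IsOpen O ∧ p ∈ O ∧
    ∃ (g : MvPolynomial (Fin n) Qbar) (F : Fin k → MvPolynomial (Fin n) Qbar),
      ∀ x ∈ U ∩ O, eval x g ≠ 0 ∧ ∀ i, φ x i = eval x (F i) / eval x g

/-- `φ` is regular on the subset `U` of projective space: near each point of `U` it is given on `U`
by homogeneous polynomials of the same degree without common zero. -/
def ProjRegularOn {n k : ℕ} (U : Set (Proj n)) (φ : Proj n → Proj k) : Prop :=
  ∀ p ∈ U, ∃ O : Set (Proj n), IsOpen O ∧ p ∈ O ∧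
    ∃ (e : ℕ) (F : Fin (k + 1) → MvPolynomial (Fin (n + 1)) Qbar),
      (∀ i, (F i).IsHomogeneous e) ∧
      ∀ (v : Fin (n + 1) → Qbar) (hv : v ≠ 0), Projectivization.mk Qbar v hv ∈ U ∩ O →
        ∃ hF : (fun i => eval v (F i)) ≠ 0,
          φ (Projectivization.mk Qbar v hv) = Projectivization.mk Qbar (fun i => eval v (F i)) hF

/-- `φ` is birational from the irreducible set `X` onto its image: it restricts to an isomorphism
from a nonempty open subset of `X` to a nonempty open subset of `φ(X)`. -/
def AffBirationalOntoImage {n k : ℕ} (X : Set (Aff n)) (φ : Aff n → Aff k) : Prop :=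
  ∃ (O : Set (Aff n)) (P : Set (Aff k)) (ψ : Aff k → Aff n),
    IsOpen O ∧ IsOpen P ∧ (X ∩ O).Nonempty ∧
    AffRegularOn (X ∩ O) φ ∧ AffRegularOn (φ '' X ∩ P) ψ ∧
    Set.MapsTo φ (X ∩ O) (φ '' X ∩ P) ∧ Set.MapsTo ψ (φ '' X ∩ P) (X ∩ O) ∧
    Set.InvOn ψ φ (X ∩ O) (φ '' X ∩ P)

/-- `φ` is birational from the irreducible set `X` onto its image: it restricts to an isomorphism
from a nonempty open subset of `X` to a nonempty open subset of `φ(X)`. -/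
def ProjBirationalOntoImage {n k : ℕ} (X : Set (Proj n)) (φ : Proj n → Proj k) : Prop :=
  ∃ (O : Set (Proj n)) (P : Set (Proj k)) (ψ : Proj k → Proj n),
    IsOpen O ∧ IsOpen P ∧ (X ∩ O).Nonempty ∧
    ProjRegularOn (X ∩ O) φ ∧ ProjRegularOn (φ '' X ∩ P) ψ ∧
    Set.MapsTo φ (X ∩ O) (φ '' X ∩ P) ∧ Set.MapsTo ψ (φ '' X ∩ P) (X ∩ O) ∧
    Set.InvOn ψ φ (X ∩ O) (φ '' X ∩ P)

/-- The affine map `x ↦ A x + b`. -/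
def affMap {n k : ℕ} (A : Matrix (Fin k) (Fin n) ℤ) (b : Fin k → ℤ) (x : Aff n) : Aff k :=
  fun i => ∑ j, (A i j : Qbar) * x j + (b i : Qbar)

/-- The homogenization `(x₀, x) ↦ (x₀, A x + x₀ b)` of the affine map `x ↦ A x + b`. -/
def homMap {n k : ℕ} (A : Matrix (Fin k) (Fin n) ℤ) (b : Fin k → ℤ)
    (v : Fin (n + 1) → Qbar) : Fin (k + 1) → Qbar :=
  Fin.cons (v 0) (fun i => ∑ j, (A i j : Qbar) * v j.succ + (b i : Qbar) * v 0)

/-- `φ` is on `Z` the morphism of projective spaces induced by `x ↦ A x + b`, that is,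
`[x₀ : x] ↦ [x₀ : A x + x₀ b]`; in particular the latter is defined at every point of `Z`. -/
def IsInducedOn {n k : ℕ} (A : Matrix (Fin k) (Fin n) ℤ) (b : Fin k → ℤ) (Z : Set (Proj n))
    (φ : Proj n → Proj k) : Prop :=
  ∀ (v : Fin (n + 1) → Qbar) (hv : v ≠ 0), Projectivization.mk Qbar v hv ∈ Z →
    ∃ h : homMap A b v ≠ 0,
      φ (Projectivization.mk Qbar v hv) = Projectivization.mk Qbar (homMap A b v) h

end

end BirationalProjection

open BirationalProjection

/-! Let x be a generic point of the affine cone over the projective closure of X, with coordinates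
in the field E they generate: the relations between its coordinates are the equations of the cone,
and every point of the cone is a specialization of x. If x₀, ℓ₁, …, ℓᵣ are linear forms without
common zero on the cone but the origin, then x is integral over the algebra they generate
(`IsConical.isIntegral_of_forall_eq_zero`). If moreover they are algebraically independent at x,
then r is the dimension (`IsGenericPoint.topologicalKrullDim_eq`), the degree of E over the field
they generate is the degree d (`IsGenericPoint.hasDegree`), and every fibre of the finite map they
define has at most d points (`card_le_finrank_of_specializes`).

This uniform bound on the fibres is what makes C depend on n and d only. Each row of A is a vector
(1, t, …, tⁿ⁻¹), and a form with such coefficients vanishes at a given nonzero vector for at most n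
values of t. Starting from any Noether normalization that keeps x₀, the forms are replaced one at a
time; a new form only has to be nonzero at d or fewer points, so some t ≤ nd works
(`HasNoCommonZero.exists_update`). The last row has to separate the points of two fibres, over a
generic point and over a generic point of x₀ = 0, which excludes at most 2nd² values of t. The
translation b can be zero.

A form that separates a geometric generic fibre is a primitive element
(`adjoin_singleton_eq_top_of_injOn`), so adding the last row makes the projection birational onto
its image. The minimal polynomial of that form, which is homogeneous of degree d and monic, is the
equation of the image (`exists_generator_ker_aeval`).

At infinity, the prime ideal of each component of X₀ lies over the ideal (x₀) of the polynomial ring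
(`comap_bind₁_eq_span_of_mem_minimalPrimes`, a version of Krull's principal ideal theorem for finite
maps). Hence ℓ₁, …, ℓₘ normalize every component, and the generic fibre of a component is contained
in the fibre of the whole cone over the generic point of x₀ = 0. The points of that fibre are
already separated, so a single last row serves all components at once
(`IsGenericPoint.projection_component`). -/

namespace BirationalProjection

open scoped IntermediateField.algebraAdjoinAdjoin

/-! ### Specializations of points, cones, and avoidance of hyperplanes -/

section Cones

variable {k E Ω : Type*} [Field k] [Field E] [Algebra k E] [Field Ω] [Algebra k Ω]
  {ι κ : Type*}

/-- Every polynomial relation over `k` between the coordinates of `x` holds for those of `v`. -/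
def Specializes (k : Type*) [Field k] {E Ω : Type*} [Field E] [Algebra k E] [Field Ω]
    [Algebra k Ω] {ι : Type*} (x : ι → E) (v : ι → Ω) : Prop :=
  ∀ p : MvPolynomial ι k, aeval x p = 0 → aeval v p = 0

/-- The ideal of polynomial relations over `k` between the coordinates of `x` is homogeneous. -/
def IsConical (k : Type*) [Field k] {E : Type*} [Field E] [Algebra k E] {ι : Type*}
    (x : ι → E) : Prop :=
  ∀ (p : MvPolynomial ι k) (t : ℕ), aeval x p = 0 → aeval x (homogeneousComponent t p) = 0

theorem homogeneousComponent_mul {p q : MvPolynomial ι k} {e : ℕ} (hq : q.IsHomogeneous e)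
    (t : ℕ) : homogeneousComponent (t + e) (p * q) = homogeneousComponent t p * q := by
  classical
  have h := sum_homogeneousComponent p
  conv_lhs => rw [← h, Finset.sum_mul, map_sum]
  have h1 : ∀ i, homogeneousComponent (t + e) (homogeneousComponent i p * q) =
      if i = t then homogeneousComponent t p * q else 0 := by
    intro i
    have := homogeneousComponent_of_mem (n := i + e) (m := t + e)
      ((homogeneousComponent_isHomogeneous i p).mul hq)
    rw [this]
    by_cases hi : i = t
    · subst hi; simp
    · rw [if_neg (by omega), if_neg hi]
  simp_rw [h1]
  rw [Finset.sum_ite_eq' (Finset.range (p.totalDegree + 1)) t]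
  split_ifs with ht
  · rfl
  · rw [homogeneousComponent_eq_zero _ _ (by simpa using ht), zero_mul]

theorem isHomogeneous_bind₁ {ℓ : κ → MvPolynomial ι k} (hℓ : ∀ i, (ℓ i).IsHomogeneous 1)
    {p : MvPolynomial κ k} {t : ℕ} (hp : p.IsHomogeneous t) : (bind₁ ℓ p).IsHomogeneous t := by
  have := hp.aeval ℓ hℓ
  rwa [one_mul] at this

theorem homogeneousComponent_bind₁ {ℓ : κ → MvPolynomial ι k} (hℓ : ∀ i, (ℓ i).IsHomogeneous 1)
    (p : MvPolynomial κ k) (t : ℕ) :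
    homogeneousComponent t (bind₁ ℓ p) = bind₁ ℓ (homogeneousComponent t p) := by
  classical
  conv_lhs => rw [← sum_homogeneousComponent p, map_sum, map_sum]
  have h1 : ∀ i, homogeneousComponent t (bind₁ ℓ (homogeneousComponent i p)) =
      if i = t then bind₁ ℓ (homogeneousComponent t p) else 0 := by
    intro i
    rw [homogeneousComponent_of_mem (n := i)
      (isHomogeneous_bind₁ hℓ (homogeneousComponent_isHomogeneous i p))]
    by_cases hi : i = t
    · subst hi; simp
    · rw [if_neg (Ne.symm hi), if_neg hi]
  simp_rw [h1]
  rw [Finset.sum_ite_eq' (Finset.range (p.totalDegree + 1)) t]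
  split_ifs with ht
  · rfl
  · rw [homogeneousComponent_eq_zero _ _ (by simpa using ht), map_zero]

theorem exists_homogeneousComponent_ne_zero {p : MvPolynomial ι k} (hp : p ≠ 0) :
    ∃ t, homogeneousComponent t p ≠ 0 := by
  by_contra! h
  exact hp (by rw [← sum_homogeneousComponent p]; simp [h])

theorem aeval_bind₁_eq (v : ι → Ω) (ℓ : κ → MvPolynomial ι k) (p : MvPolynomial κ k) :
    aeval v (bind₁ ℓ p) = aeval (fun i => aeval v (ℓ i)) p :=
  aeval_bind₁ _ _ _

theorem aeval_smul_of_isHomogeneous {p : MvPolynomial ι k} {t : ℕ} (hp : p.IsHomogeneous t)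
    (c : Ω) (v : ι → Ω) : aeval (c • v) p = c ^ t * aeval v p := by
  classical
  rw [aeval_def, aeval_def, eval₂_eq, eval₂_eq, Finset.mul_sum]
  refine Finset.sum_congr rfl fun d hd => ?_
  have h : d.degree = t := by
    by_contra h
    exact (mem_support_iff.1 hd) (hp.coeff_eq_zero h)
  simp only [Pi.smul_apply, smul_eq_mul, mul_pow, Finset.prod_mul_distrib, Finset.prod_pow_eq_pow_sum]
  rw [← h, Finsupp.degree_apply]
  ring

theorem Specializes.trans {E' : Type*} [Field E'] [Algebra k E'] {x : ι → E} {x' : ι → E'}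
    {v : ι → Ω} (h : Specializes k x x') (h' : Specializes k x' v) : Specializes k x v :=
  fun p hp => h' p (h p hp)

theorem Specializes.comp {x : ι → E} {v : ι → Ω} (h : Specializes k x v)
    (ℓ : κ → MvPolynomial ι k) :
    Specializes k (fun i => aeval x (ℓ i)) (fun i => aeval v (ℓ i)) := by
  intro p hp
  rw [← aeval_bind₁_eq] at hp ⊢
  exact h _ hp

theorem Specializes.of_algHom {x : ι → E} (f : E →ₐ[k] Ω) : Specializes k x (fun i => f (x i)) := by
  intro p hp
  have : aeval (fun i => f (x i)) p = f (aeval x p) := by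
    rw [MvPolynomial.comp_aeval_apply]
  rw [this, hp, map_zero]

theorem IsConical.comp {x : ι → E} (h : IsConical k x) {ℓ : κ → MvPolynomial ι k}
    (hℓ : ∀ i, (ℓ i).IsHomogeneous 1) : IsConical k (fun i => aeval x (ℓ i)) := by
  intro p t hp
  rw [← aeval_bind₁_eq] at hp ⊢
  rw [← homogeneousComponent_bind₁ hℓ]
  exact h _ _ hp

/-- Each homogeneous component of a relation is again a relation, and on a form of degree t scaling
only contributes a factor cᵗ. -/
theorem IsConical.specializes_smul {x : ι → E} (h : IsConical k x) {v : ι → Ω}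
    (hv : Specializes k x v) (c : Ω) : Specializes k x (c • v) := by
  intro p hp
  rw [← sum_homogeneousComponent p, map_sum]
  refine Finset.sum_eq_zero fun t _ => ?_
  rw [aeval_smul_of_isHomogeneous (homogeneousComponent_isHomogeneous t p), hv _ (h p t hp),
    mul_zero]

/-- Vectors of powers of a natural number avoid finitely many hyperplanes. -/
theorem exists_nat_forall_sum_pow_ne_zero [CharZero Ω] {n : ℕ} (T : Finset (Fin n → Ω))
    (hT : ∀ v ∈ T, v ≠ 0) : ∃ B : Finset ℕ, B.card ≤ n * T.card ∧
      ∀ t ∉ B, ∀ v ∈ T, ∑ j : Fin n, (t : Ω) ^ (j : ℕ) * v j ≠ 0 := by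
  classical
  -- The value at v of the form with coefficients tʲ is a polynomial in t whose coefficients are the
  -- entries of v. It is nonzero and has at most n roots.
  let P : (Fin n → Ω) → Polynomial Ω := fun v => ∑ j : Fin n, Polynomial.C (v j) * Polynomial.X ^ (j : ℕ)
  have hP : ∀ v t, (P v).eval t = ∑ j : Fin n, t ^ (j : ℕ) * v j := by
    intro v t
    simp only [P, Polynomial.eval_finsetSum, Polynomial.eval_mul, Polynomial.eval_C,
      Polynomial.eval_pow, Polynomial.eval_X]
    exact Finset.sum_congr rfl fun j _ => mul_comm _ _
  have hP0 : ∀ v, v ≠ 0 → P v ≠ 0 := by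
    intro v hv h
    apply hv
    funext j
    have := congrArg (fun q => Polynomial.coeff q (j : ℕ)) h
    simp only [P, Polynomial.finsetSum_coeff, Polynomial.coeff_C_mul_X_pow, ← Fin.ext_iff,
      Finset.sum_ite_eq, Finset.mem_univ, if_true, Polynomial.coeff_zero] at this
    exact this
  have hdeg : ∀ v, (P v).natDegree ≤ n := by
    intro v
    refine Polynomial.natDegree_sum_le_of_forall_le _ _ fun j _ => ?_
    exact (Polynomial.natDegree_C_mul_X_pow_le _ _).trans j.2.le
  refine ⟨T.biUnion fun v => (P v).roots.toFinset.preimage (fun t : ℕ => (t : Ω))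
    (Nat.cast_injective.injOn), ?_, ?_⟩
  · refine (Finset.card_biUnion_le_card_mul _ _ n ?_).trans (by rw [mul_comm])
    intro v _
    rw [Finset.card_preimage]
    refine (Finset.card_filter_le _ _).trans ((Multiset.toFinset_card_le _).trans ?_)
    exact ((P v).card_roots').trans (hdeg v)
  · intro t ht v hv h
    apply ht
    simp only [Finset.mem_biUnion, Finset.mem_preimage, Multiset.mem_toFinset]
    refine ⟨v, hv, ?_⟩
    rw [Polynomial.mem_roots (hP0 v (hT v hv)), Polynomial.IsRoot, hP, h]

end Cones

/-! ### Integrality over linear forms, and the size of the fibres -/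

section Integrality

variable {k E Ω : Type*} [Field k] [Field E] [Algebra k E] [Field Ω] [Algebra k Ω]
  {ι κ : Type*}

/-- A conical point is integral over the subalgebra generated by finitely many linear forms in its
coordinates if these have no common zero but the origin on the corresponding cone. -/
theorem IsConical.isIntegral_of_forall_eq_zero [IsAlgClosed k] [Finite ι] [Finite κ] {x : ι → E}
    (hx : IsConical k x) {ℓ : κ → MvPolynomial ι k} (hℓ : ∀ i, (ℓ i).IsHomogeneous 1)
    (h : ∀ v : ι → k, Specializes k x v → (∀ i, aeval v (ℓ i) = 0) → v = 0) (j : ι) :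
    IsIntegral (Algebra.adjoin k (Set.range fun i => aeval x (ℓ i))) (x j) := by
  classical
  have := Fintype.ofFinite ι
  have := Fintype.ofFinite κ
  set A := Algebra.adjoin k (Set.range fun i => aeval x (ℓ i)) with hA
  -- The zero locus of J is at most the origin, so by the Nullstellensatz some power of every
  -- variable lies in J.
  let J : Ideal (MvPolynomial ι k) := RingHom.ker (aeval x) ⊔ Ideal.span (Set.range ℓ)
  have hJ : ∀ j, ∃ N, (X j : MvPolynomial ι k) ^ N ∈ J := by
    intro j
    have : (X j : MvPolynomial ι k) ∈ J.radical := by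
      rw [← vanishingIdeal_zeroLocus_eq_radical (K := k), mem_vanishingIdeal_iff]
      intro v hv
      have hv' := (mem_zeroLocus_iff.1 hv)
      have : v = 0 := h v (fun p hp => hv' p (Ideal.mem_sup_left hp))
        (fun i => hv' _ (Ideal.mem_sup_right (Ideal.subset_span ⟨i, rfl⟩)))
      simp [this]
    exact this
  choose N' hN' using hJ
  -- A common exponent for all variables; the 1 makes it positive, so that N - 1 is the degree of
  -- the cofactors of the linear forms.
  let N := ∑ j, N' j + 1
  have hN : ∀ j, ∃ g : κ → MvPolynomial ι k, (∀ i, (g i).IsHomogeneous (N - 1)) ∧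
      x j ^ N = ∑ i, aeval x (ℓ i) * aeval x (g i) := by
    intro j
    have hle : N' j ≤ N := (Finset.single_le_sum (f := N') (fun _ _ => Nat.zero_le _)
      (Finset.mem_univ j)).trans (Nat.le_succ _)
    have hm : (X j : MvPolynomial ι k) ^ N ∈ J := J.mem_of_dvd (pow_dvd_pow _ hle) (hN' j)
    obtain ⟨a, ha, b, hb, hab⟩ := Submodule.mem_sup.1 hm
    obtain ⟨c, rfl⟩ := Ideal.mem_span_range_iff_exists_fun.1 hb
    have h1 : aeval x ((X j : MvPolynomial ι k) ^ N - ∑ i, c i * ℓ i) = 0 := by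
      rw [← hab, add_sub_cancel_right]; exact ha
    -- Conicality allows passing to the component of degree N, which makes the cofactors homogeneous
    -- of degree N - 1.
    have h2 := hx _ (N - 1 + 1) h1
    rw [map_sub, map_sum] at h2
    simp_rw [homogeneousComponent_mul (hℓ _)] at h2
    have h3 : homogeneousComponent (N - 1 + 1) ((X j : MvPolynomial ι k) ^ N) = X j ^ N :=
      homogeneousComponent_eq_self (by simpa [N] using isHomogeneous_X_pow (R := k) j N)
    rw [h3] at h2
    refine ⟨fun i => homogeneousComponent (N - 1) (c i),
      fun i => homogeneousComponent_isHomogeneous _ _, ?_⟩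
    rw [map_sub, sub_eq_zero, map_pow, aeval_X, map_sum] at h2
    rw [h2]
    simp [mul_comm]
  choose g hg hgN using hN
  -- A monomial outside G has some exponent at least N, and the formula for x j ^ N rewrites it
  -- through monomials of degree one less with coefficients in A. So the monomials in G span a
  -- finitely generated A-module stable under every x j.
  let G : Set (ι →₀ ℕ) := {s | s.degree ≤ Fintype.card ι * N}
  let mon : (ι →₀ ℕ) → E := fun s => aeval x (monomial s (1 : k))
  let M : Submodule A E := Submodule.span A (mon '' G)
  have hk : ∀ (c : k) (e : E), e ∈ M → c • e ∈ M := by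
    intro c e he
    rw [← algebraMap_smul A c e]
    exact M.smul_mem _ he
  have hmem : ∀ D, ∀ s : ι →₀ ℕ, s.degree ≤ D → mon s ∈ M := by
    intro D
    induction D with
    | zero =>
      intro s hs
      exact Submodule.subset_span ⟨s, hs.trans (Nat.zero_le _), rfl⟩
    | succ D ih =>
      intro s hs
      by_cases hsG : s ∈ G
      · exact Submodule.subset_span ⟨s, hsG, rfl⟩
      have : ∃ j, N ≤ s j := by
        by_contra! hcon
        apply hsG
        change s.degree ≤ _
        rw [Finsupp.degree_eq_sum]
        calc ∑ i, s i ≤ ∑ _i : ι, N := Finset.sum_le_sum fun i _ => (hcon i).le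
          _ = _ := by simp
      obtain ⟨j, hj⟩ := this
      obtain ⟨s', rfl⟩ : ∃ s', s = Finsupp.single j N + s' := by
        refine ⟨s - Finsupp.single j N, ?_⟩
        rw [add_tsub_cancel_of_le]
        exact Finsupp.single_le_iff.2 hj
      have e1 : mon (Finsupp.single j N + s') =
          ∑ i, aeval x (ℓ i) * aeval x (g j i * monomial s' (1 : k)) := by
        have : (monomial (Finsupp.single j N + s') (1 : k)) = X j ^ N * monomial s' 1 := by
          rw [X_pow_eq_monomial, monomial_mul, one_mul]
        simp only [mon]
        rw [this, map_mul, map_pow, aeval_X, hgN j, Finset.sum_mul]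
        exact Finset.sum_congr rfl fun i _ => by rw [map_mul, mul_assoc]
      rw [e1]
      refine Submodule.sum_mem _ fun i _ => ?_
      have hyi : aeval x (ℓ i) ∈ A := Algebra.subset_adjoin ⟨i, rfl⟩
      change (⟨_, hyi⟩ : A) • aeval x (g j i * monomial s' (1 : k)) ∈ M
      refine M.smul_mem _ ?_
      have hhom : (g j i * monomial s' (1 : k)).IsHomogeneous (N - 1 + s'.degree) :=
        (hg j i).mul (isHomogeneous_monomial _ rfl)
      rw [as_sum (g j i * monomial s' (1 : k)), map_sum]
      refine Submodule.sum_mem _ fun u hu => ?_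
      have hu' : u.degree = N - 1 + s'.degree := by
        by_contra hne
        exact (mem_support_iff.1 hu) (hhom.coeff_eq_zero hne)
      rw [← mul_one (coeff u _), ← smul_eq_mul, ← smul_monomial, map_smul]
      refine hk _ _ (ih u ?_)
      rw [map_add, Finsupp.degree_single] at hs
      rw [hu']
      simp only [N] at hs ⊢
      omega
  refine isIntegral_of_smul_mem_submodule M ?_ ?_ (x j) ?_
  · intro hbot
    have h1 : mon 0 ∈ M := hmem 0 0 (by simp)
    rw [hbot, Submodule.mem_bot] at h1
    simp [mon] at h1
  · exact Submodule.fg_span ((Finsupp.finite_of_degree_le _).image _)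
  · intro e he
    induction he using Submodule.span_induction with
    | mem e he =>
      obtain ⟨s, -, rfl⟩ := he
      have : x j • mon s = mon (Finsupp.single j 1 + s) := by
        simp only [mon, smul_eq_mul]
        have : monomial (Finsupp.single j 1 + s) (1 : k) = X j * monomial s 1 := by
          rw [X, monomial_mul, one_mul]
        rw [this, map_mul, aeval_X]
      rw [this]
      exact hmem _ _ le_rfl
    | zero => rw [smul_zero]; exact M.zero_mem
    | add a b _ _ ha hb => rw [smul_add]; exact M.add_mem ha hb
    | smul a b _ hb => rw [smul_comm]; exact M.smul_mem _ hb

/-- Written with polynomial coefficients, an integral equation can be evaluated at points other than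
y. -/
theorem exists_polynomial_lift {y : κ → E} (q : Polynomial (Algebra.adjoin k (Set.range y)))
    (hq : q.Monic) : ∃ q' : Polynomial (MvPolynomial κ k), q'.Monic ∧
      q'.natDegree = q.natDegree ∧ ∀ e : E,
        q'.eval₂ (aeval y : MvPolynomial κ k →ₐ[k] E).toRingHom e = Polynomial.aeval e q := by
  let f : MvPolynomial κ k →ₐ[k] Algebra.adjoin k (Set.range y) :=
    aeval fun i => ⟨y i, Algebra.subset_adjoin ⟨i, rfl⟩⟩
  have hf : (algebraMap (Algebra.adjoin k (Set.range y)) E).comp f.toRingHom =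
      (aeval y : MvPolynomial κ k →ₐ[k] E).toRingHom := by
    ext
    · simp [f]
    · simp [f]
  have hsurj : Function.Surjective f := by
    rintro ⟨a, ha⟩
    have ha' := ha
    rw [Algebra.adjoin_range_eq_range_aeval] at ha'
    obtain ⟨p, hp⟩ := ha'
    refine ⟨p, Subtype.ext ?_⟩
    have := congrArg (fun g => g p) hf
    exact this.trans hp
  have hl : q ∈ Polynomial.lifts f.toRingHom := by
    rw [Polynomial.mem_lifts]
    exact Polynomial.map_surjective f.toRingHom hsurj q
  obtain ⟨q', h1, h2, h3⟩ := Polynomial.lifts_and_natDegree_eq_and_monic hl hq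
  refine ⟨q', h3, h2, fun e => ?_⟩
  rw [← h1, Polynomial.aeval_def, Polynomial.eval₂_map, hf]

theorem eval₂_aeval_eq_aeval_eval₂ (z : ι → Ω) (ℓ : κ → MvPolynomial ι k) (p : MvPolynomial ι k)
    (q : Polynomial (MvPolynomial κ k)) :
    q.eval₂ (aeval fun i => aeval z (ℓ i) : MvPolynomial κ k →ₐ[k] Ω).toRingHom (aeval z p) =
      aeval z (q.eval₂ (bind₁ ℓ).toRingHom p) := by
  have h1 := Polynomial.hom_eval₂ q (bind₁ ℓ).toRingHom
    (aeval z : MvPolynomial ι k →ₐ[k] Ω).toRingHom p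
  have h2 : ((aeval z : MvPolynomial ι k →ₐ[k] Ω).toRingHom).comp (bind₁ ℓ).toRingHom =
      (aeval fun i => aeval z (ℓ i) : MvPolynomial κ k →ₐ[k] Ω).toRingHom := by
    ext <;> simp
  rw [h2] at h1
  exact h1.symm

/-- An integral equation at x becomes a polynomial relation between the coordinates of x once the
forms are substituted into its coefficients, so it passes to specializations. -/
theorem Specializes.eval₂_eq_zero {x : ι → E} {v : ι → Ω} (h : Specializes k x v)
    (ℓ : κ → MvPolynomial ι k) (p : MvPolynomial ι k) {q : Polynomial (MvPolynomial κ k)}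
    (hq : q.eval₂ (aeval fun i => aeval x (ℓ i) : MvPolynomial κ k →ₐ[k] E).toRingHom
      (aeval x p) = 0) :
    q.eval₂ (aeval fun i => aeval v (ℓ i) : MvPolynomial κ k →ₐ[k] Ω).toRingHom
      (aeval v p) = 0 := by
  rw [eval₂_aeval_eq_aeval_eval₂] at hq ⊢
  exact h _ hq

/-- The converse of `IsConical.isIntegral_of_forall_eq_zero`. All multiples c • v lie on the cone
and the forms vanish there, so their j-th coordinates are roots of one monic polynomial with fixed
coefficients. If v j were nonzero, there would be infinitely many roots. -/
theorem IsConical.eq_zero_of_isIntegral [Infinite k] {x : ι → E} (hx : IsConical k x)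
    {ℓ : κ → MvPolynomial ι k} (hℓ : ∀ i, (ℓ i).IsHomogeneous 1)
    (hint : ∀ j, IsIntegral (Algebra.adjoin k (Set.range fun i => aeval x (ℓ i))) (x j))
    {v : ι → Ω} (hv : Specializes k x v) (hv0 : ∀ i, aeval v (ℓ i) = 0) : v = 0 := by
  funext j
  by_contra hj
  obtain ⟨q, hqm, hq⟩ := hint j
  obtain ⟨q', hq'm, -, hq'⟩ := exists_polynomial_lift q hqm
  have h0 := (hq' (x j)).trans hq
  set f := (aeval (0 : κ → Ω) : MvPolynomial κ k →ₐ[k] Ω).toRingHom with hf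
  have hroot : ∀ c : k, (q'.map f).IsRoot (algebraMap k Ω c * v j) := by
    intro c
    have h1 := (hx.specializes_smul hv (algebraMap k Ω c)).eval₂_eq_zero ℓ (X j) (q := q')
      (by rw [aeval_X]; exact h0)
    have h2 : (fun i => aeval (algebraMap k Ω c • v) (ℓ i)) = (0 : κ → Ω) := by
      funext i
      rw [aeval_smul_of_isHomogeneous (hℓ i), hv0 i, mul_zero, Pi.zero_apply]
    rw [h2, aeval_X] at h1
    rw [Polynomial.IsRoot, Polynomial.eval_map]
    exact h1
  refine (hq'm.map f).ne_zero (Polynomial.eq_zero_of_infinite_isRoot _ ?_)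
  refine (Set.infinite_range_of_injective (f := fun c : k => algebraMap k Ω c * v j) ?_).mono ?_
  · intro a b hab
    exact (algebraMap k Ω).injective (mul_right_cancel₀ hj hab)
  · rintro _ ⟨c, rfl⟩
    exact hroot c

theorem isIntegrallyClosed_adjoin {y : κ → E} (hy : AlgebraicIndependent k y) :
    IsIntegrallyClosed (Algebra.adjoin k (Set.range y)) :=
  IsIntegrallyClosed.of_equiv hy.aevalEquiv.toRingEquiv

theorem finiteDimensional_of_isIntegral [Finite ι] {x : ι → E} {y : κ → E}
    (hgen : IntermediateField.adjoin k (Set.range x) = ⊤)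
    (hint : ∀ j, IsIntegral (Algebra.adjoin k (Set.range y)) (x j)) :
    FiniteDimensional (IntermediateField.adjoin k (Set.range y)) E := by
  set K := IntermediateField.adjoin k (Set.range y)
  have h1 : FiniteDimensional K (IntermediateField.adjoin K (Set.range x)) := by
    apply IntermediateField.finiteDimensional_adjoin
    rintro _ ⟨j, rfl⟩
    exact (hint j).tower_top
  have h2 : IntermediateField.adjoin K (Set.range x) = ⊤ := by
    rw [eq_top_iff]
    intro e _
    have : IntermediateField.adjoin k (Set.range x) ≤
        (IntermediateField.adjoin K (Set.range x)).restrictScalars k := by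
      rw [IntermediateField.adjoin_le_iff]
      exact IntermediateField.subset_adjoin K _
    exact this (hgen ▸ IntermediateField.mem_top)
  rw [h2] at h1
  exact LinearEquiv.finiteDimensional (IntermediateField.topEquiv (F := K) (E := E)).toLinearEquiv

/-- Separating the points of T means not vanishing at their pairwise differences. -/
theorem exists_sum_pow_injOn [CharZero Ω] {n : ℕ} (T : Finset (Fin n → Ω)) :
    ∃ B : Finset ℕ, B.card ≤ n * (T.card * T.card) ∧
      ∀ t ∉ B, Set.InjOn (fun v : Fin n → Ω => ∑ j : Fin n, (t : Ω) ^ (j : ℕ) * v j) T := by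
  classical
  obtain ⟨B, hB, h⟩ := exists_nat_forall_sum_pow_ne_zero
    (T.offDiag.image fun p => p.1 - p.2) (by
      intro v hv
      obtain ⟨p, hp, rfl⟩ := Finset.mem_image.1 hv
      exact sub_ne_zero.2 (Finset.mem_offDiag.1 hp).2.2)
  refine ⟨B, hB.trans (Nat.mul_le_mul_left _ (Finset.card_image_le.trans ?_)), ?_⟩
  · rw [Finset.offDiag_card]; omega
  · intro t ht a ha b hb hab
    by_contra hne
    refine h t ht (a - b) (Finset.mem_image.2 ⟨(a, b), Finset.mem_offDiag.2 ⟨ha, hb, hne⟩, rfl⟩) ?_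
    simpa [mul_sub, Finset.sum_sub_distrib, sub_eq_zero] using hab

/-- The number of points in a fibre of an integral morphism to an affine space is at most the
degree of the extension of function fields. -/
theorem card_le_finrank_of_specializes [CharZero Ω] {n : ℕ} {x : Fin n → E}
    {ℓ : κ → MvPolynomial (Fin n) k}
    (hy : AlgebraicIndependent k fun i => aeval x (ℓ i))
    (hint : ∀ j, IsIntegral (Algebra.adjoin k (Set.range fun i => aeval x (ℓ i))) (x j))
    (hfin : FiniteDimensional (IntermediateField.adjoin k (Set.range fun i => aeval x (ℓ i))) E)
    (T : Finset (Fin n → Ω)) (w : κ → Ω) (hT : ∀ v ∈ T, Specializes k x v)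
    (hTw : ∀ v ∈ T, ∀ i, aeval v (ℓ i) = w i) :
    T.card ≤ Module.finrank (IntermediateField.adjoin k (Set.range fun i => aeval x (ℓ i))) E := by
  classical
  -- With a form p that separates T, it suffices to count the values of p on T, which are roots of
  -- one monic polynomial.
  obtain ⟨B, -, hB⟩ := exists_sum_pow_injOn T
  obtain ⟨t, ht⟩ := Infinite.exists_notMem_finset B
  have hinj := hB t ht
  set y := fun i => aeval x (ℓ i) with hyd
  have := isIntegrallyClosed_adjoin hy
  let p : MvPolynomial (Fin n) k := ∑ j : Fin n, C ((t : k) ^ (j : ℕ)) * X j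
  have he : IsIntegral (Algebra.adjoin k (Set.range y)) (aeval x p) := by
    rw [show aeval x p = ∑ j : Fin n, (t : E) ^ (j : ℕ) * x j by simp [p]]
    refine IsIntegral.sum _ fun j _ => IsIntegral.mul ?_ (hint j)
    exact_mod_cast isIntegral_algebraMap (R := Algebra.adjoin k (Set.range y)) (A := E)
      (x := ((t ^ (j : ℕ) : ℕ) : Algebra.adjoin k (Set.range y)))
  obtain ⟨q, hqm, hqd, hq⟩ := exists_polynomial_lift _ (minpoly.monic he)
  -- The algebra of the forms is a polynomial ring, hence integrally closed, so the minimal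
  -- polynomial over it is the one over its field of fractions.
  have hdeg : q.natDegree ≤ Module.finrank (IntermediateField.adjoin k (Set.range y)) E := by
    have h1 := minpoly.isIntegrallyClosed_eq_field_fractions'
      (IntermediateField.adjoin k (Set.range y)) he
    have h2 := minpoly.natDegree_le (A := IntermediateField.adjoin k (Set.range y)) (aeval x p)
    rw [h1, (minpoly.monic he).natDegree_map, ← hqd] at h2
    exact h2
  set f := (aeval w : MvPolynomial κ k →ₐ[k] Ω).toRingHom
  have hroot : ∀ v ∈ T, aeval v p ∈ (q.map f).roots := by
    intro v hv
    rw [Polynomial.mem_roots (hqm.map f).ne_zero, Polynomial.IsRoot, Polynomial.eval_map]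
    have h1 := (hT v hv).eval₂_eq_zero ℓ p (q := q) ((hq _).trans (minpoly.aeval _ _))
    rwa [show (fun i => aeval v (ℓ i)) = w from funext (hTw v hv)] at h1
  have hsub : T.image (fun v => aeval v p) ⊆ (q.map f).roots.toFinset := by
    intro e he
    obtain ⟨v, hv, rfl⟩ := Finset.mem_image.1 he
    exact Multiset.mem_toFinset.2 (hroot v hv)
  have hcard : (T.image (fun v => aeval v p)).card = T.card := by
    apply Finset.card_image_of_injOn
    intro a ha b hb hab
    refine hinj ha hb ?_
    simpa [p] using hab
  calc T.card = (T.image (fun v => aeval v p)).card := hcard.symm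
    _ ≤ (q.map f).roots.toFinset.card := Finset.card_le_card hsub
    _ ≤ (q.map f).roots.card := Multiset.toFinset_card_le _
    _ ≤ (q.map f).natDegree := Polynomial.card_roots' _
    _ ≤ q.natDegree := Polynomial.natDegree_map_le
    _ ≤ _ := hdeg

end Integrality

/-! ### Graded primes and their behaviour under finite linear projections -/

section Primes

variable {k E : Type*} [Field k] [Field E] [Algebra k E] {ι κ : Type*}

/-- The ideal `Q` contains the homogeneous components of its elements. -/
def IsGradedIdeal (Q : Ideal (MvPolynomial ι k)) : Prop :=
  ∀ p ∈ Q, ∀ t, homogeneousComponent t p ∈ Q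

attribute [local instance] MvPolynomial.gradedAlgebra

theorem IsGradedIdeal.isHomogeneous {Q : Ideal (MvPolynomial ι k)} (h : IsGradedIdeal Q) :
    Q.IsHomogeneous (homogeneousSubmodule ι k) := by
  intro i p hp
  rw [show ((DirectSum.decompose (homogeneousSubmodule ι k) p) i : MvPolynomial ι k) =
    homogeneousComponent i p from decomposition.decompose'_apply p i]
  exact h p hp i

/-- The homogeneous core stays prime and loses no homogeneous element, so it can replace Q wherever
only graded data matter. -/
theorem exists_isGradedIdeal_le (Q : Ideal (MvPolynomial ι k)) (hQ : Q.IsPrime) :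
    ∃ Q' ≤ Q, Q'.IsPrime ∧ IsGradedIdeal Q' ∧ ∀ p t, p.IsHomogeneous t → p ∈ Q → p ∈ Q' := by
  refine ⟨(Q.homogeneousCore (homogeneousSubmodule ι k)).toIdeal,
    Ideal.toIdeal_homogeneousCore_le _ _, hQ.homogeneousCore, ?_, ?_⟩
  · intro p hp t
    exact homogeneousComponent_mem_of_mem
      (Q.homogeneousCore (homogeneousSubmodule ι k)).isHomogeneous hp t
  · intro p t hp hpQ
    exact Ideal.mem_homogeneousCore_of_homogeneous_of_mem ⟨t, hp⟩ hpQ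

theorem IsGradedIdeal.le_of_forall {Q Q' : Ideal (MvPolynomial ι k)} (h : IsGradedIdeal Q)
    (hle : ∀ p t, p.IsHomogeneous t → p ∈ Q → p ∈ Q') : Q ≤ Q' := by
  intro p hp
  rw [← sum_homogeneousComponent p]
  exact Ideal.sum_mem _ fun t _ =>
    hle _ t (homogeneousComponent_isHomogeneous t p) (h p hp t)

theorem IsGradedIdeal.isPrime {Q : Ideal (MvPolynomial ι k)} (h : IsGradedIdeal Q) (hne : Q ≠ ⊤)
    (hmul : ∀ p q s t, p.IsHomogeneous s → q.IsHomogeneous t → p * q ∈ Q → p ∈ Q ∨ q ∈ Q) :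
    Q.IsPrime := by
  refine h.isHomogeneous.isPrime_of_homogeneous_mem_or_mem hne ?_
  rintro p q ⟨s, hp⟩ ⟨t, hq⟩ hpq
  exact hmul p q s t hp hq hpq

theorem IsConical.isGradedIdeal_ker {x : ι → E} (hx : IsConical k x) :
    IsGradedIdeal (RingHom.ker (aeval x : MvPolynomial ι k →ₐ[k] E)) :=
  fun p hp t => hx p t hp

/-! ### Going up, incomparability and lifting of points -/

section GoingUp

variable {x : ι → E} {ℓ : κ → MvPolynomial ι k}

/-- Translates integrality of elements of E into integrality of the ring homomorphism from the
polynomials in the forms to the coordinate ring, the setting of going up. -/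
theorem isIntegral_quotient_comp_bind₁
    (hint : ∀ j, IsIntegral (Algebra.adjoin k (Set.range fun i => aeval x (ℓ i))) (x j)) :
    ((Ideal.Quotient.mk (RingHom.ker (aeval x : MvPolynomial ι k →ₐ[k] E))).comp
      (bind₁ ℓ : MvPolynomial κ k →ₐ[k] MvPolynomial ι k).toRingHom).IsIntegral := by
  set g := (Ideal.Quotient.mk (RingHom.ker (aeval x : MvPolynomial ι k →ₐ[k] E))).comp
      (bind₁ ℓ : MvPolynomial κ k →ₐ[k] MvPolynomial ι k).toRingHom with hg
  intro r
  obtain ⟨p, rfl⟩ := Ideal.Quotient.mk_surjective r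
  induction p using MvPolynomial.induction_on with
  | C a =>
    have : Ideal.Quotient.mk (RingHom.ker (aeval x : MvPolynomial ι k →ₐ[k] E)) (C a) =
        g (C a) := by simp [hg]
    rw [this]
    exact g.isIntegralElem_map
  | add p q hp hq => rw [map_add]; exact hp.add g hq
  | mul_X p j hp =>
    rw [map_mul]
    refine hp.mul g ?_
    obtain ⟨q, hqm, hq⟩ := hint j
    obtain ⟨q', hq'm, -, hq'⟩ := exists_polynomial_lift q hqm
    refine ⟨q', hq'm, ?_⟩
    have h1 := (hq' (x j)).trans hq
    have h2 := eval₂_aeval_eq_aeval_eval₂ x ℓ (X j) q'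
    rw [aeval_X, h1] at h2
    rw [hg, ← Polynomial.hom_eval₂]
    exact Ideal.Quotient.eq_zero_iff_mem.2 h2.symm

theorem exists_isPrime_comap_bind₁_eq
    (hint : ∀ j, IsIntegral (Algebra.adjoin k (Set.range fun i => aeval x (ℓ i))) (x j))
    {Q : Ideal (MvPolynomial ι k)} (hQ : Q.IsPrime) (hker : RingHom.ker (aeval x) ≤ Q)
    {P : Ideal (MvPolynomial κ k)} (hP : P.IsPrime) (hle : Q.comap (bind₁ ℓ) ≤ P) :
    ∃ Q' ≥ Q, Q'.IsPrime ∧ Q'.comap (bind₁ ℓ) = P := by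
  set I := RingHom.ker (aeval x : MvPolynomial ι k →ₐ[k] E)
  set g := (Ideal.Quotient.mk I).comp
      (bind₁ ℓ : MvPolynomial κ k →ₐ[k] MvPolynomial ι k).toRingHom with hg
  let := g.toAlgebra
  have : Algebra.IsIntegral (MvPolynomial κ k) (MvPolynomial ι k ⧸ I) :=
    ⟨isIntegral_quotient_comp_bind₁ hint⟩
  have hQm : (Q.map (Ideal.Quotient.mk I)).IsPrime :=
    Ideal.map_isPrime_of_surjective Ideal.Quotient.mk_surjective (by rwa [Ideal.mk_ker])
  have hcm : (Q.map (Ideal.Quotient.mk I)).comap (Ideal.Quotient.mk I) = Q := by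
    rw [Ideal.comap_map_of_surjective _ Ideal.Quotient.mk_surjective, ← RingHom.ker_eq_comap_bot,
      Ideal.mk_ker, sup_eq_left]
    exact hker
  obtain ⟨Q', hQ', hQ'p, hQ'c⟩ := Ideal.exists_ideal_over_prime_of_isIntegral_of_isPrime P
    (Q.map (Ideal.Quotient.mk I)) (by
      intro p hp
      apply hle
      have hp' : g p ∈ Q.map (Ideal.Quotient.mk I) := hp
      rw [Ideal.mem_comap, ← hcm, Ideal.mem_comap]
      exact hp')
  refine ⟨Q'.comap (Ideal.Quotient.mk I), ?_, Ideal.comap_isPrime _ _, ?_⟩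
  · rw [ge_iff_le, ← hcm]
    exact Ideal.comap_mono hQ'
  · rw [← hQ'c]
    rfl

/-- Going up, followed by passing to the homogeneous core. The contraction is unchanged because P is
graded and substituting linear forms preserves degrees. -/
theorem exists_isPrime_isGradedIdeal_comap_bind₁_eq (hℓ : ∀ i, (ℓ i).IsHomogeneous 1)
    (hint : ∀ j, IsIntegral (Algebra.adjoin k (Set.range fun i => aeval x (ℓ i))) (x j))
    {Q : Ideal (MvPolynomial ι k)} (hQ : Q.IsPrime) (hQg : IsGradedIdeal Q)
    (hker : RingHom.ker (aeval x) ≤ Q)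
    {P : Ideal (MvPolynomial κ k)} (hP : P.IsPrime) (hPg : IsGradedIdeal P)
    (hle : Q.comap (bind₁ ℓ) ≤ P) :
    ∃ Q' ≥ Q, Q'.IsPrime ∧ IsGradedIdeal Q' ∧ Q'.comap (bind₁ ℓ) = P := by
  obtain ⟨Q₁, hQ₁, hQ₁p, hQ₁c⟩ := exists_isPrime_comap_bind₁_eq hint hQ hker hP hle
  obtain ⟨Q₂, hQ₂, hQ₂p, hQ₂g, hQ₂m⟩ := exists_isGradedIdeal_le Q₁ hQ₁p
  refine ⟨Q₂, hQg.le_of_forall fun p t hp hpQ => hQ₂m p t hp (hQ₁ hpQ), hQ₂p, hQ₂g, ?_⟩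
  apply le_antisymm
  · rw [← hQ₁c]; exact Ideal.comap_mono hQ₂
  · refine hPg.le_of_forall fun p t hp hpP => ?_
    refine hQ₂m _ t (isHomogeneous_bind₁ hℓ hp) ?_
    rw [← hQ₁c] at hpP
    exact hpP

/-- Incomparability for integral extensions, transported from the quotient by the relations of x. -/
theorem comap_bind₁_lt_comap_bind₁
    (hint : ∀ j, IsIntegral (Algebra.adjoin k (Set.range fun i => aeval x (ℓ i))) (x j))
    {Q Q' : Ideal (MvPolynomial ι k)} (hQ : Q.IsPrime) (hker : RingHom.ker (aeval x) ≤ Q)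
    (hlt : Q < Q') : Q.comap (bind₁ ℓ) < Q'.comap (bind₁ ℓ) := by
  set I := RingHom.ker (aeval x : MvPolynomial ι k →ₐ[k] E)
  set g := (Ideal.Quotient.mk I).comp
      (bind₁ ℓ : MvPolynomial κ k →ₐ[k] MvPolynomial ι k).toRingHom with hg
  let := g.toAlgebra
  have : Algebra.IsIntegral (MvPolynomial κ k) (MvPolynomial ι k ⧸ I) :=
    ⟨isIntegral_quotient_comp_bind₁ hint⟩
  have hcm : ∀ {R : Ideal (MvPolynomial ι k)}, I ≤ R →
      (R.map (Ideal.Quotient.mk I)).comap (Ideal.Quotient.mk I) = R := by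
    intro R hR
    rw [Ideal.comap_map_of_surjective _ Ideal.Quotient.mk_surjective, ← RingHom.ker_eq_comap_bot,
      Ideal.mk_ker, sup_eq_left]
    exact hR
  have hQm : (Q.map (Ideal.Quotient.mk I)).IsPrime :=
    Ideal.map_isPrime_of_surjective Ideal.Quotient.mk_surjective (by rwa [Ideal.mk_ker])
  obtain ⟨p, hpQ', hpQ⟩ := SetLike.exists_of_lt hlt
  have h := Ideal.comap_lt_comap_of_integral_mem_sdiff (R := MvPolynomial κ k)
    (I := Q.map (Ideal.Quotient.mk I)) (J := Q'.map (Ideal.Quotient.mk I))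
    (Ideal.map_mono hlt.le) (x := Ideal.Quotient.mk I p)
    ⟨Ideal.mem_map_of_mem _ hpQ', fun h => hpQ (by
      rw [← hcm hker]; exact h)⟩ (Algebra.IsIntegral.isIntegral _)
  have hc : ∀ {R : Ideal (MvPolynomial ι k)}, I ≤ R → (R.map (Ideal.Quotient.mk I)).comap
      (algebraMap (MvPolynomial κ k) (MvPolynomial ι k ⧸ I)) = R.comap (bind₁ ℓ) := by
    intro R hR
    conv_rhs => rw [← hcm hR]
    rfl
  rwa [hc hker, hc (hker.trans hlt.le)] at h

/-- Points lift along the integral morphism defined by `ℓ`. -/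
theorem exists_specializes_aeval_eq [IsAlgClosed k] [Finite ι]
    (hint : ∀ j, IsIntegral (Algebra.adjoin k (Set.range fun i => aeval x (ℓ i))) (x j))
    {w : κ → k} (hw : Specializes k (fun i => aeval x (ℓ i)) w) :
    ∃ v : ι → k, Specializes k x v ∧ ∀ i, aeval v (ℓ i) = w i := by
  -- Lying over, applied to the maximal ideal of w; by the Nullstellensatz, the resulting prime Q
  -- has a zero v.
  obtain ⟨Q, hQ, hQp, hQc⟩ := exists_isPrime_comap_bind₁_eq hint
    (RingHom.ker_isPrime (aeval x : MvPolynomial ι k →ₐ[k] E)) le_rfl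
    (RingHom.ker_isPrime (aeval w : MvPolynomial κ k →ₐ[k] k)) (by
      intro p hp
      refine hw p ?_
      rw [← aeval_bind₁_eq]
      exact hp)
  have hne : (zeroLocus k Q).Nonempty := by
    rw [Set.nonempty_iff_ne_empty]
    intro h
    have := vanishingIdeal_zeroLocus_eq_radical (K := k) Q
    rw [h, vanishingIdeal_empty, hQp.radical] at this
    exact hQp.ne_top this.symm
  obtain ⟨v, hv⟩ := hne
  refine ⟨v, fun p hp => hv p (hQ hp), fun i => ?_⟩
  have h1 : (X i - C (w i) : MvPolynomial κ k) ∈ Q.comap (bind₁ ℓ) := by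
    rw [hQc, RingHom.mem_ker]
    simp
  have h2 := hv _ h1
  simpa [sub_eq_zero] using h2

end GoingUp

/-- In the localization at p the radical of I is p, so g is nilpotent modulo I there. Equivalently,
a prime over I that misses all u * g ^ N with u outside p would be contained in p, hence equal to
it. -/
theorem exists_mul_pow_mem_of_mem_minimalPrimes {R : Type*} [CommRing R] {I p : Ideal R}
    (hp : p ∈ I.minimalPrimes) {g : R} (hg : g ∈ p) : ∃ u ∉ p, ∃ N : ℕ, u * g ^ N ∈ I := by
  by_contra! hcon
  have hpp : p.IsPrime := hp.1.1
  have hdisj : Disjoint (I : Set R) (p.primeCompl ⊔ Submonoid.powers g : Submonoid R) := by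
    rw [Set.disjoint_left]
    intro r hr hr'
    obtain ⟨u, hu, w, ⟨N, rfl⟩, rfl⟩ := Submonoid.mem_sup.1 hr'
    exact hcon u hu N hr
  obtain ⟨q, hq, hIq, hqd⟩ := Ideal.exists_le_prime_disjoint I _ hdisj
  rw [Set.disjoint_left] at hqd
  have hqp : q ≤ p := by
    intro r hr
    by_contra hrp
    exact hqd hr ((le_sup_left : p.primeCompl ≤ _) hrp)
  have : g ∈ q := hp.2 ⟨hq, hIq⟩ hqp hg
  exact hqd this ((le_sup_right : Submonoid.powers g ≤ p.primeCompl ⊔ _)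
    (Submonoid.mem_powers g))

/-- A minimal prime over one of the coordinates of an integral morphism to an affine space lies
over the prime ideal of that coordinate. -/
theorem comap_bind₁_eq_span_of_mem_minimalPrimes {x : ι → E} {ℓ : κ → MvPolynomial ι k}
    (hy : AlgebraicIndependent k fun i => aeval x (ℓ i))
    (hint : ∀ j, IsIntegral (Algebra.adjoin k (Set.range fun i => aeval x (ℓ i))) (x j))
    (i₀ : κ) {P : Ideal (MvPolynomial ι k)}
    (hP : P ∈ (RingHom.ker (aeval x : MvPolynomial ι k →ₐ[k] E) ⊔
      Ideal.span {ℓ i₀}).minimalPrimes) :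
    P.comap (bind₁ ℓ) = Ideal.span {X i₀} := by
  set y := fun i => aeval x (ℓ i) with hyd
  have hPp : P.IsPrime := hP.1.1
  have hker : RingHom.ker (aeval x : MvPolynomial ι k →ₐ[k] E) ≤ P := le_sup_left.trans hP.1.2
  have hℓP : ℓ i₀ ∈ P := hP.1.2 (Ideal.mem_sup_right (Ideal.mem_span_singleton_self _))
  apply le_antisymm
  swap
  · rw [Ideal.span_singleton_le_iff_mem, Ideal.mem_comap, bind₁_X_right]
    exact hℓP
  intro g hg
  rw [Ideal.mem_span_singleton]
  by_contra hndvd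
  obtain ⟨u, hu, N, huN⟩ := exists_mul_pow_mem_of_mem_minimalPrimes hP (Ideal.mem_comap.1 hg)
  obtain ⟨a, ha, b, hb, hab⟩ := Submodule.mem_sup.1 huN
  obtain ⟨c, rfl⟩ := Ideal.mem_span_singleton'.1 hb
  let : Algebra (MvPolynomial κ k) E := (aeval y : MvPolynomial κ k →ₐ[k] E).toRingHom.toAlgebra
  have halg : ∀ p : MvPolynomial κ k, algebraMap (MvPolynomial κ k) E p = aeval y p :=
    fun p => rfl
  have hinj : Function.Injective (algebraMap (MvPolynomial κ k) E) := hy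
  have : FaithfulSMul (MvPolynomial κ k) E := (faithfulSMul_iff_algebraMap_injective _ _).2 hinj
  have hintE : ∀ p : MvPolynomial ι k, IsIntegral (MvPolynomial κ k) (aeval x p) := by
    intro p
    obtain ⟨q, hqm, hq⟩ := isIntegral_quotient_comp_bind₁ hint (Ideal.Quotient.mk _ p)
    refine ⟨q, hqm, ?_⟩
    rw [← Polynomial.hom_eval₂, Ideal.Quotient.eq_zero_iff_mem] at hq
    have := eval₂_aeval_eq_aeval_eval₂ x ℓ p q
    rw [RingHom.mem_ker.1 hq] at this
    exact this
  have hX : Prime (X i₀ : MvPolynomial κ k) := MvPolynomial.X_prime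
  have hgne : g ^ N ≠ 0 := by
    refine pow_ne_zero _ ?_
    rintro rfl
    exact hndvd (dvd_zero _)
  -- A contracted element g outside the ideal of X i₀ would give this equation in E, with u outside
  -- P.
  have hrel : (g ^ N) • aeval x u = (X i₀ : MvPolynomial κ k) • aeval x c := by
    have := congrArg (aeval x) hab
    rw [map_add, RingHom.mem_ker.1 ha, zero_add, map_mul, map_mul, map_pow, aeval_bind₁_eq] at this
    rw [Algebra.smul_def, Algebra.smul_def, halg, halg, map_pow, aeval_X, mul_comm _ (aeval x u),
      ← this, mul_comm]
  -- Both sides of the relation have the same minimal polynomial, computed by scaling roots.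
  -- Comparing coefficients, the prime X i₀ divides all lower coefficients of the minimal polynomial
  -- of u, as it does not divide g.
  have h1 := IsIntegrallyClosed.minpoly_smul hgne (hintE u)
  have h2 := IsIntegrallyClosed.minpoly_smul hX.ne_zero (hintE c)
  rw [hrel, h2] at h1
  set q := minpoly (MvPolynomial κ k) (aeval x u) with hq
  set q' := minpoly (MvPolynomial κ k) (aeval x c)
  have hqm : q.Monic := minpoly.monic (hintE u)
  have hdeg : q'.natDegree = q.natDegree := by
    have := congrArg Polynomial.natDegree h1
    simpa using this
  have hdvd : ∀ i < q.natDegree, X i₀ ∣ q.coeff i := by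
    intro i hi
    have := congrArg (fun r => Polynomial.coeff r i) h1
    simp only [Polynomial.coeff_scaleRoots, hdeg] at this
    have hd : X i₀ ∣ q.coeff i * (g ^ N) ^ (q.natDegree - i) := by
      rw [← this]
      exact Dvd.dvd.mul_left (dvd_pow_self _ (by omega)) _
    rcases hX.dvd_or_dvd hd with h | h
    · exact h
    · exact absurd (hX.dvd_of_dvd_pow (hX.dvd_of_dvd_pow h)) hndvd
  -- Modulo P the integral equation of u reduces to its leading term, so a power of u lies in P, a
  -- contradiction.
  have hzero : aeval x (q.eval₂ (bind₁ ℓ).toRingHom u) = 0 := by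
    rw [← eval₂_aeval_eq_aeval_eval₂]
    exact minpoly.aeval (MvPolynomial κ k) (aeval x u)
  have hmem := hker (RingHom.mem_ker.2 hzero)
  rw [Polynomial.eval₂_eq_sum_range, Finset.sum_range_succ, hqm.coeff_natDegree, map_one,
    one_mul] at hmem
  refine hu (hPp.mem_of_pow_mem q.natDegree ?_)
  refine (Submodule.add_mem_iff_right P ?_).1 hmem
  refine Ideal.sum_mem _ fun i hi => Ideal.mul_mem_right _ _ ?_
  obtain ⟨r, hr⟩ := hdvd i (Finset.mem_range.1 hi)
  rw [hr]
  change bind₁ ℓ (X i₀ * r) ∈ P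
  rw [map_mul, bind₁_X_right]
  exact Ideal.mul_mem_right _ _ hℓP

end Primes

/-! ### Hilbert functions and degrees of field extensions -/

section Hilbert

theorem finrank_homogeneousSubmodule (k : Type*) [Field k] (r t : ℕ) :
    Module.finrank k (homogeneousSubmodule (Fin (r + 1)) k t) = (t + r).choose r := by
  classical
  rw [homogeneousSubmodule_eq_finsupp_supported]
  have h1 : Module.finrank k
      (AddMonoidAlgebra.supported k k {d : Fin (r + 1) →₀ ℕ | d.degree = t}) =
      Nat.card {d : Fin (r + 1) →₀ ℕ | d.degree = t} := by
    have : Finite {d : Fin (r + 1) →₀ ℕ | d.degree = t} :=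
      ((Finsupp.finite_of_degree_le t).subset fun d hd => le_of_eq hd)
    exact Module.finrank_eq_nat_card_basis (basisRestrictSupport k _)
  have h2 : Nat.card {d : Fin (r + 1) →₀ ℕ | d.degree = t} = Nat.card (Sym (Fin (r + 1)) t) := by
    refine Nat.card_congr ((Equiv.subtypeEquiv Finsupp.equivFunOnFinite ?_).trans
      (Sym.equivNatSumOfFintype (Fin (r + 1)) t).symm)
    intro d
    rw [Set.mem_ofPred_eq, Finsupp.degree_eq_sum]
    rfl
  refine h1.trans (h2.trans ?_)
  rw [Nat.card_eq_fintype_card, Sym.card_sym_eq_choose, Fintype.card_fin]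
  rw [show r + 1 + t - 1 = t + r by omega, ← Nat.choose_symm_add]

/-- A bounded shift of the argument does not affect the leading term of a binomial coefficient. The
shift is written as an equation of sums because u is a truncated difference in the application. -/
theorem tendsto_factorial_mul_choose (r : ℕ) {u : ℕ → ℕ} (a b : ℕ)
    (hu : ∀ᶠ t in atTop, u t + a = t + b) :
    Tendsto (fun t : ℕ => (r.factorial : ℝ) * ((u t + r).choose r : ℕ) / (t : ℝ) ^ r) atTop
      (𝓝 1) := by
  have h1 : ∀ i : ℕ, Tendsto (fun t : ℕ => ((u t : ℝ) + 1 + i) / t) atTop (𝓝 1) := by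
    intro i
    have h2 : Tendsto (fun t : ℕ => 1 + ((b : ℝ) - a + 1 + i) / t) atTop (𝓝 (1 + 0)) :=
      tendsto_const_nhds.add (tendsto_const_div_atTop_nhds_zero_nat _)
    rw [add_zero] at h2
    refine h2.congr' ?_
    filter_upwards [hu, eventually_gt_atTop 0] with t ht ht0
    have h3 : (u t : ℝ) + a = t + b := by exact_mod_cast ht
    have h4 : (t : ℝ) ≠ 0 := by positivity
    field_simp
    linarith
  have h2 := tendsto_finsetProd (Finset.range r) fun i _ => h1 i
  simp only [Finset.prod_const_one] at h2
  refine h2.congr fun t => ?_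
  rw [Finset.prod_div_distrib, Finset.prod_const, Finset.card_range]
  congr 1
  have h3 : r.factorial * (u t + r).choose r = ∏ i ∈ Finset.range r, (u t + 1 + i) := by
    rw [← Nat.ascFactorial_eq_prod_range, Nat.ascFactorial_eq_factorial_mul_choose]
  have := congrArg (Nat.cast : ℕ → ℝ) h3
  push_cast at this
  rw [this]

variable {k E : Type*} [Field k] [Field E] [Algebra k E] {ι κ : Type*}

/-- The degree `t` part of the algebra generated by the coordinates of `x`. -/
noncomputable def gradedPart (k : Type*) [Field k] {E : Type*} [Field E] [Algebra k E] {ι : Type*} (x : ι → E)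
    (t : ℕ) : Submodule k E :=
  (homogeneousSubmodule ι k t).map (aeval x : MvPolynomial ι k →ₐ[k] E).toLinearMap

instance finite_homogeneousSubmodule (ι : Type*) [Finite ι] (t : ℕ) :
    Module.Finite k (homogeneousSubmodule ι k t) :=
  Module.Finite.iff_fg.2 (homogeneousSubmodule_fg ι k t)

theorem aeval_mem_adjoin (A : Type*) [CommRing A] [Algebra k A] [Algebra A E] [IsScalarTower k A E]
    (x : ι → E) (p : MvPolynomial ι k) : aeval x p ∈ Algebra.adjoin A (Set.range x) := by
  rw [Algebra.adjoin_range_eq_range_aeval, ← aeval_map_algebraMap A x p]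
  exact ⟨_, rfl⟩

/-- The algebra generated by x is a finitely generated module over that of y, so one denominator s
serves all its elements. -/
theorem exists_smul_mem_span [Finite ι] {x : ι → E} {y : κ → E}
    (hint : ∀ j, IsIntegral (Algebra.adjoin k (Set.range y)) (x j))
    {β : Type*} [Fintype β] (b : β → E)
    (hb : Submodule.span (IntermediateField.adjoin k (Set.range y)) (Set.range b) = ⊤) :
    ∃ s : MvPolynomial κ k, aeval y s ≠ 0 ∧ ∀ p : MvPolynomial ι k, ∃ c : β → MvPolynomial κ k,
      aeval y s * aeval x p = ∑ i, aeval y (c i) * b i := by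
  classical
  set A := Algebra.adjoin k (Set.range y) with hA
  set K := IntermediateField.adjoin k (Set.range y) with hK
  have hrep : ∀ a : A, ∃ s : MvPolynomial κ k, aeval y s = (a : E) := by
    rintro ⟨a, ha⟩
    have ha' := ha
    rw [hA, Algebra.adjoin_range_eq_range_aeval] at ha'
    exact ha'
  let W : Submodule A E := Submodule.span A (Set.range b)
  have h1 : ∀ e : E, ∃ a : A, a ≠ 0 ∧ a • e ∈ W := by
    intro e
    have he : e ∈ Submodule.span K (Set.range b) := hb ▸ Submodule.mem_top
    obtain ⟨f, rfl⟩ := (Submodule.mem_span_range_iff_exists_fun K).1 he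
    obtain ⟨⟨a, ha⟩, h⟩ := IsLocalization.exist_integer_multiples (nonZeroDivisors A) Finset.univ f
    refine ⟨a, nonZeroDivisors.ne_zero ha, ?_⟩
    rw [Finset.smul_sum]
    refine Submodule.sum_mem _ fun i _ => ?_
    obtain ⟨c, hc⟩ := h i (Finset.mem_univ i)
    have : a • f i • b i = c • b i := by
      rw [← smul_assoc, ← hc, algebraMap_smul]
    rw [this]
    exact W.smul_mem _ (Submodule.subset_span ⟨i, rfl⟩)
  have h2 : ∀ M : Submodule A E, M.FG → ∃ a : A, a ≠ 0 ∧ ∀ e ∈ M, a • e ∈ W := by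
    intro M hM
    induction M, hM using Submodule.fg_induction with
    | singleton e =>
      obtain ⟨a, ha, hae⟩ := h1 e
      refine ⟨a, ha, fun e' he' => ?_⟩
      obtain ⟨c, rfl⟩ := Submodule.mem_span_singleton.1 he'
      rw [smul_comm]
      exact W.smul_mem _ hae
    | sup M₁ M₂ _ _ ih₁ ih₂ =>
      obtain ⟨a₁, ha₁, h₁⟩ := ih₁
      obtain ⟨a₂, ha₂, h₂⟩ := ih₂
      refine ⟨a₁ * a₂, mul_ne_zero ha₁ ha₂, fun e he => ?_⟩
      obtain ⟨e₁, he₁, e₂, he₂, rfl⟩ := Submodule.mem_sup.1 he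
      rw [smul_add]
      refine W.add_mem ?_ ?_
      · rw [mul_comm, mul_smul]; exact W.smul_mem _ (h₁ _ he₁)
      · rw [mul_smul]; exact W.smul_mem _ (h₂ _ he₂)
  obtain ⟨a, ha, haW⟩ := h2 (Subalgebra.toSubmodule (Algebra.adjoin A (Set.range x)))
    (fg_adjoin_of_finite (Set.finite_range x) (by rintro _ ⟨j, rfl⟩; exact hint j))
  obtain ⟨s, hs⟩ := hrep a
  refine ⟨s, by rw [hs]; exact fun h => ha (Subtype.ext h), fun p => ?_⟩
  have hp : aeval x p ∈ Algebra.adjoin A (Set.range x) := aeval_mem_adjoin A x p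
  obtain ⟨f, hf⟩ := (Submodule.mem_span_range_iff_exists_fun A).1 (haW _ hp)
  choose c hc using hrep
  refine ⟨fun i => c (f i), ?_⟩
  rw [hs]
  simp only [hc]
  exact hf.symm

/-- E is algebraic over K, so K[x] is already a field and equals E; hence the monomials in x span E
over K. A basis of monomials consists of homogeneous elements, which makes it possible to count by
degree. -/
theorem exists_monomial_basis [Finite ι] {x : ι → E} {y : κ → E}
    (hgen : IntermediateField.adjoin k (Set.range x) = ⊤)
    (hint : ∀ j, IsIntegral (Algebra.adjoin k (Set.range y)) (x j)) :
    ∃ (D : ℕ) (m : Fin D → ι →₀ ℕ),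
      D = Module.finrank (IntermediateField.adjoin k (Set.range y)) E ∧
      LinearIndependent (IntermediateField.adjoin k (Set.range y))
        (fun i => aeval x (monomial (m i) (1 : k))) ∧
      Submodule.span (IntermediateField.adjoin k (Set.range y))
        (Set.range fun i => aeval x (monomial (m i) (1 : k))) = ⊤ := by
  classical
  have hfd := finiteDimensional_of_isIntegral hgen hint
  set K := IntermediateField.adjoin k (Set.range y) with hK
  let mon : (ι →₀ ℕ) → E := fun m => aeval x (monomial m (1 : k))
  have hspan : Submodule.span K (Set.range mon) = ⊤ := by
    have h1 : ∀ p : MvPolynomial ι K, aeval x p ∈ Submodule.span K (Set.range mon) := by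
      intro p
      rw [as_sum p, map_sum]
      refine Submodule.sum_mem _ fun m _ => ?_
      rw [aeval_monomial, ← Algebra.smul_def]
      refine Submodule.smul_mem _ _ (Submodule.subset_span ⟨m, ?_⟩)
      simp only [mon, aeval_monomial, map_one, one_mul]
    rw [eq_top_iff]
    intro e _
    have he : e ∈ IntermediateField.adjoin k (Set.range x) := hgen ▸ IntermediateField.mem_top
    have hmem : e ∈ Algebra.adjoin K (Set.range x) := by
      have h2 : ∀ z ∈ Algebra.adjoin K (Set.range x), z⁻¹ ∈ Algebra.adjoin K (Set.range x) :=
        fun z hz => Subalgebra.inv_mem_of_algebraic (A := Algebra.adjoin K (Set.range x))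
          (x := ⟨z, hz⟩) (Algebra.IsAlgebraic.isAlgebraic z)
      obtain ⟨p, q, rfl⟩ := (IntermediateField.mem_adjoin_range_iff k x e).1 he
      have h3 : ∀ p : MvPolynomial ι k, aeval x p ∈ Algebra.adjoin K (Set.range x) :=
        aeval_mem_adjoin K x
      rw [div_eq_mul_inv]
      exact mul_mem (h3 p) (h2 _ (h3 q))
    rw [Algebra.adjoin_range_eq_range_aeval] at hmem
    obtain ⟨p, rfl⟩ := hmem
    exact h1 p
  obtain ⟨b, hbs, hbspan, hbli⟩ := exists_linearIndependent K (Set.range mon)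
  have hbfin : Finite b := hbli.finite
  have := Fintype.ofFinite b
  let B : Module.Basis b K E := Module.Basis.mk hbli (by
    rw [Subtype.range_coe, hbspan, hspan])
  have hcard : Fintype.card b = Module.finrank K E := (Module.finrank_eq_card_basis B).symm
  let eqv := (Fintype.equivFin b).symm
  have hch : ∀ i, ∃ m, mon m = (eqv i : E) := fun i => hbs (eqv i).2
  choose m hm using hch
  refine ⟨Fintype.card b, m, hcard, ?_, ?_⟩
  · have : (fun i => aeval x (monomial (m i) (1 : k))) = (fun i : b => (i : E)) ∘ eqv := by
      funext i; exact hm i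
    rw [this]
    exact hbli.comp _ eqv.injective
  · have : (fun i => aeval x (monomial (m i) (1 : k))) = (fun i : b => (i : E)) ∘ eqv := by
      funext i; exact hm i
    rw [this, Set.range_comp, eqv.range_eq_univ, Set.image_univ, Subtype.range_coe, hbspan, hspan]

/-- The leading term of the Hilbert function of a conical point is given by the degree of the
field extension defined by a system of linear forms over which it is integral. -/
theorem IsConical.tendsto_finrank_gradedPart [Finite ι] {x : ι → E} (hx : IsConical k x)
    (hgen : IntermediateField.adjoin k (Set.range x) = ⊤) {r : ℕ}
    {ℓ : Fin (r + 1) → MvPolynomial ι k} (hℓ : ∀ i, (ℓ i).IsHomogeneous 1)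
    (hy : AlgebraicIndependent k fun i => aeval x (ℓ i))
    (hint : ∀ j, IsIntegral (Algebra.adjoin k (Set.range fun i => aeval x (ℓ i))) (x j)) :
    Tendsto (fun t : ℕ => (r.factorial : ℝ) * Module.finrank k (gradedPart k x t) / (t : ℝ) ^ r)
      atTop (𝓝 (Module.finrank
        (IntermediateField.adjoin k (Set.range fun i => aeval x (ℓ i))) E : ℝ)) := by
  classical
  obtain ⟨D, m, hD, hli, hspan⟩ := exists_monomial_basis hgen hint
  rw [← hD]
  obtain ⟨s, hs0, hs⟩ := exists_smul_mem_span hint _ hspan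
  set y := fun i => aeval x (ℓ i) with hyd
  set K := IntermediateField.adjoin k (Set.range y) with hK
  have hyK : ∀ p : MvPolynomial (Fin (r + 1)) k, aeval y p ∈ K := by
    intro p
    refine IntermediateField.algebra_adjoin_le_adjoin k _ ?_
    rw [Algebra.adjoin_range_eq_range_aeval]; exact ⟨p, rfl⟩
  -- The common denominator s need not be homogeneous; its component of degree e serves in its
  -- place.
  obtain ⟨e, he⟩ := exists_homogeneousComponent_ne_zero (p := s) (by rintro rfl; simp at hs0)
  let mon : Fin D → MvPolynomial ι k := fun i => monomial (m i) 1
  let dg : Fin D → ℕ := fun i => (m i).degree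
  have hmon : ∀ i, (mon i).IsHomogeneous (dg i) := fun i => isHomogeneous_monomial _ rfl
  let M := ∑ i, dg i
  have hM : ∀ i, dg i ≤ M := fun i =>
    Finset.single_le_sum (f := dg) (fun _ _ => Nat.zero_le _) (Finset.mem_univ i)
  let Φ : (Fin D → MvPolynomial (Fin (r + 1)) k) →ₗ[k] E :=
    ∑ i, (LinearMap.mulRight k (aeval x (mon i))).comp
      ((aeval y : MvPolynomial (Fin (r + 1)) k →ₐ[k] E).toLinearMap.comp (LinearMap.proj i))
  have hΦ : ∀ c, Φ c = ∑ i, aeval y (c i) * aeval x (mon i) := by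
    intro c; simp [Φ, LinearMap.sum_apply]
  have hΦinj : Function.Injective Φ := by
    rw [← LinearMap.ker_eq_bot, LinearMap.ker_eq_bot']
    intro c hc
    rw [hΦ] at hc
    funext i
    have h1 := (Fintype.linearIndependent_iff.1 hli) (fun i => ⟨aeval y (c i), hyK (c i)⟩) hc i
    have h2 : aeval y (c i) = 0 := congrArg Subtype.val h1
    exact hy (h2.trans (map_zero _).symm)
  let V : (Fin D → ℕ) → Submodule k (Fin D → MvPolynomial (Fin (r + 1)) k) := fun u =>
    Submodule.pi Set.univ fun i => homogeneousSubmodule (Fin (r + 1)) k (u i)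
  let eqV : ∀ u, V u ≃ₗ[k] ((i : Fin D) → homogeneousSubmodule (Fin (r + 1)) k (u i)) := fun u =>
    { toFun := fun c i => ⟨c.1 i, c.2 i (Set.mem_univ i)⟩
      map_add' := fun _ _ => rfl
      map_smul' := fun _ _ => rfl
      invFun := fun c => ⟨fun i => (c i).1, fun i _ => (c i).2⟩
      left_inv := fun _ => rfl
      right_inv := fun _ => rfl }
  have hVfin : ∀ u, Module.Finite k (V u) := fun u => Module.Finite.equiv (eqV u).symm
  have hVrank : ∀ u, Module.finrank k (V u) = ∑ i, (u i + r).choose r := by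
    intro u
    rw [LinearEquiv.finrank_eq (eqV u), Module.finrank_pi_fintype]
    simp_rw [finrank_homogeneousSubmodule]
  have hWfin : ∀ u, Module.Finite k ((V u).map Φ) := fun u => inferInstance
  have hWrank : ∀ u, Module.finrank k ((V u).map Φ) = ∑ i, (u i + r).choose r := by
    intro u
    rw [← hVrank u]
    exact (LinearEquiv.finrank_eq (Submodule.equivMapOfInjective Φ hΦinj (V u))).symm
  have hGfin : ∀ t, Module.Finite k (gradedPart k x t) := fun t => by
    unfold gradedPart; infer_instance
  -- The products of forms of degree t - dg i in y with the i-th basis monomial span a direct sum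
  -- inside the degree t part.
  have hlow : ∀ t, M ≤ t → ∑ i, (t - dg i + r).choose r ≤ Module.finrank k (gradedPart k x t) := by
    intro t ht
    rw [← hWrank]
    refine Submodule.finrank_mono ?_
    rintro _ ⟨c, hc, rfl⟩
    rw [hΦ]
    refine Submodule.sum_mem _ fun i _ => ⟨bind₁ ℓ (c i) * mon i, ?_, ?_⟩
    · have h1 := (isHomogeneous_bind₁ hℓ (hc i (Set.mem_univ i))).mul (hmon i)
      rwa [Nat.sub_add_cancel ((hM i).trans ht)] at h1
    · change aeval x (bind₁ ℓ (c i) * mon i) = _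
      rw [map_mul, aeval_bind₁_eq]
  have hse : aeval y (homogeneousComponent e s) ≠ 0 := fun h =>
    he (hy (h.trans (map_zero _).symm))
  -- Conversely, multiplication by the component of degree e of s embeds the degree t part into the
  -- analogous sum for t + e. Both bounds have the leading term D tʳ / r!.
  have hup : ∀ t, M ≤ t →
      Module.finrank k (gradedPart k x t) ≤ ∑ i, (t + e - dg i + r).choose r := by
    intro t ht
    rw [← hWrank]
    have h1 : Module.finrank k ((gradedPart k x t).map
        (LinearMap.mulLeft k (aeval y (homogeneousComponent e s)))) =
        Module.finrank k (gradedPart k x t) :=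
      (LinearEquiv.finrank_eq (Submodule.equivMapOfInjective _
        (fun a b hab => mul_left_cancel₀ hse hab) (gradedPart k x t))).symm
    rw [← h1]
    refine Submodule.finrank_mono ?_
    rintro _ ⟨_, ⟨p, hp, rfl⟩, rfl⟩
    obtain ⟨c, hc⟩ := hs p
    have h2 : aeval x (bind₁ ℓ s * p - ∑ i, bind₁ ℓ (c i) * mon i) = 0 := by
      rw [map_sub, map_mul, map_sum, aeval_bind₁_eq, sub_eq_zero]
      refine hc.trans (Finset.sum_congr rfl fun i _ => ?_)
      rw [map_mul, aeval_bind₁_eq]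
    have h3 := hx _ (e + t) h2
    have h4 : ∀ i, homogeneousComponent (e + t) (bind₁ ℓ (c i) * mon i) =
        bind₁ ℓ (homogeneousComponent (t + e - dg i) (c i)) * mon i := by
      intro i
      have : e + t = (t + e - dg i) + dg i := by have := hM i; omega
      rw [this, homogeneousComponent_mul (hmon i), homogeneousComponent_bind₁ hℓ]
    rw [map_sub, map_sum, homogeneousComponent_mul hp, homogeneousComponent_bind₁ hℓ, map_sub,
      map_mul, aeval_bind₁_eq, sub_eq_zero, map_sum] at h3
    refine ⟨fun i => homogeneousComponent (t + e - dg i) (c i),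
      fun i _ => homogeneousComponent_isHomogeneous _ _, ?_⟩
    rw [hΦ]
    refine Eq.trans ?_ h3.symm
    refine Finset.sum_congr rfl fun i _ => ?_
    rw [h4, map_mul, aeval_bind₁_eq]
  have hlim : ∀ (e : ℕ), Tendsto (fun t : ℕ => (r.factorial : ℝ) *
      (∑ i, (t + e - dg i + r).choose r : ℕ) / (t : ℝ) ^ r) atTop (𝓝 (D : ℝ)) := by
    intro e
    have h1 := tendsto_finsetSum (Finset.univ : Finset (Fin D)) fun i _ =>
      tendsto_factorial_mul_choose r (u := fun t => t + e - dg i) (dg i) e (by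
        filter_upwards [eventually_ge_atTop M] with t ht
        have := hM i
        omega)
    simp only [Finset.sum_const, Finset.card_univ, Fintype.card_fin, nsmul_eq_mul, mul_one] at h1
    refine h1.congr fun t => ?_
    rw [Nat.cast_sum, Finset.mul_sum, Finset.sum_div]
  refine tendsto_of_tendsto_of_tendsto_of_le_of_le' (hlim 0) (hlim e) ?_ ?_
  · filter_upwards [eventually_ge_atTop M] with t ht
    have := hlow t ht
    simp only [add_zero]
    gcongr
  · filter_upwards [eventually_ge_atTop M] with t ht
    have := hup t ht
    gcongr

end Hilbert

/-! ### Fibres, primitive elements and birational projections -/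

section Primitive

variable {k E Ω : Type*} [Field k] [Field E] [Algebra k E] [Field Ω] [Algebra k Ω] {ι κ : Type*}

/-- A family of the size of a transcendence basis over which the whole field is algebraic is
algebraically independent. -/
theorem algebraicIndependent_of_isIntegral [Finite ι] [Finite κ] {E : Type*} [Field E]
    [Algebra k E] {x : ι → E} {y y' : κ → E}
    (hgen : IntermediateField.adjoin k (Set.range x) = ⊤) (hy : AlgebraicIndependent k y)
    (hint : ∀ j, IsIntegral (Algebra.adjoin k (Set.range y')) (x j)) :
    AlgebraicIndependent k y' := by
  have hfd := finiteDimensional_of_isIntegral hgen hint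
  have : Algebra.IsAlgebraic (Algebra.adjoin k (Set.range y')) E :=
    Algebra.IsAlgebraic.trans (Algebra.adjoin k (Set.range y'))
      (IntermediateField.adjoin k (Set.range y')) E
  exact (Algebra.IsAlgebraic.isTranscendenceBasis_of_lift_le_trdeg_of_finite k y'
    hy.lift_cardinalMk_le_trdeg).1

/-- The bound on finite sets of points of the fibre is uniform, so the whole fibre is finite and
obeys it. -/
theorem finite_specializes [CharZero Ω] {n : ℕ} {x : Fin n → E}
    {ℓ : κ → MvPolynomial (Fin n) k}
    (hy : AlgebraicIndependent k fun i => aeval x (ℓ i))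
    (hint : ∀ j, IsIntegral (Algebra.adjoin k (Set.range fun i => aeval x (ℓ i))) (x j))
    (hgen : IntermediateField.adjoin k (Set.range x) = ⊤) (w : κ → Ω) :
    ∃ T : Finset (Fin n → Ω),
      T.card ≤ Module.finrank (IntermediateField.adjoin k (Set.range fun i => aeval x (ℓ i))) E ∧
      ∀ v, v ∈ T ↔ Specializes k x v ∧ ∀ i, aeval v (ℓ i) = w i := by
  classical
  have hfd := finiteDimensional_of_isIntegral hgen hint
  have hcard : ∀ T : Finset (Fin n → Ω),
      (↑T ⊆ {v : Fin n → Ω | Specializes k x v ∧ ∀ i, aeval v (ℓ i) = w i}) → T.card ≤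
      Module.finrank (IntermediateField.adjoin k (Set.range fun i => aeval x (ℓ i))) E :=
    fun T hT => card_le_finrank_of_specializes hy hint hfd T w (fun v hv => (hT hv).1)
      (fun v hv => (hT hv).2)
  have hfin : {v : Fin n → Ω | Specializes k x v ∧ ∀ i, aeval v (ℓ i) = w i}.Finite := by
    by_contra hinf
    obtain ⟨T, hT, hTc⟩ := Set.Infinite.exists_subset_card_eq hinf
      (Module.finrank (IntermediateField.adjoin k (Set.range fun i => aeval x (ℓ i))) E + 1)
    have := hcard T hT
    omega
  refine ⟨hfin.toFinset, hcard _ (by simp), fun v => ?_⟩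
  rw [Set.Finite.mem_toFinset, Set.mem_ofPred_eq]

/-- An element that separates the points of a geometric generic fibre is primitive. -/
theorem adjoin_singleton_eq_top_of_injOn [CharZero k] [IsAlgClosed Ω] [Finite ι] {x : ι → E}
    {ℓ : κ → MvPolynomial ι k}
    (hgen : IntermediateField.adjoin k (Set.range x) = ⊤)
    (hy : AlgebraicIndependent k fun i => aeval x (ℓ i))
    (hint : ∀ j, IsIntegral (Algebra.adjoin k (Set.range fun i => aeval x (ℓ i))) (x j))
    {η : κ → Ω} (hη : AlgebraicIndependent k η) (l : MvPolynomial ι k)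
    (hinj : Set.InjOn (fun v : ι → Ω => aeval v l)
      {v | Specializes k x v ∧ ∀ i, aeval v (ℓ i) = η i}) :
    IntermediateField.adjoin (IntermediateField.adjoin k (Set.range fun i => aeval x (ℓ i)))
      {aeval x l} = ⊤ := by
  have hfd := finiteDimensional_of_isIntegral hgen hint
  set y := fun i => aeval x (ℓ i) with hyd
  set K := IntermediateField.adjoin k (Set.range y) with hK
  -- σ makes Ω an extension of K through y ↦ η. The K-embeddings of E into Ω then yield points of
  -- the fibre over η, and an element is primitive when its image determines the embedding.
  let σ : K →ₐ[k] Ω := ((IntermediateField.adjoin k (Set.range η)).val.comp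
    hη.aevalEquivField.toAlgHom).comp hy.aevalEquivField.symm.toAlgHom
  have hyK : ∀ i, y i ∈ K := fun i => IntermediateField.subset_adjoin _ _ ⟨i, rfl⟩
  have hσ : ∀ i, σ ⟨y i, hyK i⟩ = η i := by
    intro i
    have h1 : hy.aevalEquivField.symm ⟨y i, hyK i⟩ = algebraMap _ _ (X i : MvPolynomial κ k) := by
      rw [AlgEquiv.symm_apply_eq]
      apply Subtype.ext
      rw [AlgebraicIndependent.aevalEquivField_algebraMap_apply_coe, aeval_X]
    change ((hη.aevalEquivField (hy.aevalEquivField.symm ⟨y i, hyK i⟩) :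
      IntermediateField.adjoin k (Set.range η)) : Ω) = _
    rw [h1, AlgebraicIndependent.aevalEquivField_algebraMap_apply_coe, aeval_X]
  let := σ.toRingHom.toAlgebra
  have : IsScalarTower k K Ω := IsScalarTower.of_algebraMap_eq fun c => (σ.commutes c).symm
  have : CharZero K := charZero_of_injective_algebraMap (algebraMap k K).injective
  rw [Field.primitive_element_iff_algHom_eq_of_eval' K Ω (fun e => IsAlgClosed.splits _)]
  intro φ ψ hφψ
  have hval : ∀ (φ : E →ₐ[K] Ω) (p : MvPolynomial ι k),
      φ (aeval x p) = aeval (fun j => φ (x j)) p := by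
    intro φ p
    exact MvPolynomial.comp_aeval_apply (f := x) (φ.restrictScalars k) p
  have hmem : ∀ φ : E →ₐ[K] Ω, (fun j => φ (x j)) ∈
      {v : ι → Ω | Specializes k x v ∧ ∀ i, aeval v (ℓ i) = η i} := by
    intro φ
    refine ⟨Specializes.of_algHom (φ.restrictScalars k), fun i => ?_⟩
    rw [← hval]
    have h1 := φ.commutes ⟨y i, hyK i⟩
    exact h1.trans (hσ i)
  have hx : (fun j => φ (x j)) = fun j => ψ (x j) := by
    refine hinj (hmem φ) (hmem ψ) ?_
    simp only [← hval]
    exact hφψ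
  refine AlgHom.ext fun e => ?_
  have he : e ∈ IntermediateField.adjoin k (Set.range x) := hgen ▸ IntermediateField.mem_top
  obtain ⟨p, q, rfl⟩ := (IntermediateField.mem_adjoin_range_iff k x e).1 he
  rw [map_div₀, map_div₀, hval, hval, hval, hval, hx]

/-- A birational linear projection of a conical point has a homogeneous inverse. -/
theorem IsConical.exists_inverse [Finite ι] {x : ι → E} (hx : IsConical k x)
    {ℓ : κ → MvPolynomial ι k} (hℓ : ∀ i, (ℓ i).IsHomogeneous 1)
    (hgen : IntermediateField.adjoin k (Set.range fun i => aeval x (ℓ i)) = ⊤) :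
    ∃ (e : ℕ) (D : MvPolynomial κ k) (G : ι → MvPolynomial κ k), D.IsHomogeneous e ∧
      (∀ j, (G j).IsHomogeneous (e + 1)) ∧ aeval x (bind₁ ℓ D) ≠ 0 ∧
      ∀ j, aeval x (bind₁ ℓ D * X j) = aeval x (bind₁ ℓ (G j)) := by
  classical
  have := Fintype.ofFinite ι
  set z := fun i => aeval x (ℓ i) with hz
  have h1 : ∀ j, ∃ p q : MvPolynomial κ k, aeval z q ≠ 0 ∧ x j * aeval z q = aeval z p := by
    intro j
    have he : x j ∈ IntermediateField.adjoin k (Set.range z) := hgen ▸ IntermediateField.mem_top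
    obtain ⟨p, q, hpq⟩ := (IntermediateField.mem_adjoin_range_iff k z (x j)).1 he
    by_cases hq : aeval z q = 0
    · refine ⟨0, 1, by simp, ?_⟩
      rw [hpq, hq]; simp
    · exact ⟨p, q, hq, by rw [hpq, div_mul_cancel₀ _ hq]⟩
  choose p q hq hpq using h1
  let D := ∏ j, q j
  have hD : aeval z D ≠ 0 := by
    simp only [D, map_prod]
    exact Finset.prod_ne_zero_iff.2 fun j _ => hq j
  let G : ι → MvPolynomial κ k := fun j => p j * ∏ i ∈ Finset.univ.erase j, q i
  have hG : ∀ j, aeval z D * x j = aeval z (G j) := by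
    intro j
    have : D = q j * ∏ i ∈ Finset.univ.erase j, q i :=
      (Finset.mul_prod_erase _ _ (Finset.mem_univ j)).symm
    rw [this, map_mul, map_mul, ← hpq j]
    ring
  -- The relations D * X j = G j split by degree because x is conical, so D and G may be replaced by
  -- their components of degrees e and e + 1.
  obtain ⟨e, he⟩ : ∃ e, aeval z (homogeneousComponent e D) ≠ 0 := by
    by_contra! hcon
    apply hD
    rw [← sum_homogeneousComponent D, map_sum]
    exact Finset.sum_eq_zero fun i _ => hcon i
  refine ⟨e, homogeneousComponent e D, fun j => homogeneousComponent (e + 1) (G j),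
    homogeneousComponent_isHomogeneous _ _, fun j => homogeneousComponent_isHomogeneous _ _,
    by rwa [aeval_bind₁_eq], fun j => ?_⟩
  have h2 : aeval x (bind₁ ℓ D * X j - bind₁ ℓ (G j)) = 0 := by
    rw [map_sub, map_mul, aeval_bind₁_eq, aeval_bind₁_eq, aeval_X, hG j, sub_self]
  have h3 := hx _ (e + 1) h2
  rw [map_sub, homogeneousComponent_mul (isHomogeneous_X k j), homogeneousComponent_bind₁ hℓ,
    homogeneousComponent_bind₁ hℓ, map_sub, sub_eq_zero] at h3
  exact h3

theorem adjoin_range_eq_top_of_adjoin_singleton {y : κ → E} {a : E}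
    (h : IntermediateField.adjoin (IntermediateField.adjoin k (Set.range y)) {a} = ⊤)
    {κ' : Type*} {z : κ' → E} (hy : ∀ i, ∃ j, z j = y i) (ha : ∃ j, z j = a) :
    IntermediateField.adjoin k (Set.range z) = ⊤ := by
  rw [eq_top_iff]
  have h1 := IntermediateField.adjoin_adjoin_left k (Set.range y) {a}
  rw [h, IntermediateField.restrictScalars_top] at h1
  rw [h1, IntermediateField.adjoin_le_iff]
  rintro e (⟨i, rfl⟩ | rfl)
  · obtain ⟨j, hj⟩ := hy i
    exact IntermediateField.subset_adjoin _ _ ⟨j, hj⟩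
  · obtain ⟨j, hj⟩ := ha
    exact IntermediateField.subset_adjoin _ _ ⟨j, hj⟩

theorem aeval_option_elim (y : κ → Ω) (a : Ω) (F : MvPolynomial (Option κ) k) :
    aeval (fun o : Option κ => o.elim a y) F =
      (optionEquivLeft k κ F).eval₂ (aeval y : MvPolynomial κ k →ₐ[k] Ω).toRingHom a := by
  induction F using MvPolynomial.induction_on with
  | C c => simp
  | add p q hp hq => rw [map_add, hp, hq, map_add, Polynomial.eval₂_add]
  | mul_X p o hp =>
    rw [map_mul, hp, map_mul, Polynomial.eval₂_mul, aeval_X]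
    cases o <;> simp

/-- The relations between the coordinates of a finite birational projection to a space of dimension
one more are generated by a homogeneous polynomial that is monic in the last variable. -/
theorem exists_generator_ker_aeval [Finite ι] {x : ι → E}
    (hgen : IntermediateField.adjoin k (Set.range x) = ⊤) {y : κ → E}
    (hy : AlgebraicIndependent k y)
    (hint : ∀ j, IsIntegral (Algebra.adjoin k (Set.range y)) (x j)) {a : E}
    (ha : IsIntegral (Algebra.adjoin k (Set.range y)) a)
    (hprim : IntermediateField.adjoin (IntermediateField.adjoin k (Set.range y)) {a} = ⊤)
    (hcon : IsConical k fun o : Option κ => o.elim a y) :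
    ∃ F : MvPolynomial (Option κ) k,
      F.IsHomogeneous (Module.finrank (IntermediateField.adjoin k (Set.range y)) E) ∧
      aeval (fun o : Option κ => o.elim a y) F = 0 ∧
      (∀ G : MvPolynomial (Option κ) k, aeval (fun o : Option κ => o.elim a y) G = 0 → F ∣ G) ∧
      ∀ c : κ → k, (aeval (fun o : Option κ => o.elim Polynomial.X fun i => Polynomial.C (c i)) F :
        Polynomial k).natDegree = Module.finrank (IntermediateField.adjoin k (Set.range y)) E := by
  classical
  have hfd := finiteDimensional_of_isIntegral hgen hint
  have hic := isIntegrallyClosed_adjoin hy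
  set K := IntermediateField.adjoin k (Set.range y) with hK
  set d := Module.finrank K E with hd
  have h1 := minpoly.isIntegrallyClosed_eq_field_fractions' K ha
  have hmon := minpoly.monic ha
  have hdeg : (minpoly (Algebra.adjoin k (Set.range y)) a).natDegree = d := by
    have h2 := (Field.primitive_element_iff_minpoly_natDegree_eq K a).1 hprim
    rw [h1, hmon.natDegree_map] at h2
    exact h2
  let ε := hy.aevalEquiv.toRingEquiv
  have hε : ∀ q : Polynomial (MvPolynomial κ k),
      q.eval₂ (aeval y : MvPolynomial κ k →ₐ[k] E).toRingHom a =
        Polynomial.aeval a (q.map ε.toRingHom) := by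
    intro q
    rw [Polynomial.aeval_def, Polynomial.eval₂_map]
    congr 1
  -- The minimal polynomial of a over the integrally closed algebra of y; it divides every
  -- polynomial over that algebra that vanishes at a.
  let p : Polynomial (MvPolynomial κ k) :=
    (minpoly (Algebra.adjoin k (Set.range y)) a).map ε.symm.toRingHom
  have hpε : p.map ε.toRingHom = minpoly (Algebra.adjoin k (Set.range y)) a := by
    simp only [p, Polynomial.map_map]
    have : ε.toRingHom.comp ε.symm.toRingHom = RingHom.id _ := by
      ext; simp
    rw [this, Polynomial.map_id]
  have hpm : p.Monic := hmon.map _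
  have hpd : p.natDegree = d := by
    rw [← hdeg]; exact hmon.natDegree_map _
  have hp0 : p.eval₂ (aeval y : MvPolynomial κ k →ₐ[k] E).toRingHom a = 0 := by
    rw [hε, hpε]; exact minpoly.aeval _ _
  have hpdvd : ∀ q : Polynomial (MvPolynomial κ k),
      q.eval₂ (aeval y : MvPolynomial κ k →ₐ[k] E).toRingHom a = 0 → p ∣ q := by
    intro q hq
    rw [hε] at hq
    have h2 := minpoly.isIntegrallyClosed_dvd ha hq
    have h3 := Polynomial.map_dvd ε.symm.toRingHom h2
    rw [Polynomial.map_map] at h3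
    have : ε.symm.toRingHom.comp ε.toRingHom = RingHom.id _ := by
      ext <;> simp
    rwa [this, Polynomial.map_id] at h3
  let F := (optionEquivLeft k κ).symm p
  have hFp : optionEquivLeft k κ F = p := AlgEquiv.apply_symm_apply _ _
  have hF0 : aeval (fun o : Option κ => o.elim a y) F = 0 := by
    rw [aeval_option_elim, hFp, hp0]
  have hFdvd : ∀ G : MvPolynomial (Option κ) k,
      aeval (fun o : Option κ => o.elim a y) G = 0 → F ∣ G := by
    intro G hG
    rw [aeval_option_elim] at hG
    have h2 := map_dvd (optionEquivLeft k κ).symm (hpdvd _ hG)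
    rwa [AlgEquiv.symm_apply_apply] at h2
  -- The component of degree d is again a relation and still monic of degree d in the last variable.
  -- Being divisible by p, it equals p, so F is homogeneous.
  let p' := optionEquivLeft k κ (homogeneousComponent d F)
  have hp'le : p'.natDegree ≤ d := by
    rw [natDegree_optionEquivLeft]
    exact (degreeOf_le_totalDegree _ _).trans
      (homogeneousComponent_isHomogeneous d F).totalDegree_le
  have hp'c : p'.coeff d = 1 := by
    ext m
    rw [optionEquivLeft_coeff_coeff, coeff_homogeneousComponent, coeff_one]
    have hdegm : (m.optionElim d).degree = d + m.degree := by
      rw [Finsupp.degree_eq_weight_one, Finsupp.degree_eq_weight_one, Finsupp.weight_apply,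
        Finsupp.weight_apply, Finsupp.sum_option_index]
      · simp
      · simp
      · intros; simp
    rw [hdegm]
    by_cases hm : m = 0
    · subst hm
      rw [if_pos (by simp), if_pos rfl, ← optionEquivLeft_coeff_coeff, hFp]
      have : p.coeff d = 1 := by rw [← hpd]; exact hpm.coeff_natDegree
      rw [this, coeff_zero_one]
    · rw [if_neg, if_neg (Ne.symm hm)]
      intro h
      exact hm ((Finsupp.degree_eq_zero_iff m).1 (by omega))
  have hp'm : p'.Monic := Polynomial.monic_of_natDegree_le_of_coeff_eq_one d hp'le hp'c
  have hpp' : p = p' := by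
    have h2 : p ∣ p' := by
      have h3 := map_dvd (optionEquivLeft k κ) (hFdvd _ (hcon F d hF0))
      rwa [hFp] at h3
    exact (Polynomial.eq_of_monic_of_dvd_of_natDegree_le hpm hp'm h2 (by rw [hpd]; exact hp'le)).symm
  have hFd : F = homogeneousComponent d F := by
    apply (optionEquivLeft k κ).injective
    rw [hFp]; exact hpp'
  refine ⟨F, ?_, hF0, hFdvd, ?_⟩
  · rw [hFd]; exact homogeneousComponent_isHomogeneous d F
  · intro c
    have h2 : (aeval (fun o : Option κ => o.elim Polynomial.X fun i => Polynomial.C (c i)) F :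
        Polynomial k) = p.map (aeval c : MvPolynomial κ k →ₐ[k] k).toRingHom := by
      rw [← hFp]
      induction F using MvPolynomial.induction_on with
      | C c => simp
      | add p q hp hq => rw [map_add, hp, hq, map_add, Polynomial.map_add]
      | mul_X p o hp =>
        rw [map_mul, hp, map_mul, Polynomial.map_mul, aeval_X]
        cases o <;> simp
    rw [h2, hpm.natDegree_map, hpd]

end Primitive

/-! ### Noether normalization by linear forms with small coefficients -/

section Systems

variable {k E Ω : Type*} [Field k] [Field E] [Algebra k E] [Field Ω] [Algebra k Ω]

/-- The linear form in `x₁, …, xₙ` with coefficients `a`. -/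
noncomputable def form {k : Type*} [Field k] {n : ℕ} (a : Fin n → k) :
    MvPolynomial (Fin (n + 1)) k :=
  ∑ j, C (a j) * X j.succ

/-- The system of linear forms that consists of `x₀` and the forms with coefficients `a i`. -/
noncomputable def formSystem {k : Type*} [Field k] {n r : ℕ} (a : Fin r → Fin n → k) :
    Fin (r + 1) → MvPolynomial (Fin (n + 1)) k :=
  Fin.cons (X 0) fun i => form (a i)

theorem isHomogeneous_form {n : ℕ} (a : Fin n → k) : (form a).IsHomogeneous 1 :=
  IsHomogeneous.sum _ _ _ fun _ _ => isHomogeneous_C_mul_X _ _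

theorem isHomogeneous_formSystem {n r : ℕ} (a : Fin r → Fin n → k) (i : Fin (r + 1)) :
    (formSystem a i).IsHomogeneous 1 := by
  refine Fin.cases ?_ (fun i => ?_) i
  · exact isHomogeneous_X k 0
  · exact isHomogeneous_form _

@[simp]
theorem formSystem_zero {n r : ℕ} (a : Fin r → Fin n → k) : formSystem a 0 = X 0 := rfl

@[simp]
theorem formSystem_succ {n r : ℕ} (a : Fin r → Fin n → k) (i : Fin r) :
    formSystem a i.succ = form (a i) := rfl

theorem aeval_form {n : ℕ} (v : Fin (n + 1) → Ω) (a : Fin n → k) :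
    aeval v (form a) = ∑ j, algebraMap k Ω (a j) * v j.succ := by
  simp [form]

/-- The system of linear forms has no common zero but the origin on the cone of `x`. -/
def HasNoCommonZero {n r : ℕ} (x : Fin (n + 1) → E) (a : Fin r → Fin n → k) : Prop :=
  ∀ v : Fin (n + 1) → k, Specializes k x v → (∀ i, aeval v (formSystem a i) = 0) → v = 0

theorem hasNoCommonZero_single {n : ℕ} (x : Fin (n + 1) → E) :
    HasNoCommonZero x (fun i : Fin n => (Pi.single i 1 : Fin n → k)) := by
  intro v _ hv
  funext j
  refine Fin.cases ?_ (fun i => ?_) j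
  · simpa using hv 0
  · have := hv i.succ
    rw [formSystem_succ, aeval_form] at this
    simpa [Pi.single_apply] using this

/-- A homogeneous relation between the forms of a system that is not divisible by the variable of
`x₀` makes it possible to drop one of the forms. -/
theorem HasNoCommonZero.exists_pred [Infinite k] {n r : ℕ} {x : Fin (n + 1) → E}
    (hx : IsConical k x) (hx0 : x 0 ≠ 0) {a : Fin r → Fin n → k} (ha : HasNoCommonZero x a)
    (hdep : ¬ AlgebraicIndependent k fun i => aeval x (formSystem a i)) :
    ∃ (r' : ℕ) (a' : Fin r' → Fin n → k), r' < r ∧ HasNoCommonZero x a' := by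
  classical
  set y := fun i => aeval x (formSystem a i) with hy
  have hyc : IsConical k y := hx.comp (isHomogeneous_formSystem a)
  -- A relation of least degree is not divisible by the variable of x₀: since x 0 ≠ 0, the cofactor
  -- would be a relation of smaller degree.
  have hex : ∃ t, ∃ F : MvPolynomial (Fin (r + 1)) k, F ≠ 0 ∧ F.totalDegree = t ∧
      aeval y F = 0 := by
    rw [algebraicIndependent_iff] at hdep
    push Not at hdep
    obtain ⟨F, hF, hF0⟩ := hdep
    exact ⟨_, F, hF0, rfl, hF⟩
  obtain ⟨F, hF0, hFt, hFy, s, hFs⟩ : ∃ F : MvPolynomial (Fin (r + 1)) k, F ≠ 0 ∧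
      F.totalDegree = Nat.find hex ∧ aeval y F = 0 ∧ ∃ s, F.IsHomogeneous s := by
    obtain ⟨F, hF0, hFt, hFy⟩ := Nat.find_spec hex
    obtain ⟨s, hs⟩ := exists_homogeneousComponent_ne_zero hF0
    have hhom := homogeneousComponent_isHomogeneous s F
    refine ⟨homogeneousComponent s F, hs, ?_, hyc F s hFy, s, hhom⟩
    apply le_antisymm
    · rw [hhom.totalDegree hs, ← hFt]
      by_contra hlt
      exact hs (homogeneousComponent_eq_zero _ _ (by omega))
    · exact Nat.find_min' hex ⟨_, hs, rfl, hyc F s hFy⟩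
  have hndvd : ¬ X 0 ∣ F := by
    rintro ⟨G, rfl⟩
    have hG0 : G ≠ 0 := right_ne_zero_of_mul hF0
    rw [totalDegree_mul_of_isDomain (X_ne_zero 0) hG0, totalDegree_X] at hFt
    refine Nat.find_min hex (m := G.totalDegree) (by omega) ⟨G, hG0, rfl, ?_⟩
    rw [map_mul, aeval_X] at hFy
    refine (mul_eq_zero.1 hFy).resolve_left ?_
    simpa [hy] using hx0
  -- Hence F does not vanish identically on the hyperplane where the first variable is 0.
  obtain ⟨c, hc⟩ : ∃ c : Fin r → k, eval (Fin.cons 0 c : Fin (r + 1) → k) F ≠ 0 := by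
    by_contra! hcon
    apply hndvd
    have h1 : (finSuccEquiv k r F).coeff 0 = 0 := by
      apply MvPolynomial.funext
      intro c
      have := hcon c
      rw [eval_eq_eval_mv_eval', ← Polynomial.coeff_zero_eq_eval_zero, Polynomial.coeff_map] at this
      rw [map_zero]
      exact this
    have h2 := map_dvd (finSuccEquiv k r).symm (Polynomial.X_dvd_iff.2 h1)
    rwa [AlgEquiv.symm_apply_apply, ← finSuccEquiv_X_zero, AlgEquiv.symm_apply_apply] at h2
  have hhom : ∀ (μ : k) (w : Fin (r + 1) → k), eval (μ • w) F = μ ^ s * eval w F := by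
    intro μ w
    have := aeval_smul_of_isHomogeneous hFs μ w
    rwa [aeval_eq_eval, aeval_eq_eval] at this
  have hs0 : s ≠ 0 := by
    rintro rfl
    rw [← totalDegree_zero_iff_isHomogeneous, totalDegree_eq_zero_iff_eq_C] at hFs
    rw [hFs, aeval_C, map_eq_zero] at hFy
    rw [hFy, C_0] at hFs
    exact hF0 hFs
  obtain ⟨i₀, hi₀⟩ : ∃ i, c i ≠ 0 := by
    by_contra! hcon
    apply hc
    have h0 : (Fin.cons 0 c : Fin (r + 1) → k) = (0 : k) • (0 : Fin (r + 1) → k) := by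
      funext i
      refine Fin.cases ?_ (fun i => ?_) i
      · simp
      · simp [hcon i]
    rw [h0, hhom, zero_pow hs0, zero_mul]
  obtain ⟨r', rfl⟩ : ∃ r', r = r' + 1 := ⟨r - 1, by have := i₀.2; omega⟩
  -- Project from the point (0, c). At a common zero of the new forms and x₀, the values of the old
  -- system are μ • (0, c); as F vanishes on these values but not at (0, c), μ is 0.
  refine ⟨r', fun i => a (i₀.succAbove i) - (c (i₀.succAbove i) / c i₀) • a i₀,
    Nat.lt_succ_self _, ?_⟩
  intro v hv hv0
  have hv00 : v 0 = 0 := by simpa using hv0 0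
  set μ := aeval v (form (a i₀)) / c i₀ with hμ
  have hval : ∀ i, aeval v (form (a i)) = μ * c i := by
    intro i
    rcases Fin.eq_self_or_eq_succAbove i₀ i with rfl | ⟨i, rfl⟩
    · rw [hμ, div_mul_cancel₀ _ hi₀]
    · have := hv0 i.succ
      rw [formSystem_succ, aeval_form] at this
      simp only [Pi.sub_apply, Pi.smul_apply, smul_eq_mul, map_sub, sub_mul,
        Finset.sum_sub_distrib, sub_eq_zero, map_mul, mul_assoc, ← Finset.mul_sum] at this
      rw [aeval_form, this, hμ, aeval_form]
      simp only [Algebra.algebraMap_self, RingHom.id_apply]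
      ring
  have hsys : (fun i => aeval v (formSystem a i)) = μ • (Fin.cons 0 c : Fin (r' + 1 + 1) → k) := by
    funext i
    refine Fin.cases ?_ (fun i => ?_) i
    · simp [hv00]
    · rw [formSystem_succ, hval]; simp
  have h1 := hv.comp (formSystem a) F hFy
  rw [hsys, aeval_eq_eval, hhom] at h1
  have hμ0 : μ = 0 := by
    rcases mul_eq_zero.1 h1 with h | h
    · exact eq_zero_of_pow_eq_zero h
    · exact absurd h hc
  refine ha v hv fun i => ?_
  have := congrFun hsys i
  rw [hμ0, zero_smul] at this
  exact this

/-- Noether normalization that keeps x₀: among all systems without common zeros, one with the fewest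
forms is algebraically independent, since otherwise a form could be dropped. -/
theorem exists_hasNoCommonZero [Infinite k] {n : ℕ} {x : Fin (n + 1) → E}
    (hx : IsConical k x) (hx0 : x 0 ≠ 0) :
    ∃ (r : ℕ) (a : Fin r → Fin n → k), HasNoCommonZero x a ∧
      AlgebraicIndependent k fun i => aeval x (formSystem a i) := by
  classical
  have hex : ∃ r, ∃ a : Fin r → Fin n → k, HasNoCommonZero x a :=
    ⟨n, _, hasNoCommonZero_single x⟩
  obtain ⟨a, ha⟩ := Nat.find_spec hex
  refine ⟨_, a, ha, ?_⟩
  by_contra hdep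
  obtain ⟨r', a', hr', ha'⟩ := ha.exists_pred hx hx0 hdep
  exact Nat.find_min hex hr' ⟨a', ha'⟩

theorem HasNoCommonZero.isIntegral [IsAlgClosed k] {n r : ℕ} {x : Fin (n + 1) → E}
    (hx : IsConical k x) {a : Fin r → Fin n → k} (ha : HasNoCommonZero x a) (j : Fin (n + 1)) :
    IsIntegral (Algebra.adjoin k (Set.range fun i => aeval x (formSystem a i))) (x j) :=
  hx.isIntegral_of_forall_eq_zero (isHomogeneous_formSystem a) ha j

/-- One of the forms of a system without common zeros can be replaced by a form with small integral
coefficients. -/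
theorem HasNoCommonZero.exists_update [IsAlgClosed k] [CharZero k] {n r d : ℕ}
    {x : Fin (n + 1) → E} (hx : IsConical k x)
    (hgen : IntermediateField.adjoin k (Set.range x) = ⊤) {a : Fin r → Fin n → k}
    (ha : HasNoCommonZero x a) (hy : AlgebraicIndependent k fun i => aeval x (formSystem a i))
    (hd : Module.finrank
      (IntermediateField.adjoin k (Set.range fun i => aeval x (formSystem a i))) E = d)
    (i₀ : Fin r) :
    ∃ t ≤ n * d, HasNoCommonZero x (Function.update a i₀ fun j => (t : k) ^ (j : ℕ)) := by
  classical
  -- The points of the cone where x₀ and all forms but the i₀-th vanish and the latter is 1. Every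
  -- nonzero common zero of the remaining system is a multiple of one of them, so the new form only
  -- has to be nonzero on T.
  obtain ⟨T, hTc, hT⟩ := finite_specializes (Ω := k) hy (ha.isIntegral hx) hgen
    (Pi.single i₀.succ 1)
  rw [hd] at hTc
  obtain ⟨B, hBc, hB⟩ := exists_nat_forall_sum_pow_ne_zero (T.image Fin.tail) (by
    intro w hw h0
    obtain ⟨v, hv, rfl⟩ := Finset.mem_image.1 hw
    obtain ⟨hv1, hv2⟩ := (hT v).1 hv
    have h1 := hv2 i₀.succ
    rw [formSystem_succ, aeval_form, Pi.single_eq_same] at h1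
    have h2 : ∀ j : Fin n, v j.succ = 0 := fun j => congrFun h0 j
    simp [h2] at h1)
  have hBc' : B.card < (Finset.range (n * d + 1)).card := by
    rw [Finset.card_range, Nat.lt_succ_iff]
    exact hBc.trans (Nat.mul_le_mul_left _ (Finset.card_image_le.trans hTc))
  obtain ⟨t, ht, htB⟩ := Finset.exists_mem_notMem_of_card_lt_card hBc'
  refine ⟨t, by simpa [Nat.lt_succ_iff] using ht, ?_⟩
  intro v hv hv0
  have hv00 : v 0 = 0 := by simpa using hv0 0
  have hne : ∀ i, i ≠ i₀ → aeval v (form (a i)) = 0 := by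
    intro i hi
    have := hv0 i.succ
    rwa [formSystem_succ, Function.update_of_ne hi] at this
  have hpow : ∑ j : Fin n, (t : k) ^ (j : ℕ) * v j.succ = 0 := by
    have := hv0 i₀.succ
    rw [formSystem_succ, Function.update_self, aeval_form] at this
    simpa using this
  by_cases hμ : aeval v (form (a i₀)) = 0
  · refine ha v hv fun i => ?_
    refine Fin.cases ?_ (fun i => ?_) i
    · simpa using hv00
    · by_cases hi : i = i₀
      · rw [hi]; exact hμ
      · exact hne i hi
  · exfalso
    set μ := aeval v (form (a i₀))
    have hmem : μ⁻¹ • v ∈ T := by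
      rw [hT]
      refine ⟨hx.specializes_smul hv _, fun i => ?_⟩
      rw [aeval_smul_of_isHomogeneous (isHomogeneous_formSystem a i), pow_one]
      refine Fin.cases ?_ (fun i => ?_) i
      · rw [formSystem_zero, aeval_X, hv00, mul_zero, Pi.single_eq_of_ne (Fin.succ_ne_zero i₀).symm]
      · by_cases hi : i = i₀
        · subst hi
          rw [formSystem_succ, Pi.single_eq_same]
          exact inv_mul_cancel₀ hμ
        · rw [formSystem_succ, hne i hi, mul_zero, Pi.single_eq_of_ne]
          exact fun h => hi (Fin.succ_injective _ h)
    refine hB t htB _ (Finset.mem_image_of_mem _ hmem) ?_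
    have : ∀ j : Fin n, (t : k) ^ (j : ℕ) * Fin.tail (μ⁻¹ • v) j =
        μ⁻¹ * ((t : k) ^ (j : ℕ) * v j.succ) := by
      intro j
      simp only [Fin.tail, Pi.smul_apply, smul_eq_mul]
      ring
    simp_rw [this]
    rw [← Finset.mul_sum, hpow, mul_zero]

/-- There is a system of forms without common zeros, with small integral coefficients. -/
theorem exists_hasNoCommonZero_pow [IsAlgClosed k] [CharZero k] {n r d : ℕ}
    {x : Fin (n + 1) → E} (hx : IsConical k x)
    (hgen : IntermediateField.adjoin k (Set.range x) = ⊤) {a : Fin r → Fin n → k}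
    (ha : HasNoCommonZero x a) (hy : AlgebraicIndependent k fun i => aeval x (formSystem a i))
    (hd : ∀ a : Fin r → Fin n → k, HasNoCommonZero x a →
      (AlgebraicIndependent k fun i => aeval x (formSystem a i)) → Module.finrank
      (IntermediateField.adjoin k (Set.range fun i => aeval x (formSystem a i))) E = d) :
    ∃ τ : Fin r → ℕ, (∀ i, τ i ≤ n * d) ∧
      HasNoCommonZero x (fun i (j : Fin n) => (τ i : k) ^ (j : ℕ)) ∧
      AlgebraicIndependent k
        fun i => aeval x (formSystem (fun i (j : Fin n) => (τ i : k) ^ (j : ℕ)) i) := by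
  classical
  -- The first s forms have been replaced. The field degree must be d for every intermediate system
  -- for the bound n * d to persist, hence the quantified hypothesis `hd`.
  have key : ∀ s ≤ r, ∃ (a : Fin r → Fin n → k) (τ : Fin r → ℕ), HasNoCommonZero x a ∧
      (AlgebraicIndependent k fun i => aeval x (formSystem a i)) ∧ (∀ i, τ i ≤ n * d) ∧
      ∀ i : Fin r, (i : ℕ) < s → a i = fun j : Fin n => (τ i : k) ^ (j : ℕ) := by
    intro s
    induction s with
    | zero => exact fun _ => ⟨a, fun _ => 0, ha, hy, by simp, by simp⟩
    | succ s ih =>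
      intro hs
      obtain ⟨a, τ, h1, h2, h3, h4⟩ := ih (by omega)
      obtain ⟨t, ht, h5⟩ := h1.exists_update hx hgen h2 (hd a h1 h2) ⟨s, by omega⟩
      refine ⟨_, Function.update τ ⟨s, by omega⟩ t, h5,
        algebraicIndependent_of_isIntegral hgen h2 (h5.isIntegral hx), ?_, ?_⟩
      · intro i
        by_cases hi : i = ⟨s, by omega⟩
        · rw [hi, Function.update_self]; exact ht
        · rw [Function.update_of_ne hi]; exact h3 i
      · intro i his
        by_cases hi : i = ⟨s, by omega⟩
        · rw [hi, Function.update_self, Function.update_self]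
        · rw [Function.update_of_ne hi, Function.update_of_ne hi]
          refine h4 i ?_
          have : (i : ℕ) ≠ s := fun h => hi (Fin.ext h)
          omega
  obtain ⟨a, τ, h1, h2, h3, h4⟩ := key r le_rfl
  have : a = fun i (j : Fin n) => (τ i : k) ^ (j : ℕ) := funext fun i => h4 i i.2
  subst this
  exact ⟨τ, h3, h1, h2⟩

/-- All but few forms of powers separate the points of a fibre. -/
theorem exists_form_pow_injOn [CharZero Ω] {n r d : ℕ} {x : Fin (n + 1) → E}
    (hgen : IntermediateField.adjoin k (Set.range x) = ⊤) {a : Fin r → Fin n → k}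
    (hint : ∀ j, IsIntegral (Algebra.adjoin k (Set.range fun i => aeval x (formSystem a i))) (x j))
    (hy : AlgebraicIndependent k fun i => aeval x (formSystem a i))
    (hd : Module.finrank
      (IntermediateField.adjoin k (Set.range fun i => aeval x (formSystem a i))) E = d)
    (w : Fin (r + 1) → Ω) :
    ∃ B : Finset ℕ, B.card ≤ n * (d * d) ∧ ∀ t ∉ B,
      Set.InjOn (fun v : Fin (n + 1) → Ω => aeval v (form fun j : Fin n => (t : k) ^ (j : ℕ)))
        {v | Specializes k x v ∧ ∀ i, aeval v (formSystem a i) = w i} := by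
  classical
  obtain ⟨T, hTc, hT⟩ := finite_specializes hy hint hgen w
  rw [hd] at hTc
  obtain ⟨B, hBc, hB⟩ := exists_sum_pow_injOn (T.image Fin.tail)
  have hTc' : (T.image Fin.tail).card ≤ d := Finset.card_image_le.trans hTc
  refine ⟨B, hBc.trans (Nat.mul_le_mul_left _ (Nat.mul_le_mul hTc' hTc')), fun t ht v hv v' hv' h => ?_⟩
  -- The coordinate x₀ is constant on the fibre, so separating the tails is enough.
  have h0 : v 0 = v' 0 := by
    have h1 := hv.2 0
    have h2 := hv'.2 0
    rw [formSystem_zero, aeval_X] at h1 h2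
    rw [h1, h2]
  have htail : (Fin.tail v : Fin n → Ω) = Fin.tail v' := by
    refine hB t ht (Finset.mem_coe.2 (Finset.mem_image_of_mem _ ((hT v).2 hv)))
      (Finset.mem_coe.2 (Finset.mem_image_of_mem _ ((hT v').2 hv'))) ?_
    simpa [aeval_form, Fin.tail] using h
  rw [← Fin.cons_self_tail v, ← Fin.cons_self_tail v', h0, htail]

end Systems

/-! ### Closed sets, homogeneous ideals and generic points of projective space -/

section ProjectiveGeometry

variable {n : ℕ}

theorem isClosed_proj_iff {Z : Set (Proj n)} :
    IsClosed Z ↔ ∃ S : Set (MvPolynomial (Fin (n + 1)) Qbar),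
      (∀ f ∈ S, ∃ e : ℕ, f.IsHomogeneous e) ∧ Z = projZeros S := by
  rw [← isOpen_compl_iff]
  change Zᶜᶜ ∈ _ ↔ _
  rw [compl_compl]
  rfl

theorem isClosed_aff_iff {Z : Set (Aff n)} :
    IsClosed Z ↔ ∃ S : Set (MvPolynomial (Fin n) Qbar), Z = affZeros S := by
  rw [← isOpen_compl_iff]
  change Zᶜᶜ ∈ _ ↔ _
  rw [compl_compl]
  rfl

theorem eval_smul_of_isHomogeneous {ι : Type*} {f : MvPolynomial ι Qbar} {t : ℕ}
    (hf : f.IsHomogeneous t) (c : Qbar) (v : ι → Qbar) :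
    eval (c • v) f = c ^ t * eval v f := by
  have := aeval_smul_of_isHomogeneous hf c v
  rwa [aeval_eq_eval, aeval_eq_eval] at this

theorem eval_rep_eq_zero_iff {f : MvPolynomial (Fin (n + 1)) Qbar} {e : ℕ}
    (hf : f.IsHomogeneous e) (v : Fin (n + 1) → Qbar) (hv : v ≠ 0) :
    eval (Projectivization.mk Qbar v hv).rep f = 0 ↔ eval v f = 0 := by
  obtain ⟨a, ha⟩ := Projectivization.exists_smul_eq_mk_rep Qbar v hv
  rw [← ha, Units.smul_def, eval_smul_of_isHomogeneous hf]
  simp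

theorem mem_projZeros_iff {S : Set (MvPolynomial (Fin (n + 1)) Qbar)}
    (hS : ∀ f ∈ S, ∃ e : ℕ, f.IsHomogeneous e) (v : Fin (n + 1) → Qbar) (hv : v ≠ 0) :
    Projectivization.mk Qbar v hv ∈ projZeros S ↔ ∀ f ∈ S, eval v f = 0 := by
  refine forall₂_congr fun f hf => ?_
  obtain ⟨e, he⟩ := hS f hf
  exact eval_rep_eq_zero_iff he v hv

theorem mem_homIdeal_iff {Z : Set (Proj n)} {f : MvPolynomial (Fin (n + 1)) Qbar} :
    f ∈ homIdeal Z ↔ ∀ (v : Fin (n + 1) → Qbar) (hv : v ≠ 0),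
      Projectivization.mk Qbar v hv ∈ Z → eval v f = 0 := by
  rw [homIdeal, mem_vanishingIdeal_iff]
  constructor
  · intro h v hv hvZ
    have := h v ⟨hv, hvZ⟩
    rwa [aeval_eq_eval] at this
  · rintro h v ⟨hv, hvZ⟩
    rw [aeval_eq_eval]
    exact h v hv hvZ

theorem mk_smul_eq (c : Qbar) (hc : c ≠ 0) (v : Fin (n + 1) → Qbar) (hv : v ≠ 0) :
    Projectivization.mk Qbar (c • v) (smul_ne_zero hc hv) = Projectivization.mk Qbar v hv := by
  rw [Projectivization.mk_eq_mk_iff]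
  exact ⟨Units.mk0 c hc, rfl⟩

/-- The values of the components at v are the coefficients of the polynomial c ↦ f(c v), which has
infinitely many roots. -/
theorem eval_homogeneousComponent_eq_zero {ι : Type*} (f : MvPolynomial ι Qbar) (v : ι → Qbar)
    (h : ∀ c : Qbar, c ≠ 0 → eval (c • v) f = 0) (t : ℕ) :
    eval v (homogeneousComponent t f) = 0 := by
  let P : Polynomial Qbar := ∑ i ∈ Finset.range (f.totalDegree + 1),
    Polynomial.C (eval v (homogeneousComponent i f)) * Polynomial.X ^ i
  have hP : P = 0 := by
    refine Polynomial.eq_zero_of_infinite_isRoot _ ?_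
    refine Set.Infinite.mono (s := {0}ᶜ) ?_ (Set.Finite.infinite_compl (Set.finite_singleton 0))
    intro c hc
    have h1 := h c hc
    rw [← sum_homogeneousComponent f, map_sum] at h1
    simp_rw [eval_smul_of_isHomogeneous (homogeneousComponent_isHomogeneous _ f)] at h1
    change Polynomial.eval c P = 0
    simp only [P, Polynomial.eval_finsetSum, Polynomial.eval_mul, Polynomial.eval_C,
      Polynomial.eval_pow, Polynomial.eval_X]
    rw [← h1]
    exact Finset.sum_congr rfl fun i _ => mul_comm _ _
  by_cases ht : t < f.totalDegree + 1
  · have h2 := congrArg (fun q => Polynomial.coeff q t) hP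
    simp only [P, Polynomial.finsetSum_coeff, Polynomial.coeff_C_mul_X_pow, Finset.sum_ite_eq,
      Finset.mem_range, ht, if_true, Polynomial.coeff_zero] at h2
    exact h2
  · rw [homogeneousComponent_eq_zero _ _ (by omega), map_zero]

theorem isGradedIdeal_homIdeal (Z : Set (Proj n)) : IsGradedIdeal (homIdeal Z) := by
  intro f hf t
  rw [mem_homIdeal_iff] at hf ⊢
  intro v hv hvZ
  refine eval_homogeneousComponent_eq_zero f v (fun c hc => ?_) t
  refine hf (c • v) (smul_ne_zero hc hv) ?_
  rwa [mk_smul_eq c hc v hv]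

theorem mk_mem_iff_of_isClosed {Z : Set (Proj n)} (hZ : IsClosed Z) (v : Fin (n + 1) → Qbar)
    (hv : v ≠ 0) : Projectivization.mk Qbar v hv ∈ Z ↔ ∀ f ∈ homIdeal Z, eval v f = 0 := by
  refine ⟨fun h f hf => mem_homIdeal_iff.1 hf v hv h, fun h => ?_⟩
  obtain ⟨S, hS, rfl⟩ := isClosed_proj_iff.1 hZ
  rw [mem_projZeros_iff hS]
  intro f hf
  refine h f (mem_homIdeal_iff.2 fun w hw hwZ => ?_)
  exact (mem_projZeros_iff hS w hw).1 hwZ f hf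

theorem homIdeal_anti {Z Z' : Set (Proj n)} (h : Z ⊆ Z') : homIdeal Z' ≤ homIdeal Z := by
  intro f hf
  rw [mem_homIdeal_iff] at hf ⊢
  exact fun v hv hvZ => hf v hv (h hvZ)

theorem subset_of_homIdeal_le {Z Z' : Set (Proj n)} (hZ' : IsClosed Z')
    (h : homIdeal Z' ≤ homIdeal Z) : Z ⊆ Z' := by
  intro p hp
  induction p using Projectivization.ind with
  | h v hv =>
    rw [mk_mem_iff_of_isClosed hZ']
    exact fun f hf => mem_homIdeal_iff.1 (h hf) v hv hp

theorem homIdeal_lt {Z Z' : Set (Proj n)} (hZ : IsClosed Z) (h : Z ⊂ Z') :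
    homIdeal Z' < homIdeal Z := by
  refine lt_of_le_not_ge (homIdeal_anti h.1) fun hle => h.2 ?_
  exact subset_of_homIdeal_le hZ hle

theorem isClosed_projZeros {Q : Ideal (MvPolynomial (Fin (n + 1)) Qbar)} (hQ : IsGradedIdeal Q) :
    IsClosed (projZeros (Q : Set (MvPolynomial (Fin (n + 1)) Qbar))) := by
  rw [isClosed_proj_iff]
  refine ⟨{f | f ∈ Q ∧ ∃ e : ℕ, f.IsHomogeneous e}, fun f hf => hf.2, ?_⟩
  ext p
  constructor
  · intro h f hf
    exact h f hf.1
  · intro h f hf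
    rw [← sum_homogeneousComponent f, map_sum]
    exact Finset.sum_eq_zero fun t _ =>
      h _ ⟨hQ f hf t, t, homogeneousComponent_isHomogeneous t f⟩

theorem mk_mem_projZeros_iff {Q : Ideal (MvPolynomial (Fin (n + 1)) Qbar)} (hQ : IsGradedIdeal Q)
    (v : Fin (n + 1) → Qbar) (hv : v ≠ 0) :
    Projectivization.mk Qbar v hv ∈ projZeros (Q : Set (MvPolynomial (Fin (n + 1)) Qbar)) ↔
      ∀ f ∈ Q, eval v f = 0 := by
  have key : ∀ w : Fin (n + 1) → Qbar, (∀ f ∈ Q, eval w f = 0) ↔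
      ∀ f ∈ Q, ∀ t, eval w (homogeneousComponent t f) = 0 := by
    intro w
    constructor
    · exact fun h f hf t => h _ (hQ f hf t)
    · intro h f hf
      rw [← sum_homogeneousComponent f, map_sum]
      exact Finset.sum_eq_zero fun t _ => h f hf t
  change (∀ f ∈ Q, eval (Projectivization.mk Qbar v hv).rep f = 0) ↔ _
  rw [key, key]
  exact forall₂_congr fun f _ => forall_congr' fun t =>
    eval_rep_eq_zero_iff (homogeneousComponent_isHomogeneous t f) v hv

/-- The projective Nullstellensatz for prime ideals. -/
theorem homIdeal_projZeros {Q : Ideal (MvPolynomial (Fin (n + 1)) Qbar)} (hQ : IsGradedIdeal Q)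
    (hQp : Q.IsPrime) (hQi : ∃ i, X i ∉ Q) :
    homIdeal (projZeros (Q : Set (MvPolynomial (Fin (n + 1)) Qbar))) = Q := by
  apply le_antisymm
  · intro f hf
    obtain ⟨i, hi⟩ := hQi
    -- The factor X i takes care of the origin, which is no projective point; after that the affine
    -- Nullstellensatz applies.
    have h1 : X i * f ∈ vanishingIdeal Qbar (zeroLocus Qbar Q) := by
      rw [mem_vanishingIdeal_iff]
      intro v hv
      rw [aeval_eq_eval, map_mul, eval_X]
      by_cases hv0 : v = 0
      · simp [hv0]
      · rw [mem_homIdeal_iff.1 hf v hv0 ((mk_mem_projZeros_iff hQ v hv0).2 fun g hg => by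
          have := hv g hg
          rwa [aeval_eq_eval] at this), mul_zero]
    rw [IsPrime.vanishingIdeal_zeroLocus] at h1
    exact (hQp.mem_or_mem h1).resolve_left hi
  · intro f hf
    rw [mem_homIdeal_iff]
    exact fun v hv hvZ => (mk_mem_projZeros_iff hQ v hv).1 hvZ f hf

/-- The zero set of the homogeneous ideal is closed. It follows that equations of a projective
closure can be tested on affine points. -/
theorem homIdeal_closure (Z : Set (Proj n)) : homIdeal (closure Z) = homIdeal Z := by
  apply le_antisymm (homIdeal_anti subset_closure)
  have h : closure Z ⊆ projZeros (homIdeal Z : Set (MvPolynomial (Fin (n + 1)) Qbar)) := by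
    refine closure_minimal ?_ (isClosed_projZeros (isGradedIdeal_homIdeal Z))
    intro p hp
    induction p using Projectivization.ind with
    | h v hv =>
      rw [mk_mem_projZeros_iff (isGradedIdeal_homIdeal Z)]
      exact fun f hf => mem_homIdeal_iff.1 hf v hv hp
  intro f hf
  rw [mem_homIdeal_iff]
  exact fun v hv hvZ => (mk_mem_projZeros_iff (isGradedIdeal_homIdeal Z) v hv).1 (h hvZ) f hf

theorem homIdeal_ne_top {Z : Set (Proj n)} (hZ : Z.Nonempty) : homIdeal Z ≠ ⊤ := by
  obtain ⟨p, hp⟩ := hZ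
  induction p using Projectivization.ind with
  | h v hv =>
    intro h
    have := mem_homIdeal_iff.1 (h ▸ Submodule.mem_top : (1 : MvPolynomial _ Qbar) ∈ homIdeal Z)
      v hv hp
    simp at this

theorem exists_X_notMem_homIdeal {Z : Set (Proj n)} (hZ : Z.Nonempty) :
    ∃ i, X i ∉ homIdeal Z := by
  obtain ⟨p, hp⟩ := hZ
  induction p using Projectivization.ind with
  | h v hv =>
    obtain ⟨i, hi⟩ := Function.ne_iff.1 hv
    refine ⟨i, fun h => hi ?_⟩
    simpa using mem_homIdeal_iff.1 h v hv hp

theorem isPrime_homIdeal {Z : Set (Proj n)} (hZ : IsIrreducible Z) : (homIdeal Z).IsPrime := by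
  refine (isGradedIdeal_homIdeal Z).isPrime (homIdeal_ne_top hZ.1) ?_
  intro f g s t hf hg hfg
  have hc : ∀ (f : MvPolynomial (Fin (n + 1)) Qbar) (s : ℕ), f.IsHomogeneous s →
      IsClosed (projZeros {f}) := fun f s hf =>
    isClosed_proj_iff.2 ⟨{f}, by rintro _ rfl; exact ⟨s, hf⟩, rfl⟩
  have hsub : Z ⊆ projZeros {f} ∪ projZeros {g} := by
    intro p hp
    induction p using Projectivization.ind with
    | h v hv =>
      have h1 := mem_homIdeal_iff.1 hfg v hv hp
      rw [map_mul, mul_eq_zero] at h1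
      rcases h1 with h1 | h1
      · left
        rw [mem_projZeros_iff (by rintro _ rfl; exact ⟨s, hf⟩)]
        rintro _ rfl; exact h1
      · right
        rw [mem_projZeros_iff (by rintro _ rfl; exact ⟨t, hg⟩)]
        rintro _ rfl; exact h1
  rcases isPreirreducible_iff_isClosed_union_isClosed.1 hZ.2 _ _ (hc f s hf) (hc g t hg) hsub
    with h | h
  · left
    rw [mem_homIdeal_iff]
    exact fun v hv hvZ => (mem_projZeros_iff (by rintro _ rfl; exact ⟨s, hf⟩) v hv).1 (h hvZ) f rfl
  · right
    rw [mem_homIdeal_iff]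
    exact fun v hv hvZ => (mem_projZeros_iff (by rintro _ rfl; exact ⟨t, hg⟩) v hv).1 (h hvZ) g rfl

theorem isIrreducible_of_isPrime_homIdeal {Z : Set (Proj n)} (h : (homIdeal Z).IsPrime) :
    IsIrreducible Z := by
  constructor
  · rw [Set.nonempty_iff_ne_empty]
    rintro rfl
    refine h.ne_top ?_
    rw [Ideal.eq_top_iff_one, mem_homIdeal_iff]
    exact fun _ _ h => h.elim
  · rw [isPreirreducible_iff_isClosed_union_isClosed]
    intro Z₁ Z₂ h₁ h₂ hsub
    by_contra! hcon
    have h1 : ¬ homIdeal Z₁ ≤ homIdeal Z := fun hle => hcon.1 (subset_of_homIdeal_le h₁ hle)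
    have h2 : ¬ homIdeal Z₂ ≤ homIdeal Z := fun hle => hcon.2 (subset_of_homIdeal_le h₂ hle)
    obtain ⟨f, hf, hfZ⟩ := SetLike.not_le_iff_exists.1 h1
    obtain ⟨g, hg, hgZ⟩ := SetLike.not_le_iff_exists.1 h2
    have h3 : f * g ∈ homIdeal Z := by
      rw [mem_homIdeal_iff]
      intro v hv hvZ
      rw [map_mul]
      rcases hsub hvZ with h | h
      · rw [mem_homIdeal_iff.1 hf v hv h, zero_mul]
      · rw [mem_homIdeal_iff.1 hg v hv h, mul_zero]
    exact (h.mem_or_mem h3).elim hfZ hgZ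

/-- `x` is a generic point of the affine cone over `Z`, with values in the field it generates. -/
structure IsGenericPoint {E : Type*} [Field E] [Algebra Qbar E] (Z : Set (Proj n))
    (x : Fin (n + 1) → E) : Prop where
  aeval_eq_zero_iff : ∀ f : MvPolynomial (Fin (n + 1)) Qbar, aeval x f = 0 ↔ f ∈ homIdeal Z
  adjoin_eq_top : IntermediateField.adjoin Qbar (Set.range x) = ⊤

/-- The classes of the variables in the fraction field of the homogeneous coordinate ring. -/
theorem exists_isGenericPoint {Z : Set (Proj n)} (hZ : IsIrreducible Z) :
    ∃ (E : Type) (_ : Field E) (_ : Algebra Qbar E) (x : Fin (n + 1) → E), IsGenericPoint Z x := by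
  have hp := isPrime_homIdeal hZ
  let R := MvPolynomial (Fin (n + 1)) Qbar ⧸ homIdeal Z
  let E := FractionRing R
  let x : Fin (n + 1) → E := fun i => algebraMap R E (Ideal.Quotient.mk _ (X i))
  have hx : ∀ f : MvPolynomial (Fin (n + 1)) Qbar,
      aeval x f = algebraMap R E (Ideal.Quotient.mk _ f) := by
    intro f
    have : (aeval x : MvPolynomial (Fin (n + 1)) Qbar →ₐ[Qbar] E) =
        (IsScalarTower.toAlgHom Qbar R E).comp (Ideal.Quotient.mkₐ Qbar (homIdeal Z)) := by
      apply MvPolynomial.algHom_ext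
      intro i
      rw [aeval_X]
      rfl
    rw [this]
    rfl
  refine ⟨E, inferInstance, inferInstance, x, ?_, ?_⟩
  · intro f
    rw [hx, ← Ideal.Quotient.eq_zero_iff_mem]
    exact map_eq_zero_iff _ (IsFractionRing.injective R E)
  · rw [eq_top_iff]
    intro e _
    obtain ⟨a, b, -, rfl⟩ := IsFractionRing.div_surjective (A := R) e
    obtain ⟨f, rfl⟩ := Ideal.Quotient.mk_surjective a
    obtain ⟨g, hg⟩ := Ideal.Quotient.mk_surjective b
    rw [← hg, ← hx, ← hx]
    exact (IntermediateField.mem_adjoin_range_iff Qbar x _).2 ⟨f, g, rfl⟩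

variable {E : Type*} [Field E] [Algebra Qbar E] {Z : Set (Proj n)} {x : Fin (n + 1) → E}

theorem IsGenericPoint.ker_eq (hx : IsGenericPoint Z x) :
    RingHom.ker (aeval x : MvPolynomial (Fin (n + 1)) Qbar →ₐ[Qbar] E) = homIdeal Z := by
  ext f
  exact hx.aeval_eq_zero_iff f

theorem IsGenericPoint.isConical (hx : IsGenericPoint Z x) : IsConical Qbar x := by
  intro p t hp
  rw [hx.aeval_eq_zero_iff] at hp ⊢
  exact isGradedIdeal_homIdeal Z p hp t

theorem IsGenericPoint.mk_mem_iff (hx : IsGenericPoint Z x) (hZ : IsClosed Z)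
    (v : Fin (n + 1) → Qbar) (hv : v ≠ 0) :
    Projectivization.mk Qbar v hv ∈ Z ↔ Specializes Qbar x v := by
  rw [mk_mem_iff_of_isClosed hZ]
  refine forall_congr' fun f => ?_
  rw [hx.aeval_eq_zero_iff, aeval_eq_eval]

theorem IsGenericPoint.isIrreducible (hx : IsGenericPoint Z x) : IsIrreducible Z :=
  isIrreducible_of_isPrime_homIdeal (hx.ker_eq ▸ RingHom.ker_isPrime _)

theorem IsGenericPoint.hilbertFunction_eq (hx : IsGenericPoint Z x) (t : ℕ) :
    hilbertFunction Z t = Module.finrank Qbar (gradedPart Qbar x t) := by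
  let φ : homogeneousSubmodule (Fin (n + 1)) Qbar t →ₗ[Qbar] E :=
    (aeval x : MvPolynomial (Fin (n + 1)) Qbar →ₐ[Qbar] E).toLinearMap.comp
      (homogeneousSubmodule (Fin (n + 1)) Qbar t).subtype
  have hker : ((homIdeal Z).restrictScalars Qbar).comap
      (homogeneousSubmodule (Fin (n + 1)) Qbar t).subtype = LinearMap.ker φ := by
    ext f
    rw [LinearMap.mem_ker]
    exact (hx.aeval_eq_zero_iff _).symm
  have hrange : gradedPart Qbar x t = LinearMap.range φ := by
    rw [gradedPart, LinearMap.range_comp, Submodule.range_subtype]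
  rw [hilbertFunction, hker, hrange]
  exact LinearEquiv.finrank_eq φ.quotKerEquivRange

end ProjectiveGeometry

/-! ### Dimension and degree from a normalizing system -/

section Dimension

open TopologicalSpace

/-- The prime ideals generated by the last `i` of `r + 1` variables. -/
theorem exists_primes_mvPolynomial (k : Type*) [Field k] (r : ℕ) :
    ∃ P : ℕ → Ideal (MvPolynomial (Fin (r + 1)) k), P 0 = ⊥ ∧
      (∀ i, (P i).IsPrime ∧ IsGradedIdeal (P i) ∧ P i ≤ P (i + 1)) ∧
      (∀ i ≤ r, X 0 ∉ P i) ∧ ∀ i < r, ¬ P (i + 1) ≤ P i := by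
  classical
  -- The substitution that kills the last i variables; up to i = r the variable X 0 survives.
  let s : ℕ → Fin (r + 1) → MvPolynomial (Fin (r + 1)) k :=
    fun i j => if r < (j : ℕ) + i then 0 else X j
  have hs : ∀ i j, s i j = if r < (j : ℕ) + i then 0 else X j := fun i j => rfl
  have hslin : ∀ i j, (s i j).IsHomogeneous 1 := by
    intro i j
    rw [hs]
    split_ifs
    · exact isHomogeneous_zero _ _ _
    · exact isHomogeneous_X k j
  refine ⟨fun i => RingHom.ker (bind₁ (s i)), ?_, fun i => ⟨RingHom.ker_isPrime _, ?_, ?_⟩, ?_, ?_⟩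
  · have : s 0 = X := by
      funext j
      rw [hs, if_neg (by have := j.2; omega)]
    change RingHom.ker (bind₁ (s 0)) = ⊥
    rw [this, bind₁_X_left]
    ext f
    simp
  · intro p hp t
    rw [RingHom.mem_ker] at hp ⊢
    rw [← homogeneousComponent_bind₁ (hslin i), hp, map_zero]
  · intro p hp
    rw [RingHom.mem_ker] at hp ⊢
    have : (bind₁ (s (i + 1))) = (bind₁ (s (i + 1))).comp (bind₁ (s i)) := by
      apply MvPolynomial.algHom_ext
      intro j
      rw [AlgHom.comp_apply, bind₁_X_right, bind₁_X_right, hs i j]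
      split_ifs with h
      · rw [map_zero, hs, if_pos (by omega)]
      · rw [bind₁_X_right]
    rw [this, AlgHom.comp_apply, hp, map_zero]
  · intro i hi h
    rw [RingHom.mem_ker, bind₁_X_right, hs, if_neg (by simpa using hi)] at h
    exact X_ne_zero _ h
  · intro i hi hle
    have h1 : (X ⟨r - i, by omega⟩ : MvPolynomial (Fin (r + 1)) k) ∈
        RingHom.ker (bind₁ (s (i + 1))) := by
      rw [RingHom.mem_ker, bind₁_X_right, hs, if_pos (by change r < (r - i) + (i + 1); omega)]
    have h2 := hle h1
    rw [RingHom.mem_ker, bind₁_X_right, hs, if_neg (by change ¬ r < (r - i) + i; omega)] at h2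
    exact X_ne_zero _ h2

variable {n r : ℕ} {E : Type*} [Field E] [Algebra Qbar E] {Z : Set (Proj n)} {x : Fin (n + 1) → E}
  {ℓ : Fin (r + 1) → MvPolynomial (Fin (n + 1)) Qbar}

/-- Graded going up along the chain of ideals generated by variables. As X 0 is outside these
ideals, no member of the lifted chain lies in the hyperplane ℓ 0 = 0; for ℓ 0 = x₀ this lets the
chain restrict to the affine chart. -/
theorem IsGenericPoint.exists_chain (hx : IsGenericPoint Z x) (hZ : IsClosed Z)
    (hℓ : ∀ i, (ℓ i).IsHomogeneous 1)
    (hy : AlgebraicIndependent Qbar fun i => aeval x (ℓ i))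
    (hint : ∀ j, IsIntegral (Algebra.adjoin Qbar (Set.range fun i => aeval x (ℓ i))) (x j)) :
    ∃ V : ℕ → Set (Proj n), (∀ i ≤ r, IsClosed (V i) ∧ IsIrreducible (V i) ∧ V i ⊆ Z ∧
      ℓ 0 ∉ homIdeal (V i)) ∧ ∀ i < r, V (i + 1) ⊂ V i := by
  obtain ⟨P, hP0, hP, hPX, hPlt⟩ := exists_primes_mvPolynomial Qbar r
  let T : ℕ → Type := fun i => {Q : Ideal (MvPolynomial (Fin (n + 1)) Qbar) //
    Q.IsPrime ∧ IsGradedIdeal Q ∧ homIdeal Z ≤ Q ∧ Q.comap (bind₁ ℓ) = P i}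
  have hstep : ∀ i (Q : T i), ∃ Q' : T (i + 1), Q.1 ≤ Q'.1 := by
    rintro i ⟨Q, hQp, hQg, hQk, hQc⟩
    obtain ⟨Q', h1, h2, h3, h4⟩ := exists_isPrime_isGradedIdeal_comap_bind₁_eq hℓ hint hQp hQg
      (hx.ker_eq ▸ hQk) (hP (i + 1)).1 (hP (i + 1)).2.1 (hQc ▸ (hP i).2.2)
    exact ⟨⟨Q', h2, h3, hQk.trans h1, h4⟩, h1⟩
  choose next hnext using hstep
  let Q₀ : T 0 := ⟨homIdeal Z, hx.ker_eq ▸ RingHom.ker_isPrime _, isGradedIdeal_homIdeal Z, le_rfl,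
    by
      rw [hP0, eq_bot_iff]
      intro f hf
      rw [Ideal.mem_comap, ← hx.aeval_eq_zero_iff, aeval_bind₁_eq] at hf
      exact hy (hf.trans (map_zero _).symm)⟩
  let Q : ∀ i, T i := fun i => Nat.rec Q₀ (fun i q => next i q) i
  have hQle : ∀ i, (Q i).1 ≤ (Q (i + 1)).1 := fun i => hnext i (Q i)
  have hQℓ : ∀ i ≤ r, ℓ 0 ∉ (Q i).1 := by
    intro i hi h
    apply hPX i hi
    rw [← (Q i).2.2.2.2, Ideal.mem_comap, bind₁_X_right]
    exact h
  have hQX : ∀ i ≤ r, ∃ j, X j ∉ (Q i).1 := by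
    intro i hi
    by_contra! hcon
    apply hQℓ i hi
    have h1 : ℓ 0 ∈ homogeneousSubmodule (Fin (n + 1)) Qbar 1 := hℓ 0
    rw [homogeneousSubmodule_one_eq_span_X] at h1
    have h2 : Submodule.span Qbar (Set.range X) ≤ (Q i).1.restrictScalars Qbar := by
      rw [Submodule.span_le]
      rintro _ ⟨j, rfl⟩
      exact hcon j
    exact h2 h1
  have hI : ∀ i ≤ r, homIdeal (projZeros ((Q i).1 : Set (MvPolynomial (Fin (n + 1)) Qbar))) =
      (Q i).1 := fun i hi => homIdeal_projZeros (Q i).2.2.1 (Q i).2.1 (hQX i hi)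
  refine ⟨fun i => projZeros ((Q i).1 : Set (MvPolynomial (Fin (n + 1)) Qbar)), ?_, ?_⟩
  · intro i hi
    refine ⟨isClosed_projZeros (Q i).2.2.1, isIrreducible_of_isPrime_homIdeal ?_,
      subset_of_homIdeal_le hZ ?_, ?_⟩
    · rw [hI i hi]; exact (Q i).2.1
    · rw [hI i hi]; exact (Q i).2.2.2.1
    · rw [hI i hi]; exact hQℓ i hi
  · intro i hi
    refine ⟨fun p hp f hf => hp f (hQle i hf), fun hsub => hPlt i hi ?_⟩
    have h1 := homIdeal_anti hsub
    rw [hI i hi.le, hI (i + 1) hi] at h1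
    rw [← (Q i).2.2.2.2, ← (Q (i + 1)).2.2.2.2]
    exact Ideal.comap_mono h1

theorem isIrreducible_preimage_val {X : Type*} [TopologicalSpace X] {Z V : Set X}
    (hV : IsIrreducible V) (hVZ : V ⊆ Z) : IsIrreducible ((↑) ⁻¹' V : Set Z) := by
  constructor
  · obtain ⟨p, hp⟩ := hV.1
    exact ⟨⟨p, hVZ hp⟩, hp⟩
  · intro u v hu hv hu' hv'
    obtain ⟨u₁, hu₁, rfl⟩ := isOpen_induced_iff.1 hu
    obtain ⟨v₁, hv₁, rfl⟩ := isOpen_induced_iff.1 hv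
    obtain ⟨⟨p, hp⟩, hpV, hpu⟩ := hu'
    obtain ⟨⟨q, hq⟩, hqV, hqv⟩ := hv'
    obtain ⟨w, hwV, hwu, hwv⟩ := hV.2 u₁ v₁ hu₁ hv₁ ⟨p, hpV, hpu⟩ ⟨q, hqV, hqv⟩
    exact ⟨⟨w, hVZ hwV⟩, hwV, hwu, hwv⟩

theorem le_topologicalKrullDim_of_chain {X : Type*} [TopologicalSpace X] {Z : Set X} {r : ℕ}
    (V : ℕ → Set X) (hV : ∀ i ≤ r, IsClosed (V i) ∧ IsIrreducible (V i) ∧ V i ⊆ Z)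
    (hlt : ∀ i < r, V (i + 1) ⊂ V i) : (r : WithBot ℕ∞) ≤ topologicalKrullDim Z := by
  let s : LTSeries (IrreducibleCloseds Z) :=
    { length := r
      toFun := fun i => ⟨(↑) ⁻¹' V (r - i),
        isIrreducible_preimage_val (hV _ (Nat.sub_le _ _)).2.1 (hV _ (Nat.sub_le _ _)).2.2,
        (hV _ (Nat.sub_le _ _)).1.preimage continuous_subtype_val⟩
      step := by
        intro i
        have h1 : r - ((i.castSucc : Fin (r + 1)) : ℕ) = (r - (i.succ : Fin (r + 1))) + 1 := by
          have := i.2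
          simp only [Fin.val_castSucc, Fin.val_succ]
          omega
        have h2 := hlt (r - (i.succ : Fin (r + 1))) (by
          have := i.2
          simp only [Fin.val_succ]
          omega)
        rw [← h1] at h2
        refine ⟨fun p hp => h2.1 hp, fun hle => h2.2 fun p hp => ?_⟩
        exact @hle ⟨p, (hV _ (Nat.sub_le _ _)).2.2 hp⟩ hp }
  exact Order.LTSeries.length_le_krullDim s

/-- The vertex of the cone contributes one more prime ideal above those of closed subsets, which
accounts for the difference between r + 1 and r. -/
theorem homIdeal_lt_ker_aeval_zero {W : Set (Proj n)} (hW : W.Nonempty) :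
    homIdeal W < RingHom.ker (aeval (0 : Fin (n + 1) → Qbar)) := by
  obtain ⟨i, hi⟩ := exists_X_notMem_homIdeal hW
  obtain ⟨p, hp⟩ := hW
  refine lt_of_le_not_ge ?_ fun hle => hi (hle (by rw [RingHom.mem_ker]; simp))
  intro f hf
  induction p using Projectivization.ind with
  | h v hv =>
    have h1 := mem_homIdeal_iff.1 (isGradedIdeal_homIdeal W f hf 0) v hv hp
    rw [homogeneousComponent_zero, eval_C] at h1
    rw [RingHom.mem_ker, aeval_zero, ← constantCoeff_eq] at *
    rw [h1, map_zero]

/-- Going up gives a chain of length r. By incomparability, chains of closed subsets, extended by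
the vertex, contract to strict chains of primes in a polynomial ring of dimension r + 1. -/
theorem IsGenericPoint.topologicalKrullDim_eq (hx : IsGenericPoint Z x) (hZ : IsClosed Z)
    (hℓ : ∀ i, (ℓ i).IsHomogeneous 1)
    (hy : AlgebraicIndependent Qbar fun i => aeval x (ℓ i))
    (hint : ∀ j, IsIntegral (Algebra.adjoin Qbar (Set.range fun i => aeval x (ℓ i))) (x j)) :
    topologicalKrullDim Z = r := by
  classical
  have hZi := hx.isIrreducible
  apply le_antisymm
  · have : Nonempty (IrreducibleCloseds Z) :=
      ⟨⟨(↑) ⁻¹' Z, isIrreducible_preimage_val hZi le_rfl,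
        hZ.preimage continuous_subtype_val⟩⟩
    have hirr : ∀ W : IrreducibleCloseds Z, IsIrreducible ((↑) '' (W : Set Z) : Set (Proj n)) :=
      fun W => W.isIrreducible.image _ continuous_subtype_val.continuousOn
    have hcl : ∀ W : IrreducibleCloseds Z, IsClosed ((↑) '' (W : Set Z) : Set (Proj n)) :=
      fun W => (hZ.isClosedEmbedding_subtypeVal.isClosedMap _ W.isClosed)
    have hker : ∀ W : IrreducibleCloseds Z, RingHom.ker (aeval x) ≤
        homIdeal ((↑) '' (W : Set Z) : Set (Proj n)) := by
      intro W
      rw [hx.ker_eq]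
      refine homIdeal_anti ?_
      rintro _ ⟨p, -, rfl⟩
      exact p.2
    have hpr : ∀ W : IrreducibleCloseds Z,
        ((homIdeal ((↑) '' (W : Set Z) : Set (Proj n))).comap (bind₁ ℓ)).IsPrime := fun W => by
      have := isPrime_homIdeal (hirr W)
      exact Ideal.comap_isPrime _ _
    have hpr0 : ((RingHom.ker (aeval (0 : Fin (n + 1) → Qbar) :
        MvPolynomial (Fin (n + 1)) Qbar →ₐ[Qbar] Qbar)).comap (bind₁ ℓ)).IsPrime := by
      have := RingHom.ker_isPrime (aeval (0 : Fin (n + 1) → Qbar) :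
        MvPolynomial (Fin (n + 1)) Qbar →ₐ[Qbar] Qbar)
      exact Ideal.comap_isPrime _ _
    -- The added bottom element plays the role of the empty set and goes to the contraction of the
    -- ideal of the vertex.
    let f : WithBot (IrreducibleCloseds Z) →
        (PrimeSpectrum (MvPolynomial (Fin (r + 1)) Qbar))ᵒᵈ := fun W =>
      match W with
      | ⊥ => OrderDual.toDual ⟨_, hpr0⟩
      | (W : IrreducibleCloseds Z) => OrderDual.toDual ⟨_, hpr W⟩
    have hf : StrictMono f := by
      intro W W' hWW'
      induction W' with
      | bot => exact absurd hWW' not_lt_bot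
      | coe W' =>
        induction W with
        | bot =>
          refine OrderDual.toDual_lt_toDual.2 ?_
          exact comap_bind₁_lt_comap_bind₁ hint (isPrime_homIdeal (hirr W')) (hker W')
            (homIdeal_lt_ker_aeval_zero (hirr W').1)
        | coe W =>
          refine OrderDual.toDual_lt_toDual.2 ?_
          refine comap_bind₁_lt_comap_bind₁ hint (isPrime_homIdeal (hirr W')) (hker W')
            (homIdeal_lt (hcl W) ?_)
          have h0 : W < W' := WithBot.coe_lt_coe.1 hWW'
          exact Subtype.val_injective.image_strictMono h0
    have h1 := Order.krullDim_le_of_strictMono f hf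
    rw [Order.krullDim_withBot, Order.krullDim_orderDual] at h1
    have h2 : Order.krullDim (PrimeSpectrum (MvPolynomial (Fin (r + 1)) Qbar)) =
        ((r + 1 : ℕ) : WithBot ℕ∞) := by
      have := ringKrullDim_of_isNoetherianRing (R := Qbar) (ι := Fin (r + 1))
      rw [ringKrullDim_eq_zero_of_field, zero_add, Nat.card_fin] at this
      exact this
    rw [h2] at h1
    have h3 : topologicalKrullDim Z + 1 ≤ (r : WithBot ℕ∞) + 1 := by exact_mod_cast h1
    exact (ENat.WithBot.add_le_add_one_right_iff).1 h3
  · obtain ⟨V, hV, hVlt⟩ := hx.exists_chain hZ hℓ hy hint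
    exact le_topologicalKrullDim_of_chain V
      (fun i hi => ⟨(hV i hi).1, (hV i hi).2.1, (hV i hi).2.2.1⟩) hVlt

/-- The dimension and the degree of a projective variety are read off from a system of linear forms
without common zeros on it. -/
theorem IsGenericPoint.hasDegree (hx : IsGenericPoint Z x) (hZ : IsClosed Z)
    (hℓ : ∀ i, (ℓ i).IsHomogeneous 1)
    (hy : AlgebraicIndependent Qbar fun i => aeval x (ℓ i))
    (hint : ∀ j, IsIntegral (Algebra.adjoin Qbar (Set.range fun i => aeval x (ℓ i))) (x j)) :
    HasDegree Z (Module.finrank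
      (IntermediateField.adjoin Qbar (Set.range fun i => aeval x (ℓ i))) E) := by
  refine ⟨r, hx.topologicalKrullDim_eq hZ hℓ hy hint, ?_⟩
  simp_rw [hx.hilbertFunction_eq]
  exact hx.isConical.tendsto_finrank_gradedPart hx.adjoin_eq_top hℓ hy hint

theorem HasDegree.unique {d d' : ℕ} (h : HasDegree Z d) (h' : HasDegree Z d') : d = d' := by
  obtain ⟨r, hr, ht⟩ := h
  obtain ⟨r', hr', ht'⟩ := h'
  have : r = r' := by
    have := hr.symm.trans hr'
    exact_mod_cast this
  subst this
  exact_mod_cast tendsto_nhds_unique ht ht'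

end Dimension

/-! ### The affine chart and the hyperplane at infinity -/

section AffineChart

variable {n : ℕ}

/-- Dehomogenization with respect to the first variable. -/
noncomputable def dehomogenize (n : ℕ) :
    MvPolynomial (Fin (n + 1)) Qbar →ₐ[Qbar] MvPolynomial (Fin n) Qbar :=
  aeval (Fin.cons 1 X : Fin (n + 1) → MvPolynomial (Fin n) Qbar)

theorem eval_dehomogenize (v : Fin n → Qbar) (f : MvPolynomial (Fin (n + 1)) Qbar) :
    eval v (dehomogenize n f) = eval (Fin.cons 1 v : Fin (n + 1) → Qbar) f := by
  have : ((aeval v : MvPolynomial (Fin n) Qbar →ₐ[Qbar] Qbar).comp (dehomogenize n)) =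
      (aeval (Fin.cons 1 v : Fin (n + 1) → Qbar)) := by
    apply MvPolynomial.algHom_ext
    intro i
    refine Fin.cases ?_ (fun i => ?_) i <;> simp [dehomogenize]
  have h := congrArg (fun φ => φ f) this
  simpa [aeval_eq_eval] using h

theorem exists_dehomogenize_eq (g : MvPolynomial (Fin n) Qbar) :
    ∃ G : MvPolynomial (Fin (n + 1)) Qbar, G.IsHomogeneous g.totalDegree ∧
      dehomogenize n G = g := by
  refine ⟨∑ i ∈ Finset.range (g.totalDegree + 1),
    X 0 ^ (g.totalDegree - i) * rename Fin.succ (homogeneousComponent i g), ?_, ?_⟩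
  · refine IsHomogeneous.sum _ _ _ fun i hi => ?_
    have h1 : g.totalDegree = (g.totalDegree - i) + i := by
      have := Finset.mem_range.1 hi
      omega
    rw [h1]
    refine IsHomogeneous.mul ?_ ((homogeneousComponent_isHomogeneous i g).rename_isHomogeneous)
    simpa using isHomogeneous_X_pow (R := Qbar) (0 : Fin (n + 1)) (g.totalDegree - i)
  · conv_rhs => rw [← sum_homogeneousComponent g]
    rw [map_sum]
    refine Finset.sum_congr rfl fun i _ => ?_
    rw [map_mul, map_pow, dehomogenize, aeval_X, Fin.cons_zero, one_pow, one_mul, aeval_rename]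
    have : (Fin.cons 1 X : Fin (n + 1) → MvPolynomial (Fin n) Qbar) ∘ Fin.succ = X := by
      funext j
      simp
    rw [this, aeval_X_left_apply]

theorem cons_one_ne_zero (v : Fin n → Qbar) : (Fin.cons 1 v : Fin (n + 1) → Qbar) ≠ 0 :=
  fun h => one_ne_zero (congrFun h 0)

theorem affToProj_eq_mk (v : Fin n → Qbar) :
    affToProj v = Projectivization.mk Qbar (Fin.cons 1 v) (cons_one_ne_zero v) := rfl

theorem affToProj_mem_projZeros {S : Set (MvPolynomial (Fin (n + 1)) Qbar)}
    (hS : ∀ f ∈ S, ∃ e : ℕ, f.IsHomogeneous e) (x : Aff n) :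
    affToProj x ∈ projZeros S ↔ x ∈ affZeros (dehomogenize n '' S) := by
  rw [affToProj, mem_projZeros_iff hS]
  simp only [affZeros, Set.mem_ofPred_eq, Set.forall_mem_image]
  refine forall₂_congr fun f _ => ?_
  exact (eval_dehomogenize x f).symm ▸ Iff.rfl

theorem isInducing_affToProj : IsInducing (affToProj (n := n)) := by
  rw [isInducing_iff, TopologicalSpace.ext_iff_isClosed]
  intro Z
  rw [isClosed_induced_iff]
  constructor
  · intro hZ
    obtain ⟨S, rfl⟩ := isClosed_aff_iff.1 hZ
    choose G hG hGS using fun g : MvPolynomial (Fin n) Qbar => exists_dehomogenize_eq g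
    have hS : ∀ f ∈ G '' S, ∃ e : ℕ, f.IsHomogeneous e := by
      rintro _ ⟨g, -, rfl⟩
      exact ⟨_, hG g⟩
    refine ⟨projZeros (G '' S), isClosed_proj_iff.2 ⟨_, hS, rfl⟩, ?_⟩
    ext x
    rw [Set.mem_preimage, affToProj_mem_projZeros hS, Set.image_image]
    simp [hGS]
  · rintro ⟨Z', hZ', rfl⟩
    obtain ⟨S, hS, rfl⟩ := isClosed_proj_iff.1 hZ'
    refine isClosed_aff_iff.2 ⟨dehomogenize n '' S, ?_⟩
    ext x
    exact affToProj_mem_projZeros hS x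

theorem mk_mem_H₀ (v : Fin (n + 1) → Qbar) (hv : v ≠ 0) :
    Projectivization.mk Qbar v hv ∈ H₀ n ↔ v 0 = 0 := by
  have := eval_rep_eq_zero_iff (isHomogeneous_X Qbar (0 : Fin (n + 1))) v hv
  rwa [eval_X, eval_X] at this

theorem isClosed_H₀ : IsClosed (H₀ n) := by
  rw [isClosed_proj_iff]
  refine ⟨{X 0}, by rintro _ rfl; exact ⟨1, isHomogeneous_X _ _⟩, ?_⟩
  ext p
  simp [H₀, projZeros]

theorem exists_affToProj_eq (v : Fin (n + 1) → Qbar) (hv : v ≠ 0) (h0 : v 0 ≠ 0) :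
    affToProj (fun i => v i.succ / v 0 : Fin n → Qbar) = Projectivization.mk Qbar v hv := by
  rw [affToProj_eq_mk, ← mk_smul_eq (v 0) h0 _ (cons_one_ne_zero _)]
  congr 1
  funext i
  refine Fin.cases ?_ (fun i => ?_) i
  · simp
  · simp [mul_div_cancel₀ _ h0]

theorem range_affToProj : Set.range (affToProj (n := n)) = (H₀ n)ᶜ := by
  ext p
  constructor
  · rintro ⟨x, rfl⟩
    rw [Set.mem_compl_iff, affToProj, mk_mem_H₀]
    exact one_ne_zero
  · intro h
    induction p using Projectivization.ind with
    | h v hv =>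
      rw [Set.mem_compl_iff, mk_mem_H₀] at h
      exact ⟨_, exists_affToProj_eq v hv h⟩

theorem affToProj_injective : Function.Injective (affToProj (n := n)) := by
  intro x y h
  rw [affToProj, affToProj, Projectivization.mk_eq_mk_iff'] at h
  obtain ⟨a, ha⟩ := h
  have h0 : a = 1 := (mul_one a).symm.trans (congrFun ha 0)
  rw [h0, one_smul] at ha
  funext i
  exact (congrFun ha i.succ).symm

theorem isOpenEmbedding_affToProj : IsOpenEmbedding (affToProj (n := n)) :=
  ⟨⟨isInducing_affToProj, affToProj_injective⟩, by
    rw [range_affToProj]; exact isClosed_H₀.isOpen_compl⟩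

theorem affToProj_mem_projClosure {X : Set (Aff n)} (hX : IsClosed X) (x : Aff n) :
    affToProj x ∈ projClosure X ↔ x ∈ X := by
  conv_rhs => rw [← hX.closure_eq, isInducing_affToProj.closure_eq_preimage_closure_image]
  rfl

theorem isClosed_projClosure (X : Set (Aff n)) : IsClosed (projClosure X) := isClosed_closure

theorem isIrreducible_projClosure {X : Set (Aff n)} (hX : IsIrreducible X) :
    IsIrreducible (projClosure X) :=
  (hX.image _ isInducing_affToProj.continuous.continuousOn).closure

theorem mem_homIdeal_projClosure {X : Set (Aff n)} {f : MvPolynomial (Fin (n + 1)) Qbar} {e : ℕ}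
    (hf : f.IsHomogeneous e) :
    f ∈ homIdeal (projClosure X) ↔ ∀ x ∈ X, eval x (dehomogenize n f) = 0 := by
  rw [projClosure, homIdeal_closure, mem_homIdeal_iff]
  constructor
  · intro h x hx
    refine (eval_dehomogenize x f).trans ?_
    exact h _ (cons_one_ne_zero x) ⟨x, hx, rfl⟩
  · rintro h v hv ⟨x, hx, hxv⟩
    rw [← eval_rep_eq_zero_iff hf v hv, ← hxv, affToProj, eval_rep_eq_zero_iff hf]
    exact (eval_dehomogenize x f).symm.trans (h x hx)

/-- X is a subspace of its closure, which bounds its dimension above. Below, each set of the chain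
meets the chart and is the closure of its trace there, so the traces still form a strict chain. -/
theorem IsGenericPoint.topologicalKrullDim_affine_eq {r : ℕ} {E : Type*} [Field E]
    [Algebra Qbar E] {X : Set (Aff n)} (hX : IsClosed X) {x : Fin (n + 1) → E}
    (hx : IsGenericPoint (projClosure X) x) {ℓ : Fin (r + 1) → MvPolynomial (Fin (n + 1)) Qbar}
    (hℓ : ∀ i, (ℓ i).IsHomogeneous 1) (hℓ0 : ℓ 0 = MvPolynomial.X 0)
    (hy : AlgebraicIndependent Qbar fun i => aeval x (ℓ i))
    (hint : ∀ j, IsIntegral (Algebra.adjoin Qbar (Set.range fun i => aeval x (ℓ i))) (x j)) :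
    topologicalKrullDim X = r := by
  apply le_antisymm
  · rw [← hx.topologicalKrullDim_eq (isClosed_projClosure X) hℓ hy hint]
    let φ : X → projClosure X := fun p => ⟨affToProj p, subset_closure ⟨p, p.2, rfl⟩⟩
    have hφ : IsInducing φ := by
      refine IsInducing.of_comp (g := ((↑) : projClosure X → Proj n)) ?_ continuous_subtype_val ?_
      · exact (isInducing_affToProj.continuous.comp continuous_subtype_val).subtype_mk _
      · exact isInducing_affToProj.comp IsInducing.subtypeVal
    exact hφ.topologicalKrullDim_le
  · obtain ⟨V, hV, hVlt⟩ := hx.exists_chain (isClosed_projClosure X) hℓ hy hint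
    have hne : ∀ i ≤ r, (V i ∩ Set.range affToProj).Nonempty := by
      intro i hi
      by_contra hcon
      apply (hV i hi).2.2.2
      rw [hℓ0, mem_homIdeal_iff]
      intro v hv hvV
      by_contra h0
      refine hcon ⟨_, hvV, ?_⟩
      rw [range_affToProj, Set.mem_compl_iff, mk_mem_H₀]
      simpa using h0
    refine le_topologicalKrullDim_of_chain (fun i => affToProj ⁻¹' V i) (fun i hi => ⟨?_, ?_, ?_⟩)
      fun i hi => ⟨Set.preimage_mono (hVlt i hi).1, fun hle => (hVlt i hi).2 ?_⟩
    · exact (hV i hi).1.preimage isInducing_affToProj.continuous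
    · exact (hV i hi).2.1.preimage isOpenEmbedding_affToProj (hne i hi)
    · exact fun p hp => (affToProj_mem_projClosure hX p).1 ((hV i hi).2.2.1 hp)
    · refine (subset_closure_inter_of_isPreirreducible_of_isOpen (hV i hi.le).2.1.2
        isOpenEmbedding_affToProj.isOpen_range (hne i hi.le)).trans ?_
      refine closure_minimal ?_ (hV (i + 1) hi).1
      rintro _ ⟨hp, p, rfl⟩
      exact hle hp

theorem IsIrreducible.eval_eq_zero_or {X : Set (Aff n)} (hX : IsIrreducible X)
    {f g : MvPolynomial (Fin n) Qbar} (h : ∀ x ∈ X, eval x (f * g) = 0) :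
    (∀ x ∈ X, eval x f = 0) ∨ ∀ x ∈ X, eval x g = 0 := by
  have hc : ∀ f : MvPolynomial (Fin n) Qbar, IsClosed (affZeros {f}) := fun f =>
    isClosed_aff_iff.2 ⟨{f}, rfl⟩
  have := isPreirreducible_iff_isClosed_union_isClosed.1 hX.2 _ _ (hc f) (hc g) (by
    intro x hx
    have := h x hx
    rw [map_mul, mul_eq_zero] at this
    simpa [affZeros] using this)
  simpa [affZeros, Set.subset_def] using this

end AffineChart

/-! ### Linear projections of projective varieties -/

section LinearProjection

variable {n k : ℕ}

/-- `φ` is given on `Z` by the linear forms `L`, which have no common zero on `Z`. -/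
def IsGivenOn (L : Fin (k + 1) → MvPolynomial (Fin (n + 1)) Qbar) (Z : Set (Proj n))
    (φ : Proj n → Proj k) : Prop :=
  ∀ (v : Fin (n + 1) → Qbar) (hv : v ≠ 0), Projectivization.mk Qbar v hv ∈ Z →
    ∃ h : (fun i => aeval v (L i)) ≠ 0,
      φ (Projectivization.mk Qbar v hv) = Projectivization.mk Qbar (fun i => aeval v (L i)) h

theorem IsGivenOn.mono {L : Fin (k + 1) → MvPolynomial (Fin (n + 1)) Qbar} {Z Z' : Set (Proj n)}
    {φ : Proj n → Proj k} (h : IsGivenOn L Z φ) (hZ : Z' ⊆ Z) : IsGivenOn L Z' φ :=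
  fun v hv hvZ => h v hv (hZ hvZ)

theorem IsGivenOn.projRegularOn {L : Fin (k + 1) → MvPolynomial (Fin (n + 1)) Qbar}
    {Z : Set (Proj n)} {φ : Proj n → Proj k} (h : IsGivenOn L Z φ)
    (hL : ∀ i, (L i).IsHomogeneous 1) : ProjRegularOn Z φ := by
  intro p _
  refine ⟨Set.univ, isOpen_univ, trivial, 1, L, hL, fun v hv hvZ => ?_⟩
  obtain ⟨h1, h2⟩ := h v hv hvZ.1
  simp only [aeval_eq_eval] at h1 h2
  exact ⟨h1, h2⟩

theorem aeval_zero_of_isHomogeneous_one {ι : Type*} {f : MvPolynomial ι Qbar}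
    (hf : f.IsHomogeneous 1) : aeval (0 : ι → Qbar) f = 0 := by
  have := aeval_smul_of_isHomogeneous hf (0 : Qbar) (0 : ι → Qbar)
  simpa using this

theorem isIntegral_of_le {R S : Type*} [CommRing R] [CommRing S] [Algebra R S]
    {A B : Subalgebra R S} (hAB : A ≤ B) {s : S} (h : IsIntegral A s) : IsIntegral B s := by
  obtain ⟨p, hp, h0⟩ := h
  refine ⟨p.map (Subalgebra.inclusion hAB).toRingHom, hp.map _, ?_⟩
  rw [Polynomial.eval₂_map]
  exact h0

variable {E : Type*} [Field E] [Algebra Qbar E] {Z : Set (Proj n)} {x : Fin (n + 1) → E}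
  {L : Fin (k + 1) → MvPolynomial (Fin (n + 1)) Qbar} {φ : Proj n → Proj k}

/-- By integrality every zero of the relations between the forms lifts to the cone, and the lift is
not the origin because the forms are linear. -/
theorem IsGenericPoint.image_eq (hx : IsGenericPoint Z x) (hZ : IsClosed Z)
    (hL : ∀ i, (L i).IsHomogeneous 1)
    (hint : ∀ j, IsIntegral (Algebra.adjoin Qbar (Set.range fun i => aeval x (L i))) (x j))
    (hφ : IsGivenOn L Z φ) :
    φ '' Z = projZeros (RingHom.ker (aeval (fun i => aeval x (L i)) :
      MvPolynomial (Fin (k + 1)) Qbar →ₐ[Qbar] E) : Set (MvPolynomial (Fin (k + 1)) Qbar)) := by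
  have hg := (hx.isConical.comp hL).isGradedIdeal_ker
  ext q
  constructor
  · rintro ⟨p, hp, rfl⟩
    induction p using Projectivization.ind with
    | h v hv =>
      obtain ⟨h1, h2⟩ := hφ v hv hp
      rw [h2, mk_mem_projZeros_iff hg]
      intro f hf
      rw [← aeval_eq_eval]
      exact ((hx.mk_mem_iff hZ v hv).1 hp).comp L f hf
  · intro hq
    induction q using Projectivization.ind with
    | h w hw =>
      rw [mk_mem_projZeros_iff hg] at hq
      obtain ⟨v, hv, hvw⟩ := exists_specializes_aeval_eq hint (w := w) (fun f hf => by
        rw [aeval_eq_eval]; exact hq f hf)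
      have hv0 : v ≠ 0 := by
        rintro rfl
        apply hw
        funext i
        rw [← hvw i, aeval_zero_of_isHomogeneous_one (hL i)]
        rfl
      have hvZ := (hx.mk_mem_iff hZ v hv0).2 hv
      obtain ⟨h1, h2⟩ := hφ v hv0 hvZ
      refine ⟨_, hvZ, h2.trans ?_⟩
      congr 1
      exact funext hvw

theorem IsGenericPoint.isClosed_image (hx : IsGenericPoint Z x) (hZ : IsClosed Z)
    (hL : ∀ i, (L i).IsHomogeneous 1)
    (hint : ∀ j, IsIntegral (Algebra.adjoin Qbar (Set.range fun i => aeval x (L i))) (x j))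
    (hφ : IsGivenOn L Z φ) : IsClosed (φ '' Z) := by
  rw [hx.image_eq hZ hL hint hφ]
  exact isClosed_projZeros (hx.isConical.comp hL).isGradedIdeal_ker

/-- The values of the linear forms at the generic point are a generic point of the image. -/
theorem IsGenericPoint.image (hx : IsGenericPoint Z x) (hZ : IsClosed Z)
    (hL : ∀ i, (L i).IsHomogeneous 1)
    (hint : ∀ j, IsIntegral (Algebra.adjoin Qbar (Set.range fun i => aeval x (L i))) (x j))
    (hgen : IntermediateField.adjoin Qbar (Set.range fun i => aeval x (L i)) = ⊤)
    (hφ : IsGivenOn L Z φ) : IsGenericPoint (φ '' Z) (fun i => aeval x (L i)) := by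
  refine ⟨fun f => ?_, hgen⟩
  have hg := (hx.isConical.comp hL).isGradedIdeal_ker
  obtain ⟨i, hi⟩ := exists_X_notMem_homIdeal (hx.isIrreducible.1.image φ)
  rw [hx.image_eq hZ hL hint hφ] at hi ⊢
  rw [homIdeal_projZeros hg (RingHom.ker_isPrime _), RingHom.mem_ker]
  refine ⟨i, fun h => hi (mem_homIdeal_iff.2 fun v hv hvZ => ?_)⟩
  exact (mk_mem_projZeros_iff hg v hv).1 hvZ _ h

/-- The homogeneous inverse G with denominator D is a regular inverse on the open sets where D does
not vanish. -/
theorem IsGenericPoint.projBirationalOntoImage (hx : IsGenericPoint Z x) (hZ : IsClosed Z)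
    (hL : ∀ i, (L i).IsHomogeneous 1)
    (hgen : IntermediateField.adjoin Qbar (Set.range fun i => aeval x (L i)) = ⊤)
    (hφ : IsGivenOn L Z φ) : ProjBirationalOntoImage Z φ := by
  classical
  obtain ⟨e, D, G, hD, hG, hDx, hDG⟩ := hx.isConical.exists_inverse hL hgen
  have hDL := isHomogeneous_bind₁ hL hD
  have hmemO : ∀ (v : Fin (n + 1) → Qbar) (hv : v ≠ 0),
      Projectivization.mk Qbar v hv ∈ (projZeros {bind₁ L D})ᶜ ↔
        aeval (fun i => aeval v (L i)) D ≠ 0 := by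
    intro v hv
    rw [Set.mem_compl_iff, mem_projZeros_iff (by rintro _ rfl; exact ⟨e, hDL⟩)]
    simp only [Set.mem_singleton_iff, forall_eq]
    rw [← aeval_eq_eval, aeval_bind₁_eq]
  have hmemP : ∀ (w : Fin (k + 1) → Qbar) (hw : w ≠ 0),
      Projectivization.mk Qbar w hw ∈ (projZeros {D})ᶜ ↔ aeval w D ≠ 0 := by
    intro v hv
    rw [Set.mem_compl_iff, mem_projZeros_iff (by rintro _ rfl; exact ⟨e, hD⟩)]
    simp only [Set.mem_singleton_iff, forall_eq]
    rw [← aeval_eq_eval]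
  have hinv : ∀ (v : Fin (n + 1) → Qbar) (hv : v ≠ 0), Projectivization.mk Qbar v hv ∈ Z →
      aeval (fun i => aeval v (L i)) D ≠ 0 → ∀ (w : Fin (k + 1) → Qbar) (hw : w ≠ 0),
      Projectivization.mk Qbar w hw = φ (Projectivization.mk Qbar v hv) →
      ∃ h : (fun j => eval w (G j)) ≠ 0,
        Projectivization.mk Qbar (fun j => eval w (G j)) h = Projectivization.mk Qbar v hv := by
    intro v hv hvZ hvD w hw hwv
    obtain ⟨h1, h2⟩ := hφ v hv hvZ
    rw [h2, Projectivization.mk_eq_mk_iff'] at hwv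
    obtain ⟨c, rfl⟩ := hwv
    have hc : c ≠ 0 := by
      rintro rfl
      exact hw (zero_smul _ _)
    have h3 : (fun j => eval (c • fun i => aeval v (L i)) (G j)) =
        (c ^ (e + 1) * aeval (fun i => aeval v (L i)) D) • v := by
      funext j
      rw [eval_smul_of_isHomogeneous (hG j), ← aeval_eq_eval, ← aeval_bind₁_eq,
        Pi.smul_apply, smul_eq_mul, mul_assoc]
      congr 1
      have h4 := (hx.mk_mem_iff hZ v hv).1 hvZ (bind₁ L D * X j - bind₁ L (G j)) (by
        rw [map_sub, hDG, sub_self])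
      rw [map_sub, sub_eq_zero, map_mul, aeval_X, aeval_bind₁_eq] at h4
      exact h4.symm
    have h5 : c ^ (e + 1) * aeval (fun i => aeval v (L i)) D ≠ 0 :=
      mul_ne_zero (pow_ne_zero _ hc) hvD
    simp only [h3]
    exact ⟨smul_ne_zero h5 hv, mk_smul_eq _ h5 v hv⟩
  obtain ⟨p₀, -⟩ := hx.isIrreducible.1
  -- The value p₀ is taken only where all G j vanish, hence never on the open part of the image
  -- where D is nonzero.
  let ψ : Proj k → Proj n := fun q =>
    if h : (fun j => eval q.rep (G j)) ≠ 0 then Projectivization.mk Qbar _ h else p₀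
  have hψ : ∀ (v : Fin (n + 1) → Qbar) (hv : v ≠ 0), Projectivization.mk Qbar v hv ∈ Z →
      aeval (fun i => aeval v (L i)) D ≠ 0 →
      ψ (φ (Projectivization.mk Qbar v hv)) = Projectivization.mk Qbar v hv := by
    intro v hv hvZ hvD
    obtain ⟨h1, h2⟩ := hinv v hv hvZ hvD _ (φ (Projectivization.mk Qbar v hv)).rep_nonzero
      (Projectivization.mk_rep _)
    simp only [ψ, dif_pos h1, h2]
  have himg : ∀ q ∈ φ '' Z ∩ (projZeros {D})ᶜ, ∃ (v : Fin (n + 1) → Qbar) (hv : v ≠ 0),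
      Projectivization.mk Qbar v hv ∈ Z ∧ aeval (fun i => aeval v (L i)) D ≠ 0 ∧
      q = φ (Projectivization.mk Qbar v hv) := by
    rintro _ ⟨⟨p, hp, rfl⟩, hP⟩
    induction p using Projectivization.ind with
    | h v hv =>
      obtain ⟨h1, h2⟩ := hφ v hv hp
      rw [h2, hmemP] at hP
      exact ⟨v, hv, hp, hP, rfl⟩
  refine ⟨(projZeros {bind₁ L D})ᶜ, (projZeros {D})ᶜ, ψ, ?_, ?_, ?_, ?_, ?_, ?_, ?_, ?_, ?_⟩
  · exact (isClosed_proj_iff.2 ⟨_, by rintro _ rfl; exact ⟨e, hDL⟩, rfl⟩).isOpen_compl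
  · exact (isClosed_proj_iff.2 ⟨_, by rintro _ rfl; exact ⟨e, hD⟩, rfl⟩).isOpen_compl
  · rw [Ne, hx.aeval_eq_zero_iff, mem_homIdeal_iff] at hDx
    push Not at hDx
    obtain ⟨v, hv, hvZ, hv0⟩ := hDx
    refine ⟨_, hvZ, (hmemO v hv).2 ?_⟩
    rwa [← aeval_bind₁_eq, aeval_eq_eval]
  · exact (hφ.mono Set.inter_subset_left).projRegularOn hL
  · intro q _
    refine ⟨Set.univ, isOpen_univ, trivial, e + 1, G, hG, fun w hw hwq => ?_⟩
    obtain ⟨v, hv, hvZ, hvD, h⟩ := himg _ hwq.1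
    obtain ⟨h1, h2⟩ := hinv v hv hvZ hvD w hw h
    exact ⟨h1, by rw [h2, h, hψ v hv hvZ hvD]⟩
  · rintro p ⟨hpZ, hpO⟩
    refine ⟨⟨p, hpZ, rfl⟩, ?_⟩
    induction p using Projectivization.ind with
    | h v hv =>
      obtain ⟨h1, h2⟩ := hφ v hv hpZ
      rw [h2, hmemP]
      exact (hmemO v hv).1 hpO
  · intro q hq
    obtain ⟨v, hv, hvZ, hvD, rfl⟩ := himg q hq
    rw [hψ v hv hvZ hvD]
    exact ⟨hvZ, (hmemO v hv).2 hvD⟩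
  · rintro p ⟨hpZ, hpO⟩
    induction p using Projectivization.ind with
    | h v hv => exact hψ v hv hpZ ((hmemO v hv).1 hpO)
  · intro q hq
    obtain ⟨v, hv, hvZ, hvD, rfl⟩ := himg q hq
    rw [hψ v hv hvZ hvD]

variable {r : ℕ} {σ : Fin (r + 1) → Fin (k + 1)}

theorem isIntegral_of_comp
    (hint : ∀ j, IsIntegral (Algebra.adjoin Qbar (Set.range fun i => aeval x (L (σ i)))) (x j))
    (j : Fin (n + 1)) :
    IsIntegral (Algebra.adjoin Qbar (Set.range fun i => aeval x (L i))) (x j) :=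
  isIntegral_of_le (Algebra.adjoin_mono (Set.range_comp_subset_range σ fun i => aeval x (L i)))
    (hint j)

theorem isIntegral_aeval {A : Subalgebra Qbar E} (hint : ∀ j, IsIntegral A (x j))
    (f : MvPolynomial (Fin (n + 1)) Qbar) : IsIntegral A (aeval x f) := by
  induction f using MvPolynomial.induction_on with
  | C c =>
    rw [aeval_C]
    exact isIntegral_algebraMap (x := (⟨algebraMap Qbar E c, A.algebraMap_mem c⟩ : A))
  | add p q hp hq => rw [map_add]; exact hp.add hq
  | mul_X p i hp => rw [map_mul, aeval_X]; exact hp.mul (hint i)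

/-- A projection of a variety that is birational onto its image preserves dimension and degree. -/
theorem IsGenericPoint.dim_degree_image (hx : IsGenericPoint Z x) (hZ : IsClosed Z)
    (hL : ∀ i, (L i).IsHomogeneous 1)
    (hy : AlgebraicIndependent Qbar fun i => aeval x (L (σ i)))
    (hint : ∀ j, IsIntegral (Algebra.adjoin Qbar (Set.range fun i => aeval x (L (σ i)))) (x j))
    (hgen : IntermediateField.adjoin Qbar (Set.range fun i => aeval x (L i)) = ⊤)
    (hφ : IsGivenOn L Z φ) :
    topologicalKrullDim (φ '' Z) = r ∧ HasDegree (φ '' Z) (Module.finrank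
      (IntermediateField.adjoin Qbar (Set.range fun i => aeval x (L (σ i)))) E) := by
  have hI := hx.image hZ hL (isIntegral_of_comp hint) hgen hφ
  have hcl := hx.isClosed_image hZ hL (isIntegral_of_comp hint) hφ
  -- On the image, the coordinates selected by σ form a normalizing system. Their values at its
  -- generic point are the same elements of the same field E, so dimension and degree agree with
  -- those of Z.
  have hX : (fun i => aeval (fun i => aeval x (L i)) (X (σ i) : MvPolynomial _ Qbar)) =
      fun i => aeval x (L (σ i)) := by
    funext i
    rw [aeval_X]
  have hXh : ∀ i, (X (σ i) : MvPolynomial (Fin (k + 1)) Qbar).IsHomogeneous 1 :=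
    fun i => isHomogeneous_X _ _
  have h1 : ∀ j, IsIntegral (Algebra.adjoin Qbar (Set.range fun i =>
      aeval (fun i => aeval x (L i)) (X (σ i) : MvPolynomial _ Qbar))) (aeval x (L j)) := by
    rw [hX]
    exact fun j => isIntegral_aeval hint (L j)
  refine ⟨hI.topologicalKrullDim_eq hcl hXh (by rw [hX]; exact hy) h1, ?_⟩
  have h2 := hI.hasDegree hcl hXh (by rw [hX]; exact hy) h1
  rwa [hX] at h2

end LinearProjection

/-! ### The components at infinity -/

section Infinity

variable {n m : ℕ} {Z W S : Set (Proj n)}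

theorem exists_mem_components {p : Proj n} (hp : p ∈ S) : ∃ W ∈ components S, p ∈ W := by
  refine ⟨(↑) '' irreducibleComponent (⟨p, hp⟩ : S), ⟨⟨?_, ?_⟩, ?_⟩, ?_⟩
  · exact isIrreducible_irreducibleComponent.image _ continuous_subtype_val.continuousOn
  · rintro _ ⟨q, -, rfl⟩
    exact q.2
  · rintro V ⟨hV, hVS⟩ hle q hq
    have h1 : irreducibleComponent (⟨p, hp⟩ : S) ⊆ (↑) ⁻¹' V := Set.image_subset_iff.1 hle
    have h2 := eq_irreducibleComponent (isIrreducible_preimage_val hV hVS).2 h1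
    refine ⟨⟨q, hVS hq⟩, ?_, rfl⟩
    rw [← h2]
    exact hq
  · exact ⟨_, mem_irreducibleComponent, rfl⟩

theorem iUnion_components (S : Set (Proj n)) : ⋃ W ∈ components S, W = S := by
  ext p
  simp only [Set.mem_iUnion, exists_prop]
  exact ⟨fun ⟨W, hW, hp⟩ => hW.1.2 hp, fun hp => exists_mem_components hp⟩

theorem isClosed_of_mem_components (hS : IsClosed S) (hW : W ∈ components S) : IsClosed W := by
  have h := hW.2 (y := closure W) ⟨hW.1.1.closure, closure_minimal hW.1.2 hS⟩ subset_closure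
  rw [← subset_antisymm h subset_closure]
  exact isClosed_closure

/-- A prime between the two ideals may be replaced by its homogeneous core, which still contains the
homogeneous generators. Its zero set is irreducible, lies in the section at infinity and contains W,
so it equals W by maximality. -/
theorem homIdeal_mem_minimalPrimes (hZ : IsClosed Z) (hW : W ∈ components (Z ∩ H₀ n)) :
    homIdeal W ∈ (homIdeal Z ⊔ Ideal.span {X 0}).minimalPrimes := by
  have hX0 : X 0 ∈ homIdeal W := by
    rw [mem_homIdeal_iff]
    intro v hv hvW
    rw [eval_X]
    exact (mk_mem_H₀ v hv).1 (hW.1.2 hvW).2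
  refine ⟨⟨isPrime_homIdeal hW.1.1, sup_le
    (homIdeal_anti (hW.1.2.trans Set.inter_subset_left)) ?_⟩, ?_⟩
  · rw [Ideal.span_singleton_le_iff_mem]
    exact hX0
  rintro Q ⟨hQ, hIQ⟩ hQW
  obtain ⟨Q', hQ'Q, hQ', hQ'g, hQ'h⟩ := exists_isGradedIdeal_le Q hQ
  obtain ⟨i, hi⟩ := exists_X_notMem_homIdeal hW.1.1.1
  have h1 : homIdeal (projZeros (Q' : Set (MvPolynomial (Fin (n + 1)) Qbar))) = Q' :=
    homIdeal_projZeros hQ'g hQ' ⟨i, fun h => hi (hQW (hQ'Q h))⟩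
  refine le_trans ?_ hQ'Q
  rw [← h1]
  refine homIdeal_anti (hW.2 ⟨isIrreducible_of_isPrime_homIdeal (by rwa [h1]), ?_⟩ ?_)
  · refine Set.subset_inter (subset_of_homIdeal_le hZ ?_) fun p hp => ?_
    · rw [h1]
      exact (isGradedIdeal_homIdeal Z).le_of_forall fun p t hp hpZ =>
        hQ'h p t hp (hIQ (Ideal.mem_sup_left hpZ))
    · induction p using Projectivization.ind with
      | h v hv =>
        rw [mk_mem_H₀]
        have := (mk_mem_projZeros_iff hQ'g v hv).1 hp (X 0) (hQ'h _ 1 (isHomogeneous_X _ _)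
          (hIQ (Ideal.mem_sup_right (Ideal.mem_span_singleton_self _))))
        rwa [eval_X] at this
  · refine subset_of_homIdeal_le (isClosed_projZeros hQ'g) ?_
    rw [h1]
    exact hQ'Q.trans hQW

variable {E : Type*} [Field E] [Algebra Qbar E] {x : Fin (n + 1) → E}
  {E' : Type*} [Field E'] [Algebra Qbar E'] {w : Fin (n + 1) → E'}

theorem IsGenericPoint.specializes (hx : IsGenericPoint Z x) (hw : IsGenericPoint W w)
    (hWZ : W ⊆ Z) : Specializes Qbar x w := by
  intro f hf
  rw [hx.aeval_eq_zero_iff] at hf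
  rw [hw.aeval_eq_zero_iff]
  exact homIdeal_anti hWZ hf

theorem IsGenericPoint.apply_zero_eq_zero (hw : IsGenericPoint W w) (hW : W ⊆ H₀ n) : w 0 = 0 := by
  have h : aeval w (X 0 : MvPolynomial (Fin (n + 1)) Qbar) = 0 := by
    rw [hw.aeval_eq_zero_iff, mem_homIdeal_iff]
    intro v hv hvW
    rw [eval_X]
    exact (mk_mem_H₀ v hv).1 (hW hvW)
  rwa [aeval_X] at h

theorem IsGenericPoint.ne_zero (hw : IsGenericPoint W w) : w ≠ 0 := by
  rintro rfl
  obtain ⟨i, hi⟩ := exists_X_notMem_homIdeal hw.isIrreducible.1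
  refine hi ((hw.aeval_eq_zero_iff _).1 ?_)
  rw [aeval_X]
  rfl

variable {a : Fin m → Fin n → Qbar}

/-- Since x₀ vanishes on W, the remaining forms alone have no common zero on the cone over W. -/
theorem IsGenericPoint.isIntegral_infinity (hx : IsGenericPoint Z x)
    (hint : ∀ j, IsIntegral
      (Algebra.adjoin Qbar (Set.range fun i => aeval x (formSystem a i))) (x j))
    (hw : IsGenericPoint W w) (hWZ : W ⊆ Z ∩ H₀ n) (j : Fin (n + 1)) :
    IsIntegral (Algebra.adjoin Qbar (Set.range fun i => aeval w (form (a i)))) (w j) := by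
  refine hw.isConical.isIntegral_of_forall_eq_zero (fun i => isHomogeneous_form (a i)) ?_ j
  intro v hv hv0
  refine hx.isConical.eq_zero_of_isIntegral (isHomogeneous_formSystem a) hint
    ((hx.specializes hw (hWZ.trans Set.inter_subset_left)).trans hv) (fun i => ?_)
  refine Fin.cases ?_ (fun i => hv0 i) i
  refine hv _ ?_
  rw [formSystem_zero, aeval_X]
  exact hw.apply_zero_eq_zero (hWZ.trans Set.inter_subset_right)

/-- The ideal of W contracts to that of X 0, so a relation between the remaining forms is a multiple
of X 0; setting X 0 to 0 shows that it is zero. -/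
theorem IsGenericPoint.algebraicIndependent_infinity (hx : IsGenericPoint Z x) (hZ : IsClosed Z)
    (hy : AlgebraicIndependent Qbar fun i => aeval x (formSystem a i))
    (hint : ∀ j, IsIntegral
      (Algebra.adjoin Qbar (Set.range fun i => aeval x (formSystem a i))) (x j))
    (hw : IsGenericPoint W w) (hW : W ∈ components (Z ∩ H₀ n)) :
    AlgebraicIndependent Qbar fun i => aeval w (form (a i)) := by
  have hP := homIdeal_mem_minimalPrimes hZ hW
  rw [← hx.ker_eq] at hP
  have hcomap := comap_bind₁_eq_span_of_mem_minimalPrimes hy hint 0 hP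
  rw [algebraicIndependent_iff]
  intro f hf
  have h1 : rename Fin.succ f ∈ (homIdeal W).comap (bind₁ (formSystem a)) := by
    rw [Ideal.mem_comap, ← hw.aeval_eq_zero_iff, aeval_bind₁_eq, aeval_rename]
    exact hf
  rw [hcomap, Ideal.mem_span_singleton] at h1
  obtain ⟨g, hg⟩ := h1
  have h2 := congrArg (aeval (Fin.cons 0 X : Fin (m + 1) → MvPolynomial (Fin m) Qbar)) hg
  rw [map_mul, aeval_X, Fin.cons_zero, zero_mul, aeval_rename] at h2
  have h3 : (Fin.cons 0 X : Fin (m + 1) → MvPolynomial (Fin m) Qbar) ∘ Fin.succ = X := by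
    funext j
    simp
  rwa [h3, aeval_X_left_apply] at h2

/-- The restriction of a general projection to the components at infinity. -/
theorem IsGenericPoint.projection_component {Ω : Type*} [Field Ω] [Algebra Qbar Ω] [IsAlgClosed Ω]
    (hx : IsGenericPoint Z x) (hZ : IsClosed Z) {A : Fin (m + 1) → Fin n → Qbar}
    (hy : AlgebraicIndependent Qbar
      fun i => aeval x (formSystem (fun i : Fin m => A i.castSucc) i))
    (hint : ∀ j, IsIntegral (Algebra.adjoin Qbar
      (Set.range fun i => aeval x (formSystem (fun i : Fin m => A i.castSucc) i))) (x j))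
    {η : Fin m → Ω} (hη : AlgebraicIndependent Qbar η)
    (hinj : Set.InjOn (fun v : Fin (n + 1) → Ω => aeval v (form (A (Fin.last m))))
      {v | Specializes Qbar x v ∧ ∀ i, aeval v (formSystem (fun i : Fin m => A i.castSucc) i) =
        (Fin.cons 0 η : Fin (m + 1) → Ω) i})
    {φ : Proj n → Proj (m + 1)} (hφ : IsGivenOn (formSystem A) Z φ)
    (hW : W ∈ components (Z ∩ H₀ n)) :
    ProjBirationalOntoImage W φ ∧ IsClosed (φ '' W) ∧ IsIrreducible (φ '' W) ∧
      topologicalKrullDim (φ '' W) + 1 = m ∧ ∃ e : ℕ, HasDegree W e ∧ HasDegree (φ '' W) e := by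
  obtain ⟨E', _, _, w, hw⟩ := exists_isGenericPoint hW.1.1
  have hWcl := isClosed_of_mem_components (hZ.inter isClosed_H₀) hW
  have hWZ : W ⊆ Z := hW.1.2.trans Set.inter_subset_left
  have hφW := hφ.mono hWZ
  have hintw := hx.isIntegral_infinity hint hw hW.1.2
  have hyw := hx.algebraicIndependent_infinity hZ hy hint hw hW
  have hw0 := hw.apply_zero_eq_zero (hW.1.2.trans Set.inter_subset_right)
  have hxw := hx.specializes hw hWZ
  -- The generic fibre of the component is part of the fibre of the whole cone over (0, η), whose
  -- points the last form separates.
  have hsub : {v : Fin (n + 1) → Ω | Specializes Qbar w v ∧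
      ∀ i : Fin m, aeval v (form (A i.castSucc)) = η i} ⊆
      {v | Specializes Qbar x v ∧ ∀ i, aeval v (formSystem (fun i : Fin m => A i.castSucc) i) =
        (Fin.cons 0 η : Fin (m + 1) → Ω) i} := by
    intro v hv
    refine ⟨hxw.trans hv.1, fun i => ?_⟩
    refine Fin.cases ?_ (fun i => hv.2 i) i
    refine hv.1 _ ?_
    rw [formSystem_zero, aeval_X]
    exact hw0
  have hprim := adjoin_singleton_eq_top_of_injOn hw.adjoin_eq_top hyw hintw hη
    (form (A (Fin.last m))) (hinj.mono hsub)
  have hgen : IntermediateField.adjoin Qbar (Set.range fun i => aeval w (formSystem A i)) = ⊤ :=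
    adjoin_range_eq_top_of_adjoin_singleton hprim (fun i => ⟨i.castSucc.succ, rfl⟩)
      ⟨(Fin.last m).succ, rfl⟩
  -- For m = 0 there is no component: w would be a zero of the only form x₀, hence the origin.
  obtain _ | r := m
  · refine absurd ?_ hw.ne_zero
    refine hx.isConical.eq_zero_of_isIntegral (isHomogeneous_formSystem _) hint hxw fun i => ?_
    refine Fin.cases ?_ (fun i => i.elim0) i
    rw [formSystem_zero, aeval_X]
    exact hw0
  · have hd := hw.hasDegree hWcl (fun i : Fin (r + 1) => isHomogeneous_form (A i.castSucc)) hyw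
      hintw
    have hdim := hw.dim_degree_image (σ := fun i : Fin (r + 1) => i.castSucc.succ) hWcl
      (isHomogeneous_formSystem A) hyw hintw hgen hφW
    have hint' := isIntegral_of_comp (L := formSystem A)
      (σ := fun i : Fin (r + 1) => i.castSucc.succ) hintw
    refine ⟨hw.projBirationalOntoImage hWcl (isHomogeneous_formSystem A) hgen hφW,
      hw.isClosed_image hWcl (isHomogeneous_formSystem A) hint' hφW,
      (hw.image hWcl (isHomogeneous_formSystem A) hint' hgen hφW).isIrreducible, ?_, _, hd, hdim.2⟩
    rw [hdim.1]
    push_cast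
    rfl

end Infinity

/-! ### The affine part of the projection -/

section AffineProjection

variable {n k : ℕ}

/-- The coefficients of an integral matrix, in `Qbar`. -/
noncomputable def castRows (A : Matrix (Fin k) (Fin n) ℤ) : Fin k → Fin n → Qbar :=
  fun i j => (A i j : Qbar)

theorem homMap_zero_eq (A : Matrix (Fin k) (Fin n) ℤ) (v : Fin (n + 1) → Qbar) :
    homMap A 0 v = fun i => aeval v (formSystem (castRows A) i) := by
  funext i
  refine Fin.cases ?_ (fun i => ?_) i
  · rw [formSystem_zero, aeval_X]
    rfl
  · rw [formSystem_succ, aeval_form]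
    simp [homMap, castRows]

theorem homMap_cons_one (A : Matrix (Fin k) (Fin n) ℤ) (v : Fin n → Qbar) :
    homMap A 0 (Fin.cons 1 v) = (Fin.cons 1 (affMap A 0 v) : Fin (k + 1) → Qbar) := by
  funext i
  refine Fin.cases rfl (fun i => ?_) i
  simp only [homMap, Fin.cons_succ, Fin.cons_zero, mul_one]
  rfl

theorem eval_dehomogenize_form (A : Matrix (Fin k) (Fin n) ℤ) (v : Fin n → Qbar) (i : Fin k) :
    eval v (dehomogenize n (form (castRows A i))) = affMap A 0 v i := by
  rw [eval_dehomogenize, ← aeval_eq_eval]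
  exact congrFun ((homMap_zero_eq A _).symm.trans (homMap_cons_one A v)) i.succ

theorem aeval_cons_one_formSystem (A : Matrix (Fin k) (Fin n) ℤ) (v : Fin n → Qbar) :
    (fun i => aeval (Fin.cons 1 v : Fin (n + 1) → Qbar) (formSystem (castRows A) i)) =
      (Fin.cons 1 (affMap A 0 v) : Fin (k + 1) → Qbar) :=
  (homMap_zero_eq A _).symm.trans (homMap_cons_one A v)

theorem totalDegree_dehomogenize_le (f : MvPolynomial (Fin (n + 1)) Qbar) :
    (dehomogenize n f).totalDegree ≤ f.totalDegree := by
  rw [dehomogenize, aeval_def, eval₂_eq']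
  refine totalDegree_finsetSum_le fun s hs => ?_
  refine (totalDegree_mul _ _).trans ?_
  rw [algebraMap_eq, totalDegree_C, zero_add]
  refine (totalDegree_finsetProd _ _).trans (le_trans ?_ (le_totalDegree hs))
  rw [Finsupp.sum_fintype _ _ (fun _ => rfl)]
  refine Finset.sum_le_sum fun i _ => ?_
  refine (totalDegree_pow _ _).trans (mul_le_of_le_one_right (Nat.zero_le _) ?_)
  refine Fin.cases ?_ (fun i => ?_) i
  · rw [Fin.cons_zero, totalDegree_one]
    exact zero_le_one
  · rw [Fin.cons_succ, totalDegree_X]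

variable {X : Set (Aff n)} {A : Matrix (Fin k) (Fin n) ℤ} {φ : Proj n → Proj k}

theorem IsGivenOn.affToProj_eq (hφ : IsGivenOn (formSystem (castRows A)) (projClosure X) φ)
    {p : Aff n} (hp : p ∈ X) : φ (affToProj p) = affToProj (affMap A 0 p) := by
  obtain ⟨h1, h2⟩ := hφ _ (cons_one_ne_zero p) (subset_closure ⟨p, hp, rfl⟩)
  refine h2.trans ?_
  simp only [aeval_cons_one_formSystem A p]
  rfl

theorem IsGivenOn.mem_H₀_iff {Z : Set (Proj n)} {a : Fin k → Fin n → Qbar}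
    (hφ : IsGivenOn (formSystem a) Z φ) {p : Proj n} (hp : p ∈ Z) : φ p ∈ H₀ k ↔ p ∈ H₀ n := by
  induction p using Projectivization.ind with
  | h v hv =>
    obtain ⟨h1, h2⟩ := hφ v hv hp
    rw [h2, mk_mem_H₀, mk_mem_H₀, formSystem_zero, aeval_X]

/-- The projection keeps x₀, so exactly the points at infinity go to infinity, and the affine part
of the image is the image of the affine part. -/
theorem IsGivenOn.image_affMap (hφ : IsGivenOn (formSystem (castRows A)) (projClosure X) φ)
    (hX : IsClosed X) : affMap A 0 '' X = affToProj ⁻¹' (φ '' projClosure X) := by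
  ext y
  constructor
  · rintro ⟨p, hp, rfl⟩
    exact ⟨_, subset_closure ⟨p, hp, rfl⟩, hφ.affToProj_eq hp⟩
  · rintro ⟨q, hq, hqy⟩
    have h1 : φ q ∉ H₀ k := by
      rw [hqy, ← Set.mem_compl_iff, ← range_affToProj]
      exact ⟨y, rfl⟩
    rw [hφ.mem_H₀_iff hq, ← Set.mem_compl_iff, ← range_affToProj] at h1
    obtain ⟨p, rfl⟩ := h1
    rw [affToProj_mem_projClosure hX] at hq
    rw [hφ.affToProj_eq hq] at hqy
    exact ⟨p, hq, affToProj_injective hqy⟩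

theorem IsGivenOn.projClosure_image (hφ : IsGivenOn (formSystem (castRows A)) (projClosure X) φ)
    (hX : IsClosed X) (hne : X.Nonempty) (hcl : IsClosed (φ '' projClosure X))
    (hirr : IsIrreducible (φ '' projClosure X)) :
    projClosure (affMap A 0 '' X) = φ '' projClosure X := by
  apply subset_antisymm
  · refine closure_minimal ?_ hcl
    rw [hφ.image_affMap hX]
    exact Set.image_preimage_subset _ _
  · obtain ⟨p, hp⟩ := hne
    refine (subset_closure_inter_of_isPreirreducible_of_isOpen hirr.2
      isOpenEmbedding_affToProj.isOpen_range ⟨φ (affToProj p),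
        ⟨_, subset_closure ⟨p, hp, rfl⟩, rfl⟩, ?_⟩).trans ?_
    · rw [hφ.affToProj_eq hp]
      exact ⟨_, rfl⟩
    · refine closure_mono ?_
      rw [hφ.image_affMap hX, Set.image_preimage_eq_inter_range]

variable {E : Type*} [Field E] [Algebra Qbar E] {x : Fin (n + 1) → E}

theorem IsGenericPoint.specializes_cons_one (hx : IsGenericPoint (projClosure X) x) {p : Aff n}
    (hp : p ∈ X) : Specializes Qbar x (Fin.cons 1 p : Fin (n + 1) → Qbar) :=
  (hx.mk_mem_iff (isClosed_projClosure X) _ (cons_one_ne_zero p)).1 (subset_closure ⟨p, hp, rfl⟩)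

theorem Specializes.eval_dehomogenize_mul {v : Fin n → Qbar}
    (h : Specializes Qbar x (Fin.cons 1 v : Fin (n + 1) → Qbar))
    {f g : MvPolynomial (Fin (n + 1)) Qbar} (j : Fin n)
    (hfg : aeval x (f * MvPolynomial.X j.succ) = aeval x g) :
    eval v (dehomogenize n f) * v j = eval v (dehomogenize n g) := by
  have h1 := h (f * MvPolynomial.X j.succ - g) (by rw [map_sub, hfg, sub_self])
  rwa [map_sub, sub_eq_zero, map_mul, aeval_X, Fin.cons_succ, aeval_eq_eval,
    ← eval_dehomogenize, ← eval_dehomogenize] at h1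

/-- Dehomogenizing the homogeneous inverse of the cone gives the inverse as quotients with the
single denominator D. -/
theorem IsGenericPoint.affBirationalOntoImage (hx : IsGenericPoint (projClosure X) x)
    (hgen : IntermediateField.adjoin Qbar
      (Set.range fun i => aeval x (formSystem (castRows A) i)) = ⊤) :
    AffBirationalOntoImage X (affMap A 0) := by
  have hL := isHomogeneous_formSystem (castRows A)
  obtain ⟨e, D, G, hD, hG, hDx, hDG⟩ := hx.isConical.exists_inverse hL hgen
  have hev : ∀ (p : Fin n → Qbar) (f : MvPolynomial (Fin (k + 1)) Qbar),
      eval p (dehomogenize n (bind₁ (formSystem (castRows A)) f)) =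
        eval (affMap A 0 p : Fin k → Qbar) (dehomogenize k f) := by
    intro p f
    rw [eval_dehomogenize, ← aeval_eq_eval, aeval_bind₁_eq, aeval_cons_one_formSystem,
      aeval_eq_eval]
    exact (eval_dehomogenize _ f).symm
  have hinv : ∀ p ∈ X, eval (affMap A 0 p : Fin k → Qbar) (dehomogenize k D) ≠ 0 → ∀ j : Fin n,
      eval (affMap A 0 p : Fin k → Qbar) (dehomogenize k (G j.succ)) /
        eval (affMap A 0 p : Fin k → Qbar) (dehomogenize k D) = p j := by
    intro p hp hp0 j
    have h1 := (hx.specializes_cons_one hp).eval_dehomogenize_mul j (hDG j.succ)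
    rw [hev p D, hev p (G j.succ)] at h1
    rw [← h1, mul_div_cancel_left₀ _ hp0]
  let ψ : Aff k → Aff n := fun y j =>
    eval (y : Fin k → Qbar) (dehomogenize k (G j.succ)) /
      eval (y : Fin k → Qbar) (dehomogenize k D)
  have hψ : ∀ p ∈ X, eval (affMap A 0 p : Fin k → Qbar) (dehomogenize k D) ≠ 0 →
      ψ (affMap A 0 p) = p := fun p hp hp0 => funext (hinv p hp hp0)
  have hO : ∀ p : Aff n, p ∈ (affZeros {dehomogenize n (bind₁ (formSystem (castRows A)) D)})ᶜ ↔
      eval (affMap A 0 p : Fin k → Qbar) (dehomogenize k D) ≠ 0 := by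
    intro p
    rw [← hev p D]
    simp [affZeros]
  have hP : ∀ y : Aff k, y ∈ (affZeros {dehomogenize k D})ᶜ ↔
      eval (y : Fin k → Qbar) (dehomogenize k D) ≠ 0 := by
    intro p
    simp [affZeros]
  refine ⟨(affZeros {dehomogenize n (bind₁ (formSystem (castRows A)) D)})ᶜ,
    (affZeros {dehomogenize k D})ᶜ, ψ, ?_, ?_, ?_, ?_, ?_, ?_, ?_, ?_, ?_⟩
  · exact (isClosed_aff_iff.2 ⟨_, rfl⟩).isOpen_compl
  · exact (isClosed_aff_iff.2 ⟨_, rfl⟩).isOpen_compl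
  · rw [Ne, hx.aeval_eq_zero_iff, mem_homIdeal_projClosure (isHomogeneous_bind₁ hL hD)] at hDx
    push Not at hDx
    obtain ⟨p, hp, hp0⟩ := hDx
    refine ⟨p, hp, (hO p).2 ?_⟩
    rwa [← hev p D]
  · intro p _
    refine ⟨Set.univ, isOpen_univ, trivial, 1, fun i => dehomogenize n (form (castRows A i)),
      fun q _ => ⟨by simp, fun i => ?_⟩⟩
    rw [map_one, div_one]
    exact (eval_dehomogenize_form A q i).symm
  · intro y _
    refine ⟨Set.univ, isOpen_univ, trivial, dehomogenize k D, fun j => dehomogenize k (G j.succ),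
      fun q hq => ⟨(hP q).1 hq.1.2, fun i => rfl⟩⟩
  · rintro p ⟨hpX, hpO⟩
    exact ⟨⟨p, hpX, rfl⟩, (hP _).2 ((hO p).1 hpO)⟩
  · rintro _ ⟨⟨p, hpX, rfl⟩, hpP⟩
    rw [hψ p hpX ((hP _).1 hpP)]
    exact ⟨hpX, (hO p).2 ((hP _).1 hpP)⟩
  · rintro p ⟨hpX, hpO⟩
    exact hψ p hpX ((hO p).1 hpO)
  · rintro _ ⟨⟨p, hpX, rfl⟩, hpP⟩
    rw [hψ p hpX ((hP _).1 hpP)]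

end AffineProjection

/-! ### Fibres and equation of the affine image -/

section Hypersurface

variable {n m : ℕ}

theorem formSystem_castSucc {k : Type*} [Field k] (a : Fin (m + 1) → Fin n → k) (i : Fin (m + 1)) :
    formSystem (fun i : Fin m => a i.castSucc) i = formSystem a i.castSucc := by
  refine Fin.cases rfl (fun i => ?_) i
  rw [formSystem_succ, Fin.castSucc_succ, formSystem_succ]

variable {X : Set (Aff n)} {A : Matrix (Fin (m + 1)) (Fin n) ℤ} {φ : Proj n → Proj (m + 1)}
  {E : Type*} [Field E] [Algebra Qbar E] {x : Fin (n + 1) → E}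

/-- With x₀ = 1, the fibre is contained in a fibre of the finite map given by all forms but the
last. -/
theorem IsGenericPoint.encard_fibre_le (hx : IsGenericPoint (projClosure X) x)
    (hy : AlgebraicIndependent Qbar fun i : Fin (m + 1) =>
      aeval x (formSystem (castRows A) i.castSucc))
    (hint : ∀ j, IsIntegral (Algebra.adjoin Qbar (Set.range fun i : Fin (m + 1) =>
      aeval x (formSystem (castRows A) i.castSucc))) (x j)) (y : Aff (m + 1)) :
    {p ∈ X | affMap A 0 p = y}.encard ≤ (Module.finrank (IntermediateField.adjoin Qbar
      (Set.range fun i : Fin (m + 1) => aeval x (formSystem (castRows A) i.castSucc))) E : ℕ) := by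
  obtain ⟨T, hT, hTmem⟩ := finite_specializes (Ω := Qbar) hy hint hx.adjoin_eq_top
    (fun i => (Fin.cons 1 y : Fin (m + 2) → Qbar) i.castSucc)
  have hinj : Function.Injective (fun p : Aff n => (Fin.cons 1 p : Fin (n + 1) → Qbar)) :=
    fun p q h => Fin.cons_right_injective (α := fun _ => Qbar) 1 h
  rw [← hinj.encard_image]
  refine (Set.encard_le_encard (t := (T : Set (Fin (n + 1) → Qbar))) ?_).trans ?_
  · rintro _ ⟨p, ⟨hp, hpy⟩, rfl⟩
    rw [Finset.mem_coe, hTmem]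
    refine ⟨hx.specializes_cons_one hp, fun i => ?_⟩
    rw [← hpy]
    exact congrFun (aeval_cons_one_formSystem A p) i.castSucc
  · rw [Set.encard_coe_eq_coe_finsetCard]
    exact_mod_cast hT

/-- The homogeneous generator F of the relations between the projected coordinates dehomogenizes to
a polynomial f that divides every polynomial vanishing on the affine image. -/
theorem IsGenericPoint.isIntegralHypersurface_image (hx : IsGenericPoint (projClosure X) x)
    (hy : AlgebraicIndependent Qbar fun i : Fin (m + 1) =>
      aeval x (formSystem (castRows A) i.castSucc))
    (hint : ∀ j, IsIntegral (Algebra.adjoin Qbar (Set.range fun i : Fin (m + 1) =>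
      aeval x (formSystem (castRows A) i.castSucc))) (x j))
    (hprim : IntermediateField.adjoin (IntermediateField.adjoin Qbar
      (Set.range fun i : Fin (m + 1) => aeval x (formSystem (castRows A) i.castSucc)))
      {aeval x (formSystem (castRows A) (Fin.last (m + 1)))} = ⊤)
    (hcl : IsClosed (affMap A 0 '' X)) (hirr : IsIrreducible (affMap A 0 '' X))
    (himg : IsGenericPoint (projClosure (affMap A 0 '' X))
      fun i => aeval x (formSystem (castRows A) i)) :
    IsIntegralHypersurface (affMap A 0 '' X) (Module.finrank (IntermediateField.adjoin Qbar
      (Set.range fun i : Fin (m + 1) => aeval x (formSystem (castRows A) i.castSucc))) E) := by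
  set z : Fin (m + 2) → E := fun i => aeval x (formSystem (castRows A) i) with hz
  let σ : Fin (m + 2) ≃ Option (Fin (m + 1)) := finSuccEquivLast
  have hσ : (fun o : Option (Fin (m + 1)) => o.elim (z (Fin.last (m + 1))) fun i => z i.castSucc) =
      z ∘ σ.symm := by
    funext o
    cases o <;> simp [σ]
  have hzcon : IsConical Qbar z := hx.isConical.comp (isHomogeneous_formSystem _)
  have hcon : IsConical Qbar (z ∘ σ.symm) := by
    have := hzcon.comp (ℓ := fun o => MvPolynomial.X (σ.symm o)) (fun o => isHomogeneous_X _ _)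
    simp only [aeval_X] at this
    exact this
  obtain ⟨F, hF, hF0, hFdvd, hFdeg⟩ := exists_generator_ker_aeval hx.adjoin_eq_top hy hint
    (isIntegral_aeval hint _) hprim (by rw [hσ]; exact hcon)
  rw [hσ] at hF0 hFdvd
  have hfin : FiniteDimensional (IntermediateField.adjoin Qbar (Set.range fun i : Fin (m + 1) =>
      aeval x (formSystem (castRows A) i.castSucc))) E :=
    finiteDimensional_of_isIntegral hx.adjoin_eq_top hint
  set d := Module.finrank (IntermediateField.adjoin Qbar
      (Set.range fun i : Fin (m + 1) => aeval x (formSystem (castRows A) i.castSucc))) E with hd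
  have hdpos : 0 < d := Module.finrank_pos
  set F' : MvPolynomial (Fin (m + 2)) Qbar := rename σ.symm F with hF'
  have hF'h : F'.IsHomogeneous d := hF.rename_isHomogeneous
  have hF'0 : aeval z F' = 0 := by rw [hF', aeval_rename, hF0]
  have hF'dvd : ∀ G : MvPolynomial (Fin (m + 2)) Qbar, aeval z G = 0 → F' ∣ G := by
    intro G hG
    have h1 : F ∣ rename σ G := by
      apply hFdvd
      rw [aeval_rename, Function.comp_assoc, Equiv.symm_comp_self, Function.comp_id, hG]
    have h2 := map_dvd (rename σ.symm : _ →ₐ[Qbar] MvPolynomial (Fin (m + 2)) Qbar) h1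
    rwa [rename_rename, Equiv.symm_comp_self, rename_id_apply] at h2
  set f := dehomogenize (m + 1) F' with hf
  have hfvan : ∀ y ∈ affMap A 0 '' X, eval y f = 0 :=
    (mem_homIdeal_projClosure hF'h).1 ((himg.aeval_eq_zero_iff _).1 hF'0)
  have hfdvd : ∀ g : MvPolynomial (Fin (m + 1)) Qbar,
      (∀ y ∈ affMap A 0 '' X, eval y g = 0) → f ∣ g := by
    intro g hg
    obtain ⟨G, hG, rfl⟩ := exists_dehomogenize_eq g
    exact map_dvd (dehomogenize (m + 1)) (hF'dvd G ((himg.aeval_eq_zero_iff _).2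
      ((mem_homIdeal_projClosure hG).2 hg)))
  -- F is monic of degree d in the last variable, so no degree is lost: putting 0 for the other
  -- affine variables leaves a polynomial of degree d in one variable.
  have hfdeg : d ≤ f.totalDegree := by
    let u : Fin (m + 1) → Polynomial Qbar := Fin.snoc (fun _ : Fin m => 0) Polynomial.X
    let c : Fin (m + 1) → Qbar := Fin.cons 1 0
    have hu : (Fin.cons 1 u : Fin (m + 2) → Polynomial Qbar) ∘ σ.symm =
        fun o : Option (Fin (m + 1)) => o.elim Polynomial.X fun i => Polynomial.C (c i) := by
      funext o
      rcases o with _ | i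
      · simp [σ, u, ← Fin.succ_last]
      · refine Fin.cases ?_ (fun i => ?_) i
        · simp [σ, c]
        · simp [σ, c, u, Fin.castSucc_succ]
    have h1 : aeval u f = aeval (fun o : Option (Fin (m + 1)) =>
        o.elim Polynomial.X fun i => Polynomial.C (c i)) F := by
      rw [← hu, ← aeval_rename, ← hF', hf, dehomogenize, ← AlgHom.comp_apply]
      congr 1
      apply MvPolynomial.algHom_ext
      intro i
      refine Fin.cases ?_ (fun i => ?_) i <;> simp
    have h2 := aeval_natDegree_le f le_rfl u (n := 1) fun i => by
      refine Fin.lastCases ?_ (fun i => ?_) i <;> simp [u]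
    rw [h1, hFdeg c, mul_one] at h2
    exact h2
  have hf0 : f ≠ 0 := by
    intro h
    rw [h, totalDegree_zero] at hfdeg
    omega
  -- If f divides a product, one factor vanishes on the irreducible image and is therefore a
  -- multiple of f.
  have hprime : Prime f := by
    refine ⟨hf0, fun hu => ?_, fun a b hab => ?_⟩
    · obtain ⟨y, hy⟩ := hirr.1
      exact (hu.map (eval y)).ne_zero (hfvan y hy)
    · refine (IsIrreducible.eval_eq_zero_or hirr fun y hy => ?_).imp (hfdvd a) (hfdvd b)
      obtain ⟨c, hc⟩ := hab
      rw [hc, map_mul]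
      exact mul_eq_zero_of_left (hfvan y hy) _
  refine ⟨f, hprime.irreducible, le_antisymm ?_ hfdeg, subset_antisymm ?_ ?_⟩
  · exact (totalDegree_dehomogenize_le F').trans hF'h.totalDegree_le
  · rintro y hy g rfl
    exact hfvan y hy
  · intro y hy
    obtain ⟨S, hS⟩ := isClosed_aff_iff.1 hcl
    rw [hS]
    intro g hg
    obtain ⟨c, rfl⟩ := hfdvd g fun q hq => by rw [hS] at hq; exact hq g hg
    rw [map_mul]
    exact mul_eq_zero_of_left (hy f rfl) _

end Hypersurface

/-! ### The choice of the matrix -/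

section GenericProjection

variable {n m d : ℕ}

theorem exists_algebraicIndependent_isAlgClosed (r : ℕ) :
    ∃ (Ω : Type) (_ : Field Ω) (_ : Algebra Qbar Ω) (_ : IsAlgClosed Ω) (η : Fin r → Ω),
      AlgebraicIndependent Qbar η := by
  let K := FractionRing (MvPolynomial (Fin r) Qbar)
  refine ⟨AlgebraicClosure K, inferInstance, inferInstance, inferInstance,
    fun i => algebraMap (MvPolynomial (Fin r) Qbar) (AlgebraicClosure K) (X i), ?_⟩
  have hinj : Function.Injective (algebraMap (MvPolynomial (Fin r) Qbar) (AlgebraicClosure K)) := by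
    rw [IsScalarTower.algebraMap_eq (MvPolynomial (Fin r) Qbar) K (AlgebraicClosure K)]
    exact (algebraMap K (AlgebraicClosure K)).injective.comp
      (IsFractionRing.injective (MvPolynomial (Fin r) Qbar) K)
  exact (MvPolynomial.algebraicIndependent_X (Fin r) Qbar).map' (f := IsScalarTower.toAlgHom Qbar
    (MvPolynomial (Fin r) Qbar) (AlgebraicClosure K)) hinj

/-- Integrality excludes common zeros of the forms on Z, so evaluating them at a representative
defines the map there; its values off Z are irrelevant. -/
theorem IsGenericPoint.exists_isGivenOn {k : ℕ} {E : Type*} [Field E] [Algebra Qbar E]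
    {Z : Set (Proj n)} {x : Fin (n + 1) → E} (hx : IsGenericPoint Z x) (hZ : IsClosed Z)
    {L : Fin (k + 1) → MvPolynomial (Fin (n + 1)) Qbar} (hL : ∀ i, (L i).IsHomogeneous 1)
    (hint : ∀ j, IsIntegral (Algebra.adjoin Qbar (Set.range fun i => aeval x (L i))) (x j)) :
    ∃ φ : Proj n → Proj k, IsGivenOn L Z φ := by
  classical
  refine ⟨fun p => if h : (fun i => aeval p.rep (L i)) ≠ 0 then Projectivization.mk Qbar _ h
    else affToProj fun _ => 0, fun v hv hvZ => ?_⟩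
  have h1 : (fun i => aeval v (L i)) ≠ 0 := fun h =>
    hv (hx.isConical.eq_zero_of_isIntegral hL hint ((hx.mk_mem_iff hZ v hv).1 hvZ) (congrFun h))
  obtain ⟨c, hc⟩ := Projectivization.exists_smul_eq_mk_rep Qbar v hv
  have h2 : (fun i => aeval (Projectivization.mk Qbar v hv).rep (L i)) =
      (c : Qbar) • fun i => aeval v (L i) := by
    funext i
    rw [← hc, Units.smul_def, aeval_smul_of_isHomogeneous (hL i), pow_one]
    rfl
  refine ⟨h1, ?_⟩
  simp only [h2]
  rw [dif_pos (smul_ne_zero c.ne_zero h1), mk_smul_eq _ c.ne_zero]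

theorem IsGenericPoint.apply_zero_ne_zero {X : Set (Aff n)} (hX : X.Nonempty) {E : Type*} [Field E]
    [Algebra Qbar E] {x : Fin (n + 1) → E} (hx : IsGenericPoint (projClosure X) x) : x 0 ≠ 0 := by
  intro h
  obtain ⟨p, hp⟩ := hX
  have h1 := (mem_homIdeal_projClosure (isHomogeneous_X Qbar (0 : Fin (n + 1)))).1
    ((hx.aeval_eq_zero_iff _).1 (by rw [aeval_X, h])) p hp
  simp [dehomogenize] at h1

/-- General small integral linear forms: all but the last have, together with `x₀`, no common zero
on the variety, and the last one separates the points of their fibres over a generic point and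
over a generic point at infinity. -/
theorem exists_matrix (n d : ℕ) {m : ℕ} {X : Set (Aff n)} (hXc : IsClosed X) (hXi : IsIrreducible X)
    (hdim : topologicalKrullDim X = m) (hdeg : HasDegree (projClosure X) d) {E : Type} [Field E]
    [Algebra Qbar E] {x : Fin (n + 1) → E} (hx : IsGenericPoint (projClosure X) x)
    {Ω₁ Ω₂ : Type} [Field Ω₁] [Algebra Qbar Ω₁] [Field Ω₂] [Algebra Qbar Ω₂]
    (w₁ : Fin (m + 1) → Ω₁) (w₂ : Fin (m + 1) → Ω₂) :
    ∃ A : Matrix (Fin (m + 1)) (Fin n) ℤ,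
      (∀ i j, |A i j| ≤ (((2 * (n * (d * d)) + n * d + 1) ^ n : ℕ) : ℤ)) ∧
      (AlgebraicIndependent Qbar fun i =>
        aeval x (formSystem (fun i : Fin m => castRows A i.castSucc) i)) ∧
      (∀ j, IsIntegral (Algebra.adjoin Qbar (Set.range fun i =>
        aeval x (formSystem (fun i : Fin m => castRows A i.castSucc) i))) (x j)) ∧
      Module.finrank (IntermediateField.adjoin Qbar (Set.range fun i =>
        aeval x (formSystem (fun i : Fin m => castRows A i.castSucc) i))) E = d ∧
      Set.InjOn (fun v : Fin (n + 1) → Ω₁ => aeval v (form (castRows A (Fin.last m))))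
        {v | Specializes Qbar x v ∧
          ∀ i, aeval v (formSystem (fun i : Fin m => castRows A i.castSucc) i) = w₁ i} ∧
      Set.InjOn (fun v : Fin (n + 1) → Ω₂ => aeval v (form (castRows A (Fin.last m))))
        {v | Specializes Qbar x v ∧
          ∀ i, aeval v (formSystem (fun i : Fin m => castRows A i.castSucc) i) = w₂ i} := by
  classical
  have : CharZero Ω₁ := charZero_of_injective_algebraMap (algebraMap Qbar Ω₁).injective
  have : CharZero Ω₂ := charZero_of_injective_algebraMap (algebraMap Qbar Ω₂).injective
  have hcon := hx.isConical
  have hgen := hx.adjoin_eq_top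
  have hZ := isClosed_projClosure X
  obtain ⟨r, a, ha, hya⟩ := exists_hasNoCommonZero hcon (hx.apply_zero_ne_zero hXi.1)
  obtain rfl : r = m := by
    -- The number of forms in the normalization is forced to be the dimension.
    have := (hx.topologicalKrullDim_affine_eq hXc (isHomogeneous_formSystem a) rfl hya
      (ha.isIntegral hcon)).symm.trans hdim
    exact_mod_cast this
  have hd : ∀ a : Fin r → Fin n → Qbar, HasNoCommonZero x a →
      (AlgebraicIndependent Qbar fun i => aeval x (formSystem a i)) → Module.finrank
      (IntermediateField.adjoin Qbar (Set.range fun i => aeval x (formSystem a i))) E = d :=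
    fun a ha hy => (hx.hasDegree hZ (isHomogeneous_formSystem a) hy (ha.isIntegral hcon)).unique hdeg
  obtain ⟨τ, hτ, hnc, hy⟩ := exists_hasNoCommonZero_pow hcon hgen ha hya hd
  have hint := hnc.isIntegral hcon
  obtain ⟨B₁, hB₁, hinj₁⟩ := exists_form_pow_injOn hgen hint hy (hd _ hnc hy) w₁
  obtain ⟨B₂, hB₂, hinj₂⟩ := exists_form_pow_injOn hgen hint hy (hd _ hnc hy) w₂
  -- Each of the two fibres excludes at most n * (d * d) values of t.
  obtain ⟨t, ht, htB⟩ : ∃ t ∈ Finset.range (2 * (n * (d * d)) + 1), t ∉ B₁ ∪ B₂ := by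
    apply Finset.exists_mem_notMem_of_card_lt_card
    rw [Finset.card_range]
    have := Finset.card_union_le B₁ B₂
    omega
  rw [Finset.mem_union, not_or] at htB
  have hinj₁ := hinj₁ t htB.1
  have hinj₂ := hinj₂ t htB.2
  let ρ : Fin (r + 1) → ℕ := Fin.snoc τ t
  let A : Matrix (Fin (r + 1)) (Fin n) ℤ := fun i j => (ρ i : ℤ) ^ (j : ℕ)
  have hrows : (fun i (j : Fin n) => (τ i : Qbar) ^ (j : ℕ)) =
      fun i : Fin r => castRows A i.castSucc := by
    funext i j
    simp [castRows, A, ρ]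
  have hlast : (fun j : Fin n => (t : Qbar) ^ (j : ℕ)) = castRows A (Fin.last r) := by
    funext j
    simp [castRows, A, ρ]
  -- A common bound for all rows; the 1 keeps it positive, so that its powers increase with the
  -- exponent.
  have hρ : ∀ i, ρ i ≤ 2 * (n * (d * d)) + n * d + 1 := by
    intro i
    refine Fin.lastCases ?_ (fun i => ?_) i
    · have := Finset.mem_range.1 ht
      simp only [ρ, Fin.snoc_last]
      omega
    · have := hτ i
      simp only [ρ, Fin.snoc_castSucc]
      omega
  have hdA := hd _ hnc hy
  rw [hrows] at hy hint hdA hinj₁ hinj₂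
  rw [hlast] at hinj₁ hinj₂
  refine ⟨A, fun i j => ?_, hy, hint, hdA, hinj₁, hinj₂⟩
  have hA : A i j = ((ρ i ^ (j : ℕ) : ℕ) : ℤ) := (Nat.cast_pow _ _).symm
  rw [hA, Nat.abs_cast, Nat.cast_le]
  exact (Nat.pow_le_pow_left (hρ i) j).trans
    (Nat.pow_le_pow_right (Nat.succ_pos _) j.2.le)

end GenericProjection

end BirationalProjection

/-! ### The theorem -/

theorem proposition6p2 (n d : ℕ) :
    ∃ C : ℕ, ∀ (m : ℕ) (X : Set (Aff n)), m + 2 ≤ n →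
      IsClosed X → IsIrreducible X → topologicalKrullDim X = m → HasDegree (projClosure X) d →
      ∃ (A : Matrix (Fin (m + 1)) (Fin n) ℤ) (b : Fin (m + 1) → ℤ),
        (∀ i j, |A i j| ≤ C) ∧ (∀ i, |b i| ≤ C) ∧
        AffBirationalOntoImage X (affMap A b) ∧
        (∀ y : Aff (m + 1), {x ∈ X | affMap A b x = y}.encard ≤ d) ∧
        IsClosed (affMap A b '' X) ∧ IsIrreducible (affMap A b '' X) ∧
        IsIntegralHypersurface (affMap A b '' X) d ∧
        HasDegree (projClosure (affMap A b '' X)) d ∧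
        ∃ πbar : Proj n → Proj (m + 1),
          IsInducedOn A b (projClosure X) πbar ∧
          ProjRegularOn (projClosure X) πbar ∧
          (∀ x ∈ X, πbar (affToProj x) = affToProj (affMap A b x)) ∧
          (∀ Z ∈ components (projClosure X ∩ H₀ n), ProjBirationalOntoImage Z πbar) ∧
          πbar '' projClosure X ∩ H₀ (m + 1) = πbar '' (projClosure X ∩ H₀ n) ∧
          πbar '' (projClosure X ∩ H₀ n) =
            ⋃ Z ∈ components (projClosure X ∩ H₀ n), πbar '' Z ∧
          ∀ Z ∈ components (projClosure X ∩ H₀ n),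
            IsClosed (πbar '' Z) ∧ IsIrreducible (πbar '' Z) ∧
            topologicalKrullDim (πbar '' Z) + 1 = m ∧
            ∃ e : ℕ, HasDegree Z e ∧ HasDegree (πbar '' Z) e := by
  refine ⟨(2 * (n * (d * d)) + n * d + 1) ^ n, fun m X _ hXc hXi hdim hdeg => ?_⟩
  have hZ := isClosed_projClosure X
  obtain ⟨E, _, _, x, hx⟩ := exists_isGenericPoint (isIrreducible_projClosure hXi)
  -- η₁ is a generic point of the target of the first m + 1 forms and serves X itself; (0, η₂) is
  -- generic on the hyperplane x₀ = 0 and serves all components at infinity.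
  obtain ⟨Ω₁, _, _, _, η₁, hη₁⟩ := exists_algebraicIndependent_isAlgClosed (m + 1)
  obtain ⟨Ω₂, _, _, _, η₂, hη₂⟩ := exists_algebraicIndependent_isAlgClosed m
  obtain ⟨A, hA, hy, hint, hd, hinj₁, hinj₂⟩ :=
    exists_matrix n d hXc hXi hdim hdeg hx η₁ (Fin.cons 0 η₂)
  have hL := isHomogeneous_formSystem (castRows A)
  have hprim := adjoin_singleton_eq_top_of_injOn hx.adjoin_eq_top hy hint hη₁ _ hinj₁
  have hsys : (fun i => aeval x (formSystem (fun i : Fin m => castRows A i.castSucc) i)) =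
      fun i : Fin (m + 1) => aeval x (formSystem (castRows A) i.castSucc) := by
    funext i
    rw [formSystem_castSucc]
  have hcomp : ∀ φ : Proj n → Proj (m + 1),
      IsGivenOn (formSystem (castRows A)) (projClosure X) φ →
      ∀ W ∈ components (projClosure X ∩ H₀ n), _ := fun φ hφ W hW =>
    hx.projection_component hZ hy hint hη₂ hinj₂ hφ hW
  rw [hsys] at hy hint hd hprim
  have hintL := isIntegral_of_comp hint
  have hgen : IntermediateField.adjoin Qbar
      (Set.range fun i => aeval x (formSystem (castRows A) i)) = ⊤ :=
    adjoin_range_eq_top_of_adjoin_singleton hprim (fun i => ⟨i.castSucc, rfl⟩)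
      ⟨(Fin.last m).succ, rfl⟩
  obtain ⟨φ, hφ⟩ := hx.exists_isGivenOn hZ hL hintL
  have himg := hx.image hZ hL hintL hgen hφ
  have hcl := hx.isClosed_image hZ hL hintL hφ
  have hpc := hφ.projClosure_image hXc hXi.1 hcl himg.isIrreducible
  have hdegI := (hx.dim_degree_image hZ hL hy hint hgen hφ).2
  have hclA : IsClosed (affMap A 0 '' X) := by
    rw [hφ.image_affMap hXc]
    exact hcl.preimage isInducing_affToProj.continuous
  have hirrA : IsIrreducible (affMap A 0 '' X) := by
    rw [hφ.image_affMap hXc]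
    refine himg.isIrreducible.preimage isOpenEmbedding_affToProj ?_
    obtain ⟨p, hp⟩ := hXi.1
    exact ⟨_, ⟨_, subset_closure ⟨p, hp, rfl⟩, rfl⟩, _, (hφ.affToProj_eq hp).symm⟩
  have hhyp := hx.isIntegralHypersurface_image hy hint hprim hclA hirrA (by rw [hpc]; exact himg)
  rw [hd] at hdegI hhyp
  refine ⟨A, 0, hA, fun i => ?_, hx.affBirationalOntoImage hgen, fun y => ?_, hclA, hirrA, hhyp,
    ?_, φ, ?_, hφ.projRegularOn hL, fun p hp => hφ.affToProj_eq hp,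
    fun W hW => (hcomp φ hφ W hW).1, ?_, ?_, fun W hW => (hcomp φ hφ W hW).2⟩
  · rw [Pi.zero_apply, abs_zero]
    exact Int.natCast_nonneg _
  · have h := hx.encard_fibre_le hy hint y
    rwa [hd] at h
  · rw [hpc]
    exact hdegI
  · intro v hv hvZ
    obtain ⟨h1, h2⟩ := hφ v hv hvZ
    simp only [homMap_zero_eq]
    exact ⟨h1, h2⟩
  · ext q
    constructor
    · rintro ⟨⟨p, hp, rfl⟩, hq⟩
      exact ⟨p, ⟨hp, (hφ.mem_H₀_iff hp).1 hq⟩, rfl⟩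
    · rintro ⟨p, ⟨hp, hp0⟩, rfl⟩
      exact ⟨⟨p, hp, rfl⟩, (hφ.mem_H₀_iff hp).2 hp0⟩
  · conv_lhs => rw [← iUnion_components (projClosure X ∩ H₀ n)]
    rw [Set.image_iUnion₂]
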